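/- Let ${\bf k}$ be a perfect field. Fix one of three qualities of power series over ${\bf k}$: formal; convergent with respect to a given absolute value on ${\bf k}$ (that is, $\sum_\alpha |c_\alpha|\, s^{|\alpha|}<\infty$ for some $s>0$); or algebraic over the polynomial ring. All series below have the chosen quality. Let $\mathcal B$ be the ring of such series in the variables $t,y_1,\dots,y_m$, let $\mathcal B_\circ\subset\mathcal B$ be the set of series without constant term, and let $\mathcal A_\circ$ be the set of such series in $t$ without constant term. For $h\in\mathcal B$ and $y\in\mathcal A_\circ^m$ write $h(y)=h(t,y(t))$. A map $F$ from a subset $U$ of some $\mathcal A_\circ^p$ to some $\mathcal A_\circ^q$ is called rationally textile if each coefficient of $F(y)$ is a rational function of finitely many coefficients of $y$ whose denominator vanishes nowhere on $U$; a rationally textile isomorphism is a bijective rationally textile map whose inverse is rationally textile. A subset of $\mathcal A_\circ^m$ is textile locally closed if it is the difference of two sets given by (possibly infinitely many) polynomial equations in the coefficients. Let $I\subset\mathcal B$ be an ideal generated by $f_1,\dots,f_k$, put $f=(f_1,\dots,f_k)^{T}$ and $\mathcal Y=\{y\in\mathcal A_\circ^m : h(y)=0 \text{ for all } h\in I\}$,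 and let $g$ be a $k\times k$ minor of the relative Jacobian matrix $\partial_y f$ with $g\neq 0$. Order the variables as $y=(y^1,y^2)$, where $y^1$ are the $k$ variables of the columns of $g$ and $y^2$ the other $m-k$ variables. For $d\in\mathbb N\cup\{\infty\}$ put $\mathcal Y_d=\{y\in\mathcal Y:\operatorname{ord} g(y)=d\}$ (with $\operatorname{ord}0=\infty$). For $d\in\mathbb N$ put $\mathcal V_d=t^d\mathcal A_\circ^k\times t^{2d}\mathcal A_\circ^{m-k}$; let $\mathcal R_d\cong\mathbb A_{\bf k}^{d(2m-k)}$ be the space of vectors of polynomials in $t$ without constant term, of degree $\le d$ in the first $k$ and $\le 2d$ in the last $m-k$ components; let $\pi_d(y)\in\mathcal R_d$ be the truncation of $y$, so that $y-\pi_d(y)\in\mathcal V_d$; and let $$\mathcal Z_d^*=\{z\in\mathcal R_d:\ \operatorname{ord} g(z)=d,\ f(z)\in\partial_y f(z)\cdot\mathcal V_d\}.$$ Then the following hold. (1) $\mathcal Y$ is the disjoint union of the sets $\mathcal Y_d$, $d\in\mathbb N\cup\{\infty\}$, and these are textile locally closed. (2) $\mathcal G=g\,\mathcal B_\circ^k\times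 g^2\,\mathcal B_\circ^{m-k}$ is a division module for $f$. That is, with $\Delta=\operatorname{diag}(g,\dots,g,g^2,\dots,g^2)$ and $\mathcal G(z)=\Delta(z)\cdot\mathcal A_\circ^m$, we have $\mathcal G(z)=\mathcal G(z+v)$ for all $z\in\mathcal A_\circ^m$ and $v\in\mathcal G(z)$, and there is a vector $p(t,z,a)$ of $m$ power series of the chosen quality, of order at least $2$ in $a=(a_1,\dots,a_m)$, with $$f(z+\Delta(z)a)=f(z)+\partial_yf(z)\Delta(z)a+\partial_yf(z)\Delta(z)\,p(z,a)\qquad\text{for all } z,a\in\mathcal A_\circ^m.$$ (3) Let $p$ be any vector as in (2) and let $d\in\mathbb N$. Then $\mathcal Z_d^*$ is a Zariski locally closed subset of $\mathbb A_{\bf k}^{d(2m-k)}$ and $\pi_d(\mathcal Y_d)\subset\mathcal Z_d^*$. For $y\in\mathcal Y_d$ let $z=\pi_d(y)$, let $a\in\mathcal A_\circ^m$ be the vector with $y=z+\Delta(z)a$, write $a+p(z,a)=(b^1,b^2)$ with $b^1\in\mathcal A_\circ^k$ and $b^2\in\mathcal A_\circ^{m-k}$, and let $\partial^*_{y^1}f$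 be the adjugate matrix of $\partial_{y^1}f$. Then $$y\mapsto\bigl(z,\ b^1+\partial^*_{y^1}f(z)\,\partial_{y^2}f(z)\,b^2,\ b^2\bigr)$$ is a bijection of $\mathcal Y_d$ onto the set of all $(z,e,b^2)\in\mathcal Z_d^*\times\mathcal A_\circ^k\times\mathcal A_\circ^{m-k}$ with $\partial^*_{y^1}f(z)\,f(z)+g(z)^2e=0$, and $$\Phi_d:\mathcal Y_d\to\mathcal Z_d^*\times\mathcal A_\circ^{m-k},\qquad y\mapsto(z,b^2),$$ is a rationally textile isomorphism and a homeomorphism for the $t$-adic topologies. It is an isomorphism over $\mathcal Z_d^*$: its first component is $\pi_d$. -/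

import Mathlib

open scoped PowerSeries

noncomputable section

namespace Arquile

variable {K : Type*} [Field K]

/-! ## Power series of a given quality: formal, convergent, algebraic -/

/-- The three kinds of power series over `K`. Convergence refers to an absolute value on `K`. -/
inductive Quality (K : Type*) [Field K] where
  | formal : Quality K
  | convergent (v : AbsoluteValue K ℝ) : Quality K
  | algebraic : Quality K

/-- `f = ∑ c_α x ^ α` converges: `∑ |c_α| s ^ |α| < ∞` for some radius `s > 0`. -/
def Converges (v : AbsoluteValue K ℝ) {σ : Type*} (f : MvPowerSeries σ K) : Prop :=
  ∃ s : ℝ, 0 < s ∧ Summable fun α : σ →₀ ℕ => v (MvPowerSeries.coeff α f) * s ^ α.degree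

theorem summable_of_le (v : AbsoluteValue K ℝ) {σ : Type*} {f : MvPowerSeries σ K} {r s : ℝ}
    (hr : 0 < r) (hrs : r ≤ s)
    (h : Summable fun α : σ →₀ ℕ => v (MvPowerSeries.coeff α f) * s ^ α.degree) :
    Summable fun α : σ →₀ ℕ => v (MvPowerSeries.coeff α f) * r ^ α.degree := by
  refine Summable.of_nonneg_of_le (fun α => ?_) (fun α => ?_) h
  · exact mul_nonneg (v.nonneg _) (pow_nonneg hr.le _)
  · exact mul_le_mul_of_nonneg_left (pow_le_pow_left₀ hr.le hrs _) (v.nonneg _)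

theorem Converges.exists_common (v : AbsoluteValue K ℝ) {σ : Type*} {f g : MvPowerSeries σ K}
    (hf : Converges v f) (hg : Converges v g) :
    ∃ s : ℝ, 0 < s ∧ (Summable fun α : σ →₀ ℕ => v (MvPowerSeries.coeff α f) * s ^ α.degree) ∧
      (Summable fun α : σ →₀ ℕ => v (MvPowerSeries.coeff α g) * s ^ α.degree) := by
  obtain ⟨s, hs, hsf⟩ := hf
  obtain ⟨r, hr, hrg⟩ := hg
  exact ⟨min s r, lt_min hs hr, summable_of_le v (lt_min hs hr) (min_le_left _ _) hsf,
    summable_of_le v (lt_min hs hr) (min_le_right _ _) hrg⟩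

theorem Converges.add (v : AbsoluteValue K ℝ) {σ : Type*} {f g : MvPowerSeries σ K}
    (hf : Converges v f) (hg : Converges v g) : Converges v (f + g) := by
  obtain ⟨s, hs, h1, h2⟩ := hf.exists_common v hg
  refine ⟨s, hs, Summable.of_nonneg_of_le (fun α => ?_) (fun α => ?_) (h1.add h2)⟩
  · exact mul_nonneg (v.nonneg _) (pow_nonneg hs.le _)
  · rw [map_add, ← add_mul]
    exact mul_le_mul_of_nonneg_right (v.add_le _ _) (pow_nonneg hs.le _)

theorem Converges.mul (v : AbsoluteValue K ℝ) {σ : Type*} {f g : MvPowerSeries σ K}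
    (hf : Converges v f) (hg : Converges v g) : Converges v (f * g) := by
  classical
  obtain ⟨s, hs, h1, h2⟩ := hf.exists_common v hg
  have hnn : ∀ h : MvPowerSeries σ K,
      (0 : (σ →₀ ℕ) → ℝ) ≤ fun α => v (MvPowerSeries.coeff α h) * s ^ α.degree :=
    fun h α => mul_nonneg (v.nonneg _) (pow_nonneg hs.le _)
  have h3 := Summable.mul_of_nonneg h1 h2 (hnn f) (hnn g)
  have h4 : Summable fun α : σ →₀ ℕ => ∑ p ∈ Finset.HasAntidiagonal.antidiagonal α,
      (v (MvPowerSeries.coeff p.1 f) * s ^ p.1.degree) *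
        (v (MvPowerSeries.coeff p.2 g) * s ^ p.2.degree) :=
    summable_sum_mul_antidiagonal_of_summable_mul
      (f := fun α : σ →₀ ℕ => v (MvPowerSeries.coeff α f) * s ^ α.degree)
      (g := fun α : σ →₀ ℕ => v (MvPowerSeries.coeff α g) * s ^ α.degree) h3
  refine ⟨s, hs, Summable.of_nonneg_of_le (fun α => ?_) (fun α => ?_) h4⟩
  · exact mul_nonneg (v.nonneg _) (pow_nonneg hs.le _)
  · rw [MvPowerSeries.coeff_mul]
    refine le_trans (mul_le_mul_of_nonneg_right (v.sum_le _ _) (pow_nonneg hs.le _)) ?_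
    rw [Finset.sum_mul]
    refine Finset.sum_le_sum fun p hp => le_of_eq ?_
    have hd : α.degree = p.1.degree + p.2.degree := by
      rw [← map_add, Finset.HasAntidiagonal.mem_antidiagonal.mp hp]
    rw [hd, map_mul, pow_add]
    ring

theorem converges_algebraMap (v : AbsoluteValue K ℝ) (σ : Type*) (a : K) :
    Converges v (algebraMap K (MvPowerSeries σ K) a) := by
  classical
  refine ⟨1, one_pos, summable_of_ne_finset_zero (s := {0}) fun α hα => ?_⟩
  have : α ≠ 0 := by simpa using hα
  simp [MvPowerSeries.algebraMap_apply, MvPowerSeries.coeff_C, this]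

/-- The ring of power series of quality `Q` in the variables `σ`: `K[[σ]]`, `K{σ}`, `K⟨σ⟩`. -/
def Quality.series (Q : Quality K) (σ : Type*) : Subalgebra K (MvPowerSeries σ K) :=
  match Q with
  | .formal => ⊤
  | .convergent v =>
    { carrier := {f | Converges v f}
      mul_mem' := fun hf hg => Converges.mul v hf hg
      add_mem' := fun hf hg => Converges.add v hf hg
      algebraMap_mem' := converges_algebraMap v σ }
  | .algebraic =>
    (Subalgebra.algebraicClosure (MvPolynomial σ K) (MvPowerSeries σ K)).restrictScalars K

/-- The underlying vector of formal power series of a vector of series of quality `Q`. -/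
def underlying {Q : Quality K} {σ ι : Type*} (f : ι → Q.series σ) : ι → MvPowerSeries σ K :=
  fun j => (f j : MvPowerSeries σ K)

/-- `𝒜_∘`: series in `t` of quality `Q` without constant term. -/
def arcSeries (Q : Quality K) : Set K⟦X⟧ :=
  {x | x ∈ Q.series Unit ∧ PowerSeries.constantCoeff x = 0}

/-- `𝒜_∘ ^ ι`: vectors of series of quality `Q` without constant term. -/
def arcs (Q : Quality K) (ι : Type*) : Set (ι → K⟦X⟧) :=
  {y | ∀ i, y i ∈ arcSeries Q}

/-- `f(t, y(t))`: substitution of a vector `y` of univariate series (without constant term) into a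
power series `f` in the variables `t = none` and `y_i = some i`. -/
def subst {ι : Type*} (f : MvPowerSeries (Option ι) K) (y : ι → K⟦X⟧) : K⟦X⟧ :=
  MvPowerSeries.subst (fun o : Option ι => o.elim (PowerSeries.X : K⟦X⟧) y) f

/-- The substitution is legitimate on vectors without constant term. -/
theorem hasSubst_of_mem_arcs {ι : Type*} [Finite ι] {Q : Quality K} {y : ι → K⟦X⟧}
    (hy : y ∈ arcs Q ι) :
    MvPowerSeries.HasSubst (fun o : Option ι => o.elim (PowerSeries.X : K⟦X⟧) y) := by
  refine MvPowerSeries.hasSubst_of_constantCoeff_zero fun o => ?_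
  cases o with
  | none => exact PowerSeries.constantCoeff_X
  | some i => exact (hy i).2

/-- `𝒴(I)`, the arquile variety of an ideal `I` of power series in `t, y`. -/
def variety (Q : Quality K) {ι : Type*} (I : Ideal (Q.series (Option ι))) : Set (ι → K⟦X⟧) :=
  {y | y ∈ arcs Q ι ∧ ∀ h ∈ I, subst (h : MvPowerSeries (Option ι) K) y = 0}

/-- `𝒴_d = {y ∈ 𝒴(I) : ord g(y) = d}` for `d ∈ ℕ ∪ {∞}`, where `ord 0 = ∞`. -/
def stratum (Q : Quality K) {ι : Type*} (I : Ideal (Q.series (Option ι)))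
    (g : MvPowerSeries (Option ι) K) (d : ℕ∞) : Set (ι → K⟦X⟧) :=
  {y | y ∈ variety Q I ∧ (subst g y).order = d}

/-! ## Zariski and textile notions -/

/-- The common zeros in `K ^ τ` of a set of polynomials. -/
def zeros {τ : Type*} (S : Set (MvPolynomial τ K)) : Set (τ → K) :=
  {x | ∀ P ∈ S, MvPolynomial.eval x P = 0}

/-- Zariski locally closed subsets of the affine space `K ^ τ`. -/
def IsZariskiLocallyClosed {τ : Type*} (Z : Set (τ → K)) : Prop :=
  ∃ S T : Set (MvPolynomial τ K), Z = zeros S \ zeros T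

/-- The coefficients of a vector of power series. -/
def coeffs {ι : Type*} (y : ι → K⟦X⟧) : ι × ℕ → K :=
  fun q => PowerSeries.coeff q.2 (y q.1)

/-- Textile locally closed subsets of `𝒜_∘ ^ ι`: differences of two sets that are given by (possibly
infinitely many) polynomial equations in the coefficients. -/
def IsTextileLocallyClosed (Q : Quality K) {ι : Type*} (U : Set (ι → K⟦X⟧)) : Prop :=
  ∃ S T : Set (MvPolynomial (ι × ℕ) K), U = {y | y ∈ arcs Q ι ∧ coeffs y ∈ zeros S \ zeros T}

/-- `F` is rationally textile on `U`: every coefficient of `F y` is a rational function of finitely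
many coefficients of `y`, whose denominator does not vanish on `U`. -/
def RationallyTextileOn {ι κ : Type*} (F : (ι → K⟦X⟧) → (κ → K⟦X⟧)) (U : Set (ι → K⟦X⟧)) : Prop :=
  ∀ q : κ × ℕ, ∃ N D : MvPolynomial (ι × ℕ) K, ∀ y ∈ U,
    MvPolynomial.eval (coeffs y) D ≠ 0 ∧
      coeffs (F y) q = MvPolynomial.eval (coeffs y) N / MvPolynomial.eval (coeffs y) D

/-- Continuity on `U` for the `t`-adic topologies. -/
def TAdicContinuousOn {ι κ : Type*} (F : (ι → K⟦X⟧) → (κ → K⟦X⟧)) (U : Set (ι → K⟦X⟧)) : Prop :=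
  ∀ y ∈ U, ∀ n : ℕ, ∃ r : ℕ, ∀ y' ∈ U,
    (∀ i, (PowerSeries.X : K⟦X⟧) ^ r ∣ y' i - y i) →
      ∀ j, (PowerSeries.X : K⟦X⟧) ^ n ∣ F y' j - F y j

/-- `F : U → V` is a rationally textile isomorphism: it is bijective, and `F` and its inverse are
rationally textile. -/
def IsRationallyTextileIso {ι κ : Type*} (F : (ι → K⟦X⟧) → (κ → K⟦X⟧)) (U : Set (ι → K⟦X⟧))
    (V : Set (κ → K⟦X⟧)) : Prop :=
  ∃ G : (κ → K⟦X⟧) → (ι → K⟦X⟧),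
    Set.MapsTo F U V ∧ Set.MapsTo G V U ∧ Set.InvOn G F U V ∧
      RationallyTextileOn F U ∧ RationallyTextileOn G V

/-- `F : U → V` is a homeomorphism for the `t`-adic topologies. -/
def IsTAdicHomeo {ι κ : Type*} (F : (ι → K⟦X⟧) → (κ → K⟦X⟧)) (U : Set (ι → K⟦X⟧))
    (V : Set (κ → K⟦X⟧)) : Prop :=
  ∃ G : (κ → K⟦X⟧) → (ι → K⟦X⟧),
    Set.MapsTo F U V ∧ Set.MapsTo G V U ∧ Set.InvOn G F U V ∧
      TAdicContinuousOn F U ∧ TAdicContinuousOn G V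

/-! ## Division modules

A module `𝒢 = ⟨g_1⟩ × … × ⟨g_m⟩` is given by the vector `γ = (g_1, …, g_m)`. -/

section DivisionModule

variable {k m : ℕ}

/-- The relative Jacobian matrix `∂_y f`. -/
def jac (f : Fin k → MvPowerSeries (Option (Fin m)) K) :
    Matrix (Fin k) (Fin m) (MvPowerSeries (Option (Fin m)) K) :=
  Matrix.of fun j i => MvPowerSeries.pderiv K (some i) (f j)

/-- The evaluation `f(z)` of a vector of power series. -/
def evalVec (f : Fin k → MvPowerSeries (Option (Fin m)) K) (z : Fin m → K⟦X⟧) : Fin k → K⟦X⟧ :=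
  fun j => subst (f j) z

/-- The evaluation `∂_y f(z)` of the relative Jacobian matrix. -/
def jacAt (f : Fin k → MvPowerSeries (Option (Fin m)) K) (z : Fin m → K⟦X⟧) :
    Matrix (Fin k) (Fin m) K⟦X⟧ :=
  (jac f).map fun h => subst h z

/-- `𝒢(z) = g_1(z) 𝒜_∘ × … × g_m(z) 𝒜_∘`. -/
def moduleAt (Q : Quality K) (γ : Fin m → MvPowerSeries (Option (Fin m)) K) (z : Fin m → K⟦X⟧) :
    Set (Fin m → K⟦X⟧) :=
  {v | ∀ i, ∃ x ∈ arcSeries Q, v i = subst (γ i) z * x}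

/-- `Δ_g(z) · a`, with `Δ_g = diag(g_1, …, g_m)`. -/
def scale (γ : Fin m → MvPowerSeries (Option (Fin m)) K) (z a : Fin m → K⟦X⟧) : Fin m → K⟦X⟧ :=
  fun i => subst (γ i) z * a i

/-- `p(z, a) = p(t, z(t), a(t))` for a vector `p` of series in the variables `t`, `z`, `a`. -/
def evalPair (p : Fin m → MvPowerSeries (Option (Fin m ⊕ Fin m)) K) (z a : Fin m → K⟦X⟧) :
    Fin m → K⟦X⟧ :=
  fun i => subst (p i) (Sum.elim z a)

/-- `p` is a power series vector of quality `Q` in `t, z, a`, of order at least `2` in `a`, with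
`f(z + Δ_g(z) a) = f(z) + ∂_y f(z) Δ_g(z) a + ∂_y f(z) Δ_g(z) p(z, a)` for all `z, a`. -/
structure IsTaylorRemainder (Q : Quality K) (f : Fin k → MvPowerSeries (Option (Fin m)) K)
    (γ : Fin m → MvPowerSeries (Option (Fin m)) K)
    (p : Fin m → MvPowerSeries (Option (Fin m ⊕ Fin m)) K) : Prop where
  quality : ∀ i, p i ∈ Q.series (Option (Fin m ⊕ Fin m))
  order_two : ∀ i (α : Option (Fin m ⊕ Fin m) →₀ ℕ), MvPowerSeries.coeff α (p i) ≠ 0 →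
    2 ≤ ∑ j : Fin m, α (some (Sum.inr j))
  expansion : ∀ z ∈ arcs Q (Fin m), ∀ a ∈ arcs Q (Fin m),
    evalVec f (z + scale γ z a) =
      evalVec f z + (jacAt f z).mulVec (scale γ z a) +
        (jacAt f z).mulVec (scale γ z (evalPair p z a))

/-- The module generated by the `g_i` is a division module for `f`. -/
structure IsDivisionModule (Q : Quality K) (f : Fin k → MvPowerSeries (Option (Fin m)) K)
    (γ : Fin m → MvPowerSeries (Option (Fin m)) K) : Prop where
  quality : ∀ i, γ i ∈ Q.series (Option (Fin m))
  ne_zero : ∀ i, γ i ≠ 0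
  stable : ∀ z ∈ arcs Q (Fin m), ∀ v ∈ moduleAt Q γ z, moduleAt Q γ z = moduleAt Q γ (z + v)
  taylor : ∃ p, IsTaylorRemainder Q f γ p

end DivisionModule

/-! ## The factorization

A `k × k` minor of `∂_y f` is given by the choice `c` of `k` of the `m` columns. -/

section Factorization

variable {k m : ℕ}

/-- The minor of `∂_y f` with columns `c`. -/
def minor (f : Fin k → MvPowerSeries (Option (Fin m)) K) (c : Fin k ↪ Fin m) :
    MvPowerSeries (Option (Fin m)) K :=
  ((jac f).submatrix id c).det

/-- The exponents `o_i`: `1` for the `k` columns of the minor, `2` for the other `m - k`. -/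
def expo (c : Fin k ↪ Fin m) (i : Fin m) : ℕ :=
  haveI := Classical.dec (i ∈ Set.range c)
  if i ∈ Set.range c then 1 else 2

/-- The indices of the other `m - k` variables. -/
def Rest (c : Fin k ↪ Fin m) : Type :=
  {i : Fin m // i ∉ Set.range c}

instance (c : Fin k ↪ Fin m) : Fintype (Rest c) :=
  haveI := Classical.decPred fun i : Fin m => i ∉ Set.range c
  inferInstanceAs (Fintype {i : Fin m // i ∉ Set.range c})

/-- The generators of `𝒢 = g · ℬ_∘ ^ k × g² · ℬ_∘ ^ (m - k)`. -/
def gens (f : Fin k → MvPowerSeries (Option (Fin m)) K) (c : Fin k ↪ Fin m) :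
    Fin m → MvPowerSeries (Option (Fin m)) K :=
  fun i => minor f c ^ expo c i

/-- `𝒱_d = t ^ d · 𝒜_∘ ^ k × t ^ (2 d) · 𝒜_∘ ^ (m - k)`. -/
def tailModule (Q : Quality K) (c : Fin k ↪ Fin m) (d : ℕ) : Set (Fin m → K⟦X⟧) :=
  {v | ∀ i, ∃ x ∈ arcSeries Q, v i = PowerSeries.X ^ (expo c i * d) * x}

/-- `ℛ_d`: vectors of polynomials without constant term, of degree `≤ d` in the `k` columns of the
minor and of degree `≤ 2 d` in the other `m - k`. -/
def polyVecs (K : Type*) [Field K] (c : Fin k ↪ Fin m) (d : ℕ) : Set (Fin m → K⟦X⟧) :=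
  {z | ∀ i, PowerSeries.constantCoeff (z i) = 0 ∧
    ∀ j, expo c i * d < j → PowerSeries.coeff j (z i) = 0}

/-- Indices of the coefficients of vectors in `ℛ_d`; the pair `(i, j)` is the coefficient of
`t ^ (j + 1)` in the `i`-th component. -/
abbrev PolyIdx (c : Fin k ↪ Fin m) (d : ℕ) : Type :=
  Σ i : Fin m, Fin (expo c i * d)

/-- The identification of the affine space `K ^ (d (2 m - k))` with `ℛ_d`. -/
def polyVec (c : Fin k ↪ Fin m) (d : ℕ) (x : PolyIdx c d → K) : Fin m → K⟦X⟧ :=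
  fun i => ∑ j : Fin (expo c i * d), PowerSeries.monomial (j.val + 1) (x ⟨i, j⟩)

/-- `𝒵_d^* = {z ∈ ℛ_d : ord g(z) = d, f(z) ∈ ∂_y f(z) · 𝒱_d}`. -/
def zStar (Q : Quality K) (f : Fin k → MvPowerSeries (Option (Fin m)) K) (c : Fin k ↪ Fin m)
    (d : ℕ) : Set (Fin m → K⟦X⟧) :=
  {z | z ∈ polyVecs K c d ∧ (subst (minor f c) z).order = (d : ℕ∞) ∧
    ∃ v ∈ tailModule Q c d, evalVec f z = (jacAt f z).mulVec v}

/-- The product `Z × 𝒜_∘ ^ κ` inside `𝒜_∘ ^ (ι ⊔ κ)`. -/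
def prodArcs (Q : Quality K) {ι : Type*} (Z : Set (ι → K⟦X⟧)) (κ : Type*) : Set (ι ⊕ κ → K⟦X⟧) :=
  {w | (fun i => w (Sum.inl i)) ∈ Z ∧ (fun j => w (Sum.inr j)) ∈ arcs Q κ}

/-- `π_d`: the remainder of the componentwise Weierstrass division by `t ^ d`, `t ^ (2 d)`, with
quotients in `𝒜_∘`. -/
def remainder (c : Fin k ↪ Fin m) (d : ℕ) (y : Fin m → K⟦X⟧) : Fin m → K⟦X⟧ :=
  fun i => (PowerSeries.trunc (expo c i * d + 1) (y i) : K⟦X⟧)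

/-- The quotient `v / h` of two power series, if it exists as a power series (otherwise `0`). -/
def quotient (v h : K⟦X⟧) : K⟦X⟧ :=
  haveI := Classical.dec (h ∣ v)
  if H : h ∣ v then H.choose else 0

/-- `ψ_d : y = z + v ↦ (z, v)`. -/
def psi (c : Fin k ↪ Fin m) (d : ℕ) (y : Fin m → K⟦X⟧) : (Fin m → K⟦X⟧) × (Fin m → K⟦X⟧) :=
  (remainder c d y, y - remainder c d y)

/-- The vector `a` with `v = Δ_g(z) · a`. -/
def unscale (γ : Fin m → MvPowerSeries (Option (Fin m)) K) (z v : Fin m → K⟦X⟧) : Fin m → K⟦X⟧ :=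
  fun i => quotient (v i) (subst (γ i) z)

/-- `φ_d : (z, Δ_g(z) · a) ↦ (z, Δ_g(z) · (a + p(z, a)))`. -/
def phi (γ : Fin m → MvPowerSeries (Option (Fin m)) K)
    (p : Fin m → MvPowerSeries (Option (Fin m ⊕ Fin m)) K)
    (w : (Fin m → K⟦X⟧) × (Fin m → K⟦X⟧)) : (Fin m → K⟦X⟧) × (Fin m → K⟦X⟧) :=
  (w.1, scale γ w.1 (unscale γ w.1 w.2 + evalPair p w.1 (unscale γ w.1 w.2)))

/-- The adjugate of the square submatrix of `∂_y f(z)` with columns `c`. -/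
def adjAt (f : Fin k → MvPowerSeries (Option (Fin m)) K) (c : Fin k ↪ Fin m) (z : Fin m → K⟦X⟧) :
    Matrix (Fin k) (Fin k) K⟦X⟧ :=
  ((jacAt f z).submatrix id c).adjugate

/-- The submatrix of `∂_y f(z)` of the other `m - k` columns. -/
def jacRestAt (f : Fin k → MvPowerSeries (Option (Fin m)) K) (c : Fin k ↪ Fin m)
    (z : Fin m → K⟦X⟧) : Matrix (Fin k) (Rest c) K⟦X⟧ :=
  (jacAt f z).submatrix id Subtype.val

/-- `λ_d : (z, (g(z) a_1, g(z)² a_2)) ↦ (z, a_1 + ∂_1^* f(z) · ∂_2 f(z) · a_2, a_2)`, where `∂_1^* f`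
is the adjugate matrix and `a_1`, `a_2` are the components of `a` in and outside of `c`. -/
def lam (f : Fin k → MvPowerSeries (Option (Fin m)) K) (c : Fin k ↪ Fin m)
    (w : (Fin m → K⟦X⟧) × (Fin m → K⟦X⟧)) :
    (Fin m → K⟦X⟧) × (Fin k → K⟦X⟧) × (Rest c → K⟦X⟧) :=
  let a : Fin m → K⟦X⟧ := unscale (gens f c) w.1 w.2
  let a₂ : Rest c → K⟦X⟧ := fun i => a i.1
  (w.1, (fun j => a (c j)) + (adjAt f c w.1).mulVec ((jacRestAt f c w.1).mulVec a₂), a₂)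

/-- `λ_d ∘ φ_d ∘ ψ_d`. -/
def straighten (f : Fin k → MvPowerSeries (Option (Fin m)) K) (c : Fin k ↪ Fin m)
    (p : Fin m → MvPowerSeries (Option (Fin m ⊕ Fin m)) K) (d : ℕ) (y : Fin m → K⟦X⟧) :
    (Fin m → K⟦X⟧) × (Fin k → K⟦X⟧) × (Rest c → K⟦X⟧) :=
  lam f c (phi (gens f c) p (psi c d y))

/-- The image of the stratum under `λ_d ∘ φ_d ∘ ψ_d`: triples `(z, b_1, b_2)` with `z ∈ 𝒵_d^*`,
`b_1` determined by `∂_1^* f(z) · f(z) + g(z)² · b_1 = 0`, and `b_2` arbitrary. -/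
def straightened (Q : Quality K) (f : Fin k → MvPowerSeries (Option (Fin m)) K)
    (c : Fin k ↪ Fin m) (d : ℕ) : Set ((Fin m → K⟦X⟧) × (Fin k → K⟦X⟧) × (Rest c → K⟦X⟧)) :=
  {w | w.1 ∈ zStar Q f c d ∧ w.2.1 ∈ arcs Q (Fin k) ∧ w.2.2 ∈ arcs Q (Rest c) ∧
    (adjAt f c w.1).mulVec (evalVec f w.1) + (subst (minor f c) w.1 ^ 2) • w.2.1 = 0}

/-- `Φ_d : 𝒴_d → 𝒵_d^* × 𝒜_∘ ^ (m - k)`: the map `λ_d ∘ φ_d ∘ ψ_d` with the determined component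
`b_1` omitted. -/
def factorMap (f : Fin k → MvPowerSeries (Option (Fin m)) K) (c : Fin k ↪ Fin m)
    (p : Fin m → MvPowerSeries (Option (Fin m ⊕ Fin m)) K) (d : ℕ) (y : Fin m → K⟦X⟧) :
    Fin m ⊕ Rest c → K⟦X⟧ :=
  Sum.elim (straighten f c p d y).1 (straighten f c p d y).2.2

theorem card_rest (c : Fin k ↪ Fin m) : Fintype.card (Rest c) = m - k := by
  classical
  have h : Fintype.card (Rest c) = Fintype.card {i : Fin m // ¬ i ∈ Set.range c} :=
    Fintype.card_congr (Equiv.refl _)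
  have h' : Fintype.card {i : Fin m // i ∈ Set.range c} = k := by
    rw [← Fintype.card_congr (Equiv.ofInjective c c.injective)]
    simp
  rw [h, Fintype.card_subtype_compl, h', Fintype.card_fin]

theorem card_polyIdx (c : Fin k ↪ Fin m) (d : ℕ) :
    Fintype.card (PolyIdx c d) = d * (2 * m - k) := by
  classical
  have hk : k ≤ m := by simpa using Fintype.card_le_of_embedding c
  have h1 : (Finset.univ.filter fun i : Fin m => i ∈ Set.range c).card = k := by
    have : (Finset.univ.filter fun i : Fin m => i ∈ Set.range c) = Finset.univ.image c := by
      ext i; simp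
    rw [this, Finset.card_image_of_injective _ c.injective]; simp
  have h2 : ∑ i : Fin m, expo c i + k = 2 * m := by
    have : ∀ i : Fin m, expo c i + (if i ∈ Set.range c then 1 else 0) = 2 := by
      intro i; unfold expo; split_ifs <;> simp
    have h3 := Finset.sum_congr (rfl : (Finset.univ : Finset (Fin m)) = _) fun i _ => this i
    rw [Finset.sum_add_distrib, Finset.sum_boole, h1] at h3
    simpa [mul_comm] using h3
  simp only [Fintype.card_sigma, Fintype.card_fin, ← Finset.sum_mul]
  have h3 : ∑ i : Fin m, expo c i = 2 * m - k := by omega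
  rw [h3, mul_comm]

theorem coeff_polyVec (c : Fin k ↪ Fin m) (d : ℕ) (x : PolyIdx c d → K) (i : Fin m) (n : ℕ) :
    PowerSeries.coeff n (polyVec c d x i) =
      if h : 1 ≤ n ∧ n ≤ expo c i * d then x ⟨i, ⟨n - 1, by omega⟩⟩ else 0 := by
  classical
  simp only [polyVec, map_sum, PowerSeries.coeff_monomial]
  split_ifs with h
  · rw [Finset.sum_eq_single (⟨n - 1, by omega⟩ : Fin (expo c i * d))]
    · simp [Nat.sub_add_cancel h.1]
    · intro j _ hj
      rw [if_neg]
      intro hn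
      exact hj (Fin.ext (by simp [hn]))
    · simp
  · refine Finset.sum_eq_zero fun j _ => if_neg ?_
    intro hn
    exact h (by have := j.2; omega)

/-- The identification of affine space with `ℛ_d` is a bijection. -/
theorem bijOn_polyVec (c : Fin k ↪ Fin m) (d : ℕ) :
    Set.BijOn (polyVec (K := K) c d) Set.univ (polyVecs K c d) := by
  refine ⟨fun x _ i => ⟨?_, fun j hj => ?_⟩, fun x _ y _ hxy => ?_, fun z hz => ?_⟩
  · rw [← PowerSeries.coeff_zero_eq_constantCoeff_apply, coeff_polyVec]
    simp
  · rw [coeff_polyVec, dif_neg (by omega)]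
  · funext q
    obtain ⟨i, j⟩ := q
    have h := congrArg (PowerSeries.coeff (j.val + 1)) (congrFun hxy i)
    have hj : 1 ≤ j.val + 1 ∧ j.val + 1 ≤ expo c i * d := ⟨by omega, j.2⟩
    rw [coeff_polyVec, coeff_polyVec, dif_pos hj, dif_pos hj] at h
    simpa using h
  · refine ⟨fun q => PowerSeries.coeff (q.2.val + 1) (z q.1), trivial, ?_⟩
    funext i
    ext n
    rw [coeff_polyVec]
    split_ifs with h
    · simp [Nat.sub_add_cancel h.1]
    · rcases Nat.eq_zero_or_pos n with hn | hn
      · subst hn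
        rw [PowerSeries.coeff_zero_eq_constantCoeff_apply, (hz i).1]
      · exact ((hz i).2 n (by omega)).symm

end Factorization

end Arquile

end

noncomputable section

namespace Arquile

variable {K : Type*} [Field K]

open MvPowerSeries (HasSubst)
open scoped NNReal ENNReal

/-! The point is that on a stratum the equations become affine after a change of variables. Expand
`f` at `z` along an increment `Δ(z) a`. Each component of the increment is divisible by `g(z)`, so
the part of order at least two is `g(z)² r(z, a)` for a vector `r` of series. Since `∂_{y¹} f ·
∂_{y¹}^* f = g · 1`, this vector equals `∂_y f(z) Δ(z) p` with `p = (∂_{y¹}^* f · r, 0)`: the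
nonlinear part lies in the image of the linear part (`exists_isTaylorRemainder`). Hence `f(z + Δ(z)
a) = f(z) + ∂_y f(z) Δ(z) b` with `b = a + p(z, a)`. As `p` has order two in `a`, the map `a ↦ b` is
invertible with an inverse of the same quality (`picardLimit_mem`, `solve_add_evalPair`,
`solve_apply`). Multiplying the affine equation by the adjugate loses nothing when `g(z) ≠ 0` and
gives `∂_{y¹}^* f(z) f(z) + g(z)² (b¹ + ∂_{y¹}^* f(z) ∂_{y²} f(z) b²) = 0`
(`evalVec_add_mulVec_scale_eq_zero_iff`). So the bracket is determined by `z`, and `b²` is free.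

The base point can be taken to be the truncation of `y` because moving an arc inside `𝒢(z)`
multiplies `g` by a unit (`exists_unit_subst_minor`), while `ord g(z) = d` forces `g(z) = t ^ d ·
unit` and therefore `𝒢(z) = 𝒱_d`, a module not depending on `z` (`tailModule_eq_moduleAt`). Thus `y`
and `π_d(y)` have the same order of `g`, and `y = π_d(y) + Δ(z) a`. The affine equation is solvable
exactly for `z ∈ 𝒵_d^*`, which amounts to the vanishing of the coefficients up to `2 d` of `∂_{y¹}^*
f(z) f(z)`: finitely many polynomial conditions (`mem_zStar_iff`).

Coefficients of a power series evaluated at an arc are polynomials in the coefficients of the arc.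
The only divisions are by powers of `g(z)`, whose order is constant on the stratum, so the only
denominators come from its leading coefficient, which has no zero there (`quotient_mem_seriesOver`).
Continuity follows, since each coefficient depends on finitely many others.

The quality of the series enters only through closure under substitution, division by a variable,
inversion of units, and inversion of the identity plus terms of order two. Weighted `ℓ¹`-norms give
this for convergent series, elimination and transcendence degree for algebraic ones. -/

/-! ### Algebraic power series and substitution -/

theorem isAlgebraic_of_sum_eq_zero {R A : Type*} [CommRing R] [CommRing A] [Algebra R A]
    {N : ℕ} {c : ℕ → R} {x : A} (h : ∑ i ∈ Finset.range N, c i • x ^ i = 0)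
    (hc : ∃ i < N, c i ≠ 0) : IsAlgebraic R x := by
  classical
  refine ⟨∑ i ∈ Finset.range N, Polynomial.monomial i (c i), fun h0 => ?_, ?_⟩
  · obtain ⟨i, hi, hci⟩ := hc
    have := congrArg (fun p => Polynomial.coeff p i) h0
    simp [Polynomial.finsetSum_coeff, Polynomial.coeff_monomial, hi] at this
    exact hci this
  · simpa [map_sum, Polynomial.aeval_monomial, ← Algebra.smul_def] using h

/-- Algebraicity as an explicit relation can be transported term by term, also by maps that are not
ring homomorphisms, such as homogeneous components and `leftCoeff`. -/
theorem exists_sum_eq_zero {R A : Type*} [CommRing R] [CommRing A] [Algebra R A]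
    {x : A} (h : IsAlgebraic R x) :
    ∃ (N : ℕ) (c : ℕ → R), ∑ i ∈ Finset.range N, c i • x ^ i = 0 ∧ ∃ i < N, c i ≠ 0 := by
  obtain ⟨P, hP, hx⟩ := h
  refine ⟨P.natDegree + 1, P.coeff, by rw [← Polynomial.aeval_eq_sum_range, hx],
    P.natDegree, by omega, ?_⟩
  simpa using hP

theorem coe_smul_eq {σ : Type*} (p : MvPolynomial σ K) (F : MvPowerSeries σ K) :
    p • F = (p : MvPowerSeries σ K) * F := by
  rw [Algebra.smul_def]; rfl

theorem coe_weightedHomogeneousComponent {σ : Type*} (w : σ → ℕ) (n : ℕ) (p : MvPolynomial σ K) :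
    ((MvPolynomial.weightedHomogeneousComponent w n p : MvPolynomial σ K) : MvPowerSeries σ K) =
      MvPowerSeries.weightedHomogeneousComponent w n (p : MvPowerSeries σ K) := by
  classical
  ext d
  rw [MvPolynomial.coeff_coe, MvPolynomial.coeff_weightedHomogeneousComponent,
    MvPowerSeries.coeff_weightedHomogeneousComponent, MvPolynomial.coeff_coe]

/-- The part of weight zero of an algebraic power series is algebraic. -/
theorem isAlgebraic_weightedHomogeneousComponent_zero {σ : Type*} (w : σ → ℕ)
    {F : MvPowerSeries σ K} (h : IsAlgebraic (MvPolynomial σ K) F) :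
    IsAlgebraic (MvPolynomial σ K) (MvPowerSeries.weightedHomogeneousComponent w 0 F) := by
  classical
  obtain ⟨N, c, hc, i₀, hi₀, hne⟩ := exists_sum_eq_zero h
  have hex : ∃ n : ℕ, ∃ i < N, MvPowerSeries.weightedHomogeneousComponent w n
      (c i : MvPowerSeries σ K) ≠ 0 := by
    have h0 : (c i₀ : MvPowerSeries σ K) ≠ 0 := by simpa using hne
    have h1 := (MvPowerSeries.ne_zero_iff_weightedOrder_finite w).mp h0
    exact ⟨_, i₀, hi₀, MvPowerSeries.weightedHomogeneousComponent_of_weightedOrder h1⟩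
  -- The least weight occurring in any coefficient of the relation. In weight `n` the relation reads
  -- `∑ (c i)_n · (F_0) ^ i = 0`, because no `c i` has terms of lower weight, and some `(c i)_n` is
  -- nonzero.
  set n := Nat.find hex with hn
  have hmin : ∀ i < N, (n : ℕ∞) ≤ (c i : MvPowerSeries σ K).weightedOrder w := by
    intro i hi
    by_contra hlt
    rw [not_le] at hlt
    have h0 : (c i : MvPowerSeries σ K) ≠ 0 := by
      rintro h0
      rw [h0] at hlt
      simp at hlt
    have h1 := (MvPowerSeries.ne_zero_iff_weightedOrder_finite w).mp h0
    rw [← h1] at hlt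
    exact Nat.find_min hex (by exact_mod_cast hlt) ⟨i, hi,
      MvPowerSeries.weightedHomogeneousComponent_of_weightedOrder h1⟩
  have hpow : ∀ i : ℕ, MvPowerSeries.weightedHomogeneousComponent w 0 (F ^ i) =
      (MvPowerSeries.weightedHomogeneousComponent w 0 F) ^ i := by
    intro i
    induction i with
    | zero =>
      rw [pow_zero, pow_zero]
      ext d
      rw [MvPowerSeries.coeff_weightedHomogeneousComponent, MvPowerSeries.coeff_one]
      split_ifs <;> simp_all
    | succ i ih =>
      rw [pow_succ, pow_succ, ← ih]
      exact MvPowerSeries.weightedHomogeneousComponent_mul_of_le_weightedOrder (p := 0) (q := 0)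
        (by simp) (by simp)
  refine isAlgebraic_of_sum_eq_zero (N := N)
    (c := fun i => MvPolynomial.weightedHomogeneousComponent w n (c i)) ?_ ?_
  · have := congrArg (MvPowerSeries.weightedHomogeneousComponent w n) hc
    rw [map_sum, map_zero] at this
    rw [← this]
    refine Finset.sum_congr rfl fun i hi => ?_
    rw [coe_smul_eq, coe_smul_eq, coe_weightedHomogeneousComponent, ← hpow]
    exact (MvPowerSeries.weightedHomogeneousComponent_mul_of_le_weightedOrder (p := n) (q := 0)
        (hmin i (Finset.mem_range.mp hi)) (by simp)).symm
  · obtain ⟨i, hi, h1⟩ := Nat.find_spec hex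
    refine ⟨i, hi, fun h2 => h1 ?_⟩
    rw [← coe_weightedHomogeneousComponent]
    simpa using h2

/-- The coefficient of a monomial in the variables `σ`, as a power series in the variables `τ`. -/
def leftCoeff {σ τ : Type*} (μ : σ →₀ ℕ) (F : MvPowerSeries (σ ⊕ τ) K) : MvPowerSeries τ K :=
  fun β => MvPowerSeries.coeff (Finsupp.sumElim μ β) F

theorem coeff_leftCoeff {σ τ : Type*} (μ : σ →₀ ℕ) (F : MvPowerSeries (σ ⊕ τ) K) (β : τ →₀ ℕ) :
    MvPowerSeries.coeff β (leftCoeff μ F) = MvPowerSeries.coeff (Finsupp.sumElim μ β) F := rfl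

theorem leftCoeff_sum {σ τ ι : Type*} (μ : σ →₀ ℕ) (s : Finset ι)
    (F : ι → MvPowerSeries (σ ⊕ τ) K) :
    leftCoeff μ (∑ i ∈ s, F i) = ∑ i ∈ s, leftCoeff μ (F i) := by
  ext β
  simp [coeff_leftCoeff, map_sum]

/-- A factor in the variables `τ` alone does not touch the exponents in `σ`, so extracting a
coefficient with respect to `σ` is linear over the series in `τ`. -/
theorem leftCoeff_mul_rename {σ τ : Type*} (μ : σ →₀ ℕ) (F : MvPowerSeries (σ ⊕ τ) K)
    (G : MvPowerSeries τ K) :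
    leftCoeff μ (F * MvPowerSeries.rename (Function.Embedding.inr : τ ↪ σ ⊕ τ) G) =
      leftCoeff μ F * G := by
  classical
  have hemb : ∀ β : τ →₀ ℕ, Finsupp.embDomain (Function.Embedding.inr : τ ↪ σ ⊕ τ) β =
      Finsupp.sumElim 0 β := by
    intro β
    ext (i | i)
    · rw [Finsupp.embDomain_of_notMem_range] <;> simp
    · exact Finsupp.embDomain_apply_self _ _ _
  ext β
  rw [coeff_leftCoeff, MvPowerSeries.coeff_mul, MvPowerSeries.coeff_mul]
  symm
  refine Finset.sum_of_injOn (fun q => (Finsupp.sumElim μ q.1, Finsupp.sumElim 0 q.2)) ?_ ?_ ?_ ?_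
  · rintro ⟨a, b⟩ - ⟨a', b'⟩ - hq
    simp only [Prod.mk.injEq] at hq
    refine Prod.ext ?_ ?_
    · ext i; simpa using DFunLike.congr_fun hq.1 (Sum.inr i)
    · ext i; simpa using DFunLike.congr_fun hq.2 (Sum.inr i)
  · rintro ⟨a, b⟩ hq
    simp only [Finset.mem_coe, Finset.HasAntidiagonal.mem_antidiagonal] at hq ⊢
    ext (i | i) <;> simp [← hq]
  · rintro ⟨a, b⟩ hq hnot
    rw [Finset.HasAntidiagonal.mem_antidiagonal] at hq
    -- Pairs outside the image have a second member that involves `σ`; the renamed series has no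
    -- such monomial.
    refine mul_eq_zero_of_right _ (MvPowerSeries.coeff_rename_eq_zero _ _ ?_)
    rintro ⟨b', hb'⟩
    change Finsupp.mapDomain (Function.Embedding.inr : τ ↪ σ ⊕ τ) b' = b at hb'
    rw [← Finsupp.embDomain_eq_mapDomain, hemb] at hb'
    refine hnot ⟨(a.comapDomain Sum.inr Sum.inr_injective.injOn, b'), ?_, Prod.ext ?_ hb'⟩
    · rw [Finset.mem_coe, Finset.HasAntidiagonal.mem_antidiagonal]
      ext i
      simpa [← hb'] using DFunLike.congr_fun hq (Sum.inr i)
    · ext (i | i)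
      · simpa [← hb'] using (DFunLike.congr_fun hq (Sum.inl i)).symm
      · simp
  · rintro ⟨a, b⟩ -
    rw [coeff_leftCoeff, ← hemb, MvPowerSeries.coeff_embDomain_rename]

/-- Superfluous variables are removed by comparing, in an algebraic relation, the coefficients of
one monomial `μ` in `σ`. Taking `μ` from a monomial of a nonzero coefficient keeps the new relation
nontrivial. -/
theorem isAlgebraic_of_rename_inr {σ τ : Type*} {G : MvPowerSeries τ K}
    (h : IsAlgebraic (MvPolynomial (σ ⊕ τ) K)
      (MvPowerSeries.rename (Function.Embedding.inr : τ ↪ σ ⊕ τ) G)) :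
    IsAlgebraic (MvPolynomial τ K) G := by
  classical
  obtain ⟨N, c, hc, i₀, hi₀, hne⟩ := exists_sum_eq_zero h
  obtain ⟨ν, hν⟩ := MvPolynomial.exists_coeff_ne_zero hne
  set μ : σ →₀ ℕ := ν.comapDomain Sum.inl Sum.inl_injective.injOn
  set β : τ →₀ ℕ := ν.comapDomain Sum.inr Sum.inr_injective.injOn
  have hμβ : Finsupp.sumElim μ β = ν := by
    ext (i | i) <;> simp [μ, β]
  have hpoly : ∀ p : MvPolynomial (σ ⊕ τ) K, ∃ q : MvPolynomial τ K,
      (q : MvPowerSeries τ K) = leftCoeff μ (p : MvPowerSeries (σ ⊕ τ) K) := by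
    intro p
    have hfin : (Function.support fun β : τ →₀ ℕ =>
        MvPolynomial.coeff (Finsupp.sumElim μ β) p).Finite := by
      refine Set.Finite.of_finite_image (f := fun β => Finsupp.sumElim μ β)
        (p.support.finite_toSet.subset ?_) ?_
      · rintro _ ⟨β, hβ, rfl⟩
        simpa using hβ
      · intro a _ b _ hab
        ext i
        simpa using DFunLike.congr_fun hab (Sum.inr i)
    refine ⟨∑ β ∈ hfin.toFinset, MvPolynomial.monomial β
      (MvPolynomial.coeff (Finsupp.sumElim μ β) p), ?_⟩
    ext β
    rw [MvPolynomial.coeff_coe, MvPolynomial.coeff_sum, coeff_leftCoeff, MvPolynomial.coeff_coe]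
    simp only [MvPolynomial.coeff_monomial]
    rw [Finset.sum_ite_eq']
    by_cases hβ : MvPolynomial.coeff (Finsupp.sumElim μ β) p = 0 <;> simp [hβ]
  choose q hq using hpoly
  refine isAlgebraic_of_sum_eq_zero (N := N) (c := fun i => q (c i)) ?_ ⟨i₀, hi₀, fun h0 => hν ?_⟩
  · have := congrArg (leftCoeff μ) hc
    rw [leftCoeff_sum] at this
    refine Eq.trans (Finset.sum_congr rfl fun i _ => ?_) (this.trans (by ext; rfl))
    rw [coe_smul_eq, coe_smul_eq, ← map_pow, leftCoeff_mul_rename, hq]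
  · have := congrArg (MvPowerSeries.coeff β) (hq (c i₀))
    rw [h0, coeff_leftCoeff, hμβ, MvPolynomial.coeff_coe] at this
    simpa using this.symm

theorem hasSubst_kill {τ : Type*} [Finite τ] (S : Set τ) [DecidablePred (· ∈ S)] :
    HasSubst (fun j => if j ∈ S then (0 : MvPowerSeries τ K) else MvPowerSeries.X j) :=
  MvPowerSeries.hasSubst_of_constantCoeff_zero fun j => by split_ifs <;> simp

/-- Setting the variables in `S` to zero deletes the monomials in which they occur. -/
theorem coeff_subst_kill {τ : Type*} [Finite τ] (S : Set τ) [DecidablePred (· ∈ S)]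
    (F : MvPowerSeries τ K) (e : τ →₀ ℕ) [Decidable (∀ i ∈ S, e i = 0)] :
    MvPowerSeries.coeff e (MvPowerSeries.subst
      (fun j => if j ∈ S then (0 : MvPowerSeries τ K) else MvPowerSeries.X j) F) =
      if ∀ i ∈ S, e i = 0 then MvPowerSeries.coeff e F else 0 := by
  classical
  have hprod : ∀ d : τ →₀ ℕ, (d.prod fun j k =>
      (if j ∈ S then (0 : MvPowerSeries τ K) else MvPowerSeries.X j) ^ k) =
      if ∀ i ∈ S, d i = 0 then MvPowerSeries.monomial d 1 else 0 := by
    intro d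
    split_ifs with h
    · rw [MvPowerSeries.monomial_one_eq]
      refine Finsupp.prod_congr fun s hs => ?_
      rw [if_neg]
      intro hS
      simp [h s hS] at hs
    · push Not at h
      obtain ⟨i, hi, hdi⟩ := h
      exact Finset.prod_eq_zero (i := i) (by simpa using hdi) (by simp [hi, hdi])
  rw [MvPowerSeries.coeff_subst (hasSubst_kill S), finsum_eq_single _ e, hprod]
  · split_ifs <;> simp
  · intro d hd
    rw [hprod]
    split_ifs
    · rw [MvPowerSeries.coeff_monomial_ne (Ne.symm hd), smul_zero]
    · simp

/-- With weight one on `σ` and zero on `τ`, weight zero means that no variable of `σ` occurs. So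
setting these variables to zero preserves algebraicity. -/
theorem weightedHomogeneousComponent_zero_eq_subst {σ τ : Type*} [Finite σ] [Finite τ]
    (F : MvPowerSeries (σ ⊕ τ) K) :
    MvPowerSeries.weightedHomogeneousComponent (Sum.elim (fun _ => 1) (fun _ => 0)) 0 F =
      MvPowerSeries.subst (Sum.elim (fun _ => 0) (fun j => MvPowerSeries.X (Sum.inr j)) :
        σ ⊕ τ → MvPowerSeries (σ ⊕ τ) K) F := by
  classical
  have := Fintype.ofFinite σ
  have := Fintype.ofFinite τ
  have hfun : (Sum.elim (fun _ => 0) (fun j => MvPowerSeries.X (Sum.inr j)) :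
      σ ⊕ τ → MvPowerSeries (σ ⊕ τ) K) =
      fun j => if j ∈ Set.range (Sum.inl : σ → σ ⊕ τ) then 0 else MvPowerSeries.X j := by
    funext j
    rcases j with i | i <;> simp
  ext e
  have : Finsupp.weight (Sum.elim (fun _ => 1) (fun _ => 0) : σ ⊕ τ → ℕ) e = 0 ↔
      ∀ i ∈ Set.range (Sum.inl : σ → σ ⊕ τ), e i = 0 := by
    rw [Finsupp.weight_apply, Finsupp.sum_fintype _ _ (by simp)]
    simp
  rw [hfun, coeff_subst_kill, MvPowerSeries.coeff_weightedHomogeneousComponent]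
  simp only [this]

/-- Substituting `a` directly into a relation for `f` may annihilate all its coefficients.
Substituting `θ i = x i + a i`, with new variables `x i`, is injective and keeps the relation
nontrivial. Its coefficients are algebraic, so `f(x + a)` is algebraic by transitivity, and `x` is
then set to zero and discarded. -/
theorem isAlgebraic_subst {σ τ : Type*} [Finite σ] [Finite τ] {f : MvPowerSeries σ K}
    {a : σ → MvPowerSeries τ K} (ha : ∀ i, MvPowerSeries.constantCoeff (a i) = 0)
    (hf : IsAlgebraic (MvPolynomial σ K) f) (haa : ∀ i, IsAlgebraic (MvPolynomial τ K) (a i)) :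
    IsAlgebraic (MvPolynomial τ K) (MvPowerSeries.subst a f) := by
  classical
  have hsa := MvPowerSeries.hasSubst_of_constantCoeff_zero ha
  let r : MvPowerSeries τ K →ₐ[K] MvPowerSeries (σ ⊕ τ) K :=
    MvPowerSeries.rename (Function.Embedding.inr : τ ↪ σ ⊕ τ)
  have hr : ∀ F, r F = MvPowerSeries.subst
      (MvPowerSeries.X ∘ (Function.Embedding.inr : τ ↪ σ ⊕ τ)) F :=
    fun F => MvPowerSeries.rename_eq_subst ..
  let L := Subalgebra.algebraicClosure (MvPolynomial (σ ⊕ τ) K) (MvPowerSeries (σ ⊕ τ) K)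
  let θ : σ → MvPowerSeries (σ ⊕ τ) K := fun i => MvPowerSeries.X (Sum.inl i) + r (a i)
  have hθc : ∀ i, MvPowerSeries.constantCoeff (θ i) = 0 := by
    intro i
    simp only [θ, r, map_add, MvPowerSeries.constantCoeff_X, MvPowerSeries.constantCoeff_rename, ha,
      zero_add]
  have hθ := MvPowerSeries.hasSubst_of_constantCoeff_zero hθc
  have hrenpol : ∀ p : MvPolynomial τ K, r (p : MvPowerSeries τ K) =
      ((MvPolynomial.rename Sum.inr p : MvPolynomial (σ ⊕ τ) K) : MvPowerSeries (σ ⊕ τ) K) :=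
    fun p => MvPowerSeries.rename_coe ..
  have hra : ∀ i, r (a i) ∈ L := by
    intro i
    obtain ⟨N, c, hc, j, hj, hcj⟩ := exists_sum_eq_zero (haa i)
    refine isAlgebraic_of_sum_eq_zero (N := N) (c := fun j => MvPolynomial.rename Sum.inr (c j)) ?_
      ⟨j, hj, fun h => hcj (MvPolynomial.rename_injective _ Sum.inr_injective (by simpa using h))⟩
    have := congrArg r hc
    rw [map_sum, map_zero] at this
    rw [← this]
    refine Finset.sum_congr rfl fun l _ => ?_
    rw [coe_smul_eq, coe_smul_eq, map_mul, map_pow, hrenpol]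
  have hθL : ∀ i, θ i ∈ L := by
    intro i
    refine add_mem ?_ (hra i)
    have := isAlgebraic_algebraMap (R := MvPolynomial (σ ⊕ τ) K)
      (A := MvPowerSeries (σ ⊕ τ) K) (MvPolynomial.X (Sum.inl i))
    have h2 : algebraMap (MvPolynomial (σ ⊕ τ) K) (MvPowerSeries (σ ⊕ τ) K)
      (MvPolynomial.X (Sum.inl i)) = MvPowerSeries.X (Sum.inl i) := MvPolynomial.coe_X ..
    rwa [h2] at this
  let θL : MvPolynomial σ K →ₐ[K] (L.restrictScalars K) :=
    MvPolynomial.aeval fun i => ⟨θ i, hθL i⟩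
  have hθLc : ∀ p : MvPolynomial σ K, (θL p : MvPowerSeries (σ ⊕ τ) K) =
      MvPowerSeries.subst θ (p : MvPowerSeries σ K) := by
    intro p
    rw [MvPowerSeries.subst_coe]
    have : (L.restrictScalars K).val.comp θL = MvPolynomial.aeval θ := by
      ext i
      simp [θL]
    exact DFunLike.congr_fun this p
  -- Setting the variables `τ` to zero turns `θ i` into `x i`, as `a i` has no constant term. This
  -- left inverse gives the injectivity of the substitution of `θ`.
  have hback : ∀ F : MvPowerSeries σ K, MvPowerSeries.subst
      (Sum.elim MvPowerSeries.X (fun _ => 0) : σ ⊕ τ → MvPowerSeries σ K)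
      (MvPowerSeries.subst θ F) = F := by
    intro F
    have hs : HasSubst (Sum.elim MvPowerSeries.X (fun _ => 0) : σ ⊕ τ → MvPowerSeries σ K) :=
      MvPowerSeries.hasSubst_of_constantCoeff_zero (by rintro (i | i) <;> simp)
    rw [MvPowerSeries.subst_comp_subst_apply hθ hs]
    have : (fun i => MvPowerSeries.subst
        (Sum.elim MvPowerSeries.X (fun _ => 0) : σ ⊕ τ → MvPowerSeries σ K) (θ i)) =
        MvPowerSeries.X := by
      funext i
      rw [MvPowerSeries.subst_add hs, MvPowerSeries.subst_X hs, hr,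
        MvPowerSeries.subst_comp_subst_apply (MvPowerSeries.HasSubst.X_comp _) hs]
      have h0 : (fun j => MvPowerSeries.subst
          (Sum.elim MvPowerSeries.X (fun _ => 0) : σ ⊕ τ → MvPowerSeries σ K)
          ((MvPowerSeries.X ∘ (Function.Embedding.inr : τ ↪ σ ⊕ τ)) j : MvPowerSeries (σ ⊕ τ) K))
          = (0 : τ → MvPowerSeries σ K) := by
        funext j
        exact MvPowerSeries.subst_X hs _
      rw [h0, MvPowerSeries.subst_zero_of_constantCoeff_zero (ha i)]
      simp
    rw [this, MvPowerSeries.subst_self]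
    rfl
  have hθf : IsAlgebraic (MvPolynomial (σ ⊕ τ) K) (MvPowerSeries.subst θ f) := by
    obtain ⟨N, c, hc, j, hj, hcj⟩ := exists_sum_eq_zero hf
    -- Transitivity: it is enough to be algebraic over the algebraic closure `L`, which contains the
    -- coefficients `c j (θ)`.
    refine IsAlgebraic.restrictScalars (S := L) _ ?_
    refine isAlgebraic_of_sum_eq_zero (N := N) (c := fun j => (θL (c j) : L)) ?_
      ⟨j, hj, fun h => hcj ?_⟩
    · have := congrArg (MvPowerSeries.substAlgHom (R := K) hθ) hc
      rw [map_sum, map_zero] at this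
      rw [← this]
      refine Finset.sum_congr rfl fun l _ => ?_
      rw [coe_smul_eq, map_mul, map_pow, MvPowerSeries.coe_substAlgHom, ← hθLc]
      rfl
    · have h1 : (θL (c j) : MvPowerSeries (σ ⊕ τ) K) = 0 := by
        have := congrArg (Subtype.val) h
        exact this
      rw [hθLc] at h1
      have h2 := hback (c j)
      rw [h1, ← MvPowerSeries.coe_substAlgHom (MvPowerSeries.hasSubst_of_constantCoeff_zero
        (by rintro (i | i) <;> simp)), map_zero] at h2
      exact_mod_cast h2.symm
  -- Setting `x = 0` in `f(x + a)` gives `f(a)`, still regarded as a series in `σ ⊕ τ`.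
  refine isAlgebraic_of_rename_inr (σ := σ) ?_
  have h0 := isAlgebraic_weightedHomogeneousComponent_zero
    (Sum.elim (fun _ => 1) (fun _ => 0) : σ ⊕ τ → ℕ) hθf
  rw [weightedHomogeneousComponent_zero_eq_subst] at h0
  convert h0 using 1
  have hs : HasSubst (Sum.elim (fun _ => 0) (fun j => MvPowerSeries.X (Sum.inr j)) :
      σ ⊕ τ → MvPowerSeries (σ ⊕ τ) K) :=
    MvPowerSeries.hasSubst_of_constantCoeff_zero (by rintro (i | i) <;> simp)
  change r _ = _
  rw [hr, MvPowerSeries.subst_comp_subst_apply hsa (MvPowerSeries.HasSubst.X_comp _),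
    MvPowerSeries.subst_comp_subst_apply hθ hs]
  congr 1
  funext i
  rw [MvPowerSeries.subst_add hs, MvPowerSeries.subst_X hs, hr,
    MvPowerSeries.subst_comp_subst_apply (MvPowerSeries.HasSubst.X_comp _) hs]
  simp only [Sum.elim_inl, zero_add]
  congr 1
  funext j
  exact (MvPowerSeries.subst_X (R := K) hs (Sum.inr j)).symm

/-! ### Convergent power series and weighted `ℓ¹`-norms -/

/-- The weighted `ℓ¹`-norm `∑ |c_α| s ^ |α|`. -/
def wnorm (v : AbsoluteValue K ℝ) (s : ℝ≥0) {σ : Type*} (f : MvPowerSeries σ K) : ℝ≥0∞ :=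
  ∑' α : σ →₀ ℕ, ENNReal.ofReal (v (MvPowerSeries.coeff α f)) * (s : ℝ≥0∞) ^ α.degree

/-- With values in `ℝ≥0∞` the norm always exists and sums may be interchanged freely; convergence is
then proved by a finite bound. -/
theorem wnorm_ne_top_iff (v : AbsoluteValue K ℝ) (s : ℝ≥0) {σ : Type*} (f : MvPowerSeries σ K) :
    wnorm v s f ≠ ⊤ ↔
      Summable fun α : σ →₀ ℕ => v (MvPowerSeries.coeff α f) * (s : ℝ) ^ α.degree := by
  have : ∀ α : σ →₀ ℕ, ENNReal.ofReal (v (MvPowerSeries.coeff α f)) * (s : ℝ≥0∞) ^ α.degree =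
      ((Real.toNNReal (v (MvPowerSeries.coeff α f)) * s ^ α.degree : ℝ≥0) : ℝ≥0∞) := by
    intro α
    rw [ENNReal.coe_mul, ENNReal.coe_pow]
    rfl
  unfold wnorm
  simp only [this]
  rw [ENNReal.tsum_coe_ne_top_iff_summable, ← NNReal.summable_coe]
  simp only [NNReal.coe_mul, NNReal.coe_pow, Real.coe_toNNReal _ (v.nonneg _)]

theorem converges_iff (v : AbsoluteValue K ℝ) {σ : Type*} (f : MvPowerSeries σ K) :
    Converges v f ↔ ∃ s : ℝ≥0, 0 < s ∧ wnorm v s f ≠ ⊤ := by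
  constructor
  · rintro ⟨s, hs, h⟩
    exact ⟨⟨s, hs.le⟩, hs, (wnorm_ne_top_iff v _ f).mpr h⟩
  · rintro ⟨s, hs, h⟩
    exact ⟨s, hs, (wnorm_ne_top_iff v _ f).mp h⟩

section WeightedNorm

variable (v : AbsoluteValue K ℝ)

theorem wnorm_mono {r s : ℝ≥0} (h : r ≤ s) {σ : Type*} (f : MvPowerSeries σ K) :
    wnorm v r f ≤ wnorm v s f := by
  unfold wnorm
  gcongr

theorem wnorm_add_le (s : ℝ≥0) {σ : Type*} (f g : MvPowerSeries σ K) :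
    wnorm v s (f + g) ≤ wnorm v s f + wnorm v s g := by
  unfold wnorm
  rw [← ENNReal.tsum_add]
  refine ENNReal.tsum_le_tsum fun α => ?_
  rw [← add_mul, ← ENNReal.ofReal_add (v.nonneg _) (v.nonneg _), map_add]
  gcongr
  exact v.add_le _ _

theorem wnorm_neg (s : ℝ≥0) {σ : Type*} (f : MvPowerSeries σ K) :
    wnorm v s (-f) = wnorm v s f := by
  simp [wnorm]

theorem wnorm_one_le (s : ℝ≥0) {σ : Type*} : wnorm v s (1 : MvPowerSeries σ K) ≤ 1 := by
  classical
  unfold wnorm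
  rw [tsum_eq_single 0]
  · simp
  · intro α hα
    simp [MvPowerSeries.coeff_one, hα]

theorem wnorm_X_le (s : ℝ≥0) {σ : Type*} (i : σ) :
    wnorm v s (MvPowerSeries.X i : MvPowerSeries σ K) ≤ s := by
  classical
  unfold wnorm
  rw [tsum_eq_single (Finsupp.single i 1)]
  · simp [MvPowerSeries.coeff_X]
  · intro α hα
    simp [MvPowerSeries.coeff_X, hα]

theorem wnorm_mul_le (s : ℝ≥0) {σ : Type*} (f g : MvPowerSeries σ K) :
    wnorm v s (f * g) ≤ wnorm v s f * wnorm v s g := by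
  classical
  set A : (σ →₀ ℕ) → ℝ≥0∞ :=
    fun α => ENNReal.ofReal (v (MvPowerSeries.coeff α f)) * (s : ℝ≥0∞) ^ α.degree with hA
  set B : (σ →₀ ℕ) → ℝ≥0∞ :=
    fun α => ENNReal.ofReal (v (MvPowerSeries.coeff α g)) * (s : ℝ≥0∞) ^ α.degree with hB
  have h1 : ∀ α : σ →₀ ℕ,
      ENNReal.ofReal (v (MvPowerSeries.coeff α (f * g))) * (s : ℝ≥0∞) ^ α.degree ≤
        ∑' p : Finset.HasAntidiagonal.antidiagonal α, A p.1.1 * B p.1.2 := by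
    intro α
    rw [Finset.tsum_subtype (Finset.HasAntidiagonal.antidiagonal α) fun p => A p.1 * B p.2,
      MvPowerSeries.coeff_mul]
    refine le_trans (mul_le_mul_left (ENNReal.ofReal_le_ofReal (v.sum_le _ _)) _) ?_
    rw [ENNReal.ofReal_sum_of_nonneg fun _ _ => v.nonneg _, Finset.sum_mul]
    refine Finset.sum_le_sum fun p hp => le_of_eq ?_
    have hd : α.degree = p.1.degree + p.2.degree := by
      rw [← map_add, Finset.HasAntidiagonal.mem_antidiagonal.mp hp]
    rw [hd, map_mul, ENNReal.ofReal_mul (v.nonneg _), pow_add]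
    ring
  calc wnorm v s (f * g) ≤
      ∑' (α : σ →₀ ℕ) (p : Finset.HasAntidiagonal.antidiagonal α), A p.1.1 * B p.1.2 :=
        ENNReal.tsum_le_tsum h1
    _ = ∑' q : Σ α : σ →₀ ℕ, Finset.HasAntidiagonal.antidiagonal α, A q.2.1.1 * B q.2.1.2 :=
        (ENNReal.tsum_sigma' (fun q : Σ α : σ →₀ ℕ, Finset.HasAntidiagonal.antidiagonal α =>
          A q.2.1.1 * B q.2.1.2)).symm
    _ = ∑' p : (σ →₀ ℕ) × (σ →₀ ℕ), A p.1 * B p.2 :=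
        (Finset.HasAntidiagonal.sigmaAntidiagonalEquivProd (A := σ →₀ ℕ)).tsum_eq
          (fun p : (σ →₀ ℕ) × (σ →₀ ℕ) => A p.1 * B p.2)
    _ = wnorm v s f * wnorm v s g := by
        rw [ENNReal.tsum_prod']
        simp only [ENNReal.tsum_mul_left, ENNReal.tsum_mul_right]
        rfl

theorem wnorm_pow_le (s : ℝ≥0) {σ : Type*} (f : MvPowerSeries σ K) (n : ℕ) :
    wnorm v s (f ^ n) ≤ wnorm v s f ^ n := by
  induction n with
  | zero => simpa using wnorm_one_le v s
  | succ n ih =>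
    rw [pow_succ, pow_succ]
    exact (wnorm_mul_le v s _ _).trans (mul_le_mul_left ih _)

theorem wnorm_prod_le (s : ℝ≥0) {σ ι : Type*} (t : Finset ι) (f : ι → MvPowerSeries σ K) :
    wnorm v s (∏ i ∈ t, f i) ≤ ∏ i ∈ t, wnorm v s (f i) := by
  classical
  induction t using Finset.induction_on with
  | empty => simpa using wnorm_one_le v s
  | insert i t hi ih =>
    rw [Finset.prod_insert hi, Finset.prod_insert hi]
    exact (wnorm_mul_le v s _ _).trans (mul_le_mul_right ih _)

theorem ofReal_finsum_le {ι : Type*} (u : ι → K) :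
    ENNReal.ofReal (v (finsum u)) ≤ ∑' i, ENNReal.ofReal (v (u i)) := by
  classical
  by_cases h : u.HasFiniteSupport
  · rw [finsum_eq_sum u h]
    calc ENNReal.ofReal (v (∑ i ∈ h.toFinset, u i)) ≤
        ENNReal.ofReal (∑ i ∈ h.toFinset, v (u i)) := ENNReal.ofReal_le_ofReal (v.sum_le _ _)
      _ = ∑ i ∈ h.toFinset, ENNReal.ofReal (v (u i)) :=
        ENNReal.ofReal_sum_of_nonneg fun _ _ => v.nonneg _
      _ ≤ _ := ENNReal.sum_le_tsum _
  -- A `finsum` with infinite support is zero by convention, which makes the bound trivial.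
  · rw [finsum_of_not_hasFiniteSupport h]
    simp

/-- The majorant principle: the triangle inequality bounds the norm of `f(a)` by `∑ |c_d| ‖a ^ d‖`,
and submultiplicativity gives `‖a ^ d‖ ≤ r ^ |d|`. -/
theorem wnorm_subst_le {σ τ : Type*} {a : σ → MvPowerSeries τ K} (ha : HasSubst a)
    {r s : ℝ≥0} (h : ∀ i, wnorm v s (a i) ≤ r) (f : MvPowerSeries σ K) :
    wnorm v s (MvPowerSeries.subst a f) ≤ wnorm v r f := by
  set m : (σ →₀ ℕ) → MvPowerSeries τ K := fun d => d.prod fun i k => a i ^ k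
  calc wnorm v s (MvPowerSeries.subst a f)
      ≤ ∑' (e : τ →₀ ℕ) (d : σ →₀ ℕ), ENNReal.ofReal (v (MvPowerSeries.coeff d f)) *
          (ENNReal.ofReal (v (MvPowerSeries.coeff e (m d))) * (s : ℝ≥0∞) ^ e.degree) := by
        refine ENNReal.tsum_le_tsum fun e => ?_
        rw [MvPowerSeries.coeff_subst ha]
        refine le_trans (mul_le_mul_left (ofReal_finsum_le v _) _) ?_
        rw [← ENNReal.tsum_mul_right]
        refine ENNReal.tsum_le_tsum fun d => le_of_eq ?_
        rw [smul_eq_mul, map_mul, ENNReal.ofReal_mul (v.nonneg _), mul_assoc]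
    _ = ∑' d : σ →₀ ℕ, ENNReal.ofReal (v (MvPowerSeries.coeff d f)) * wnorm v s (m d) := by
        rw [ENNReal.tsum_comm]
        simp only [ENNReal.tsum_mul_left]
        rfl
    _ ≤ wnorm v r f := by
        refine ENNReal.tsum_le_tsum fun d => mul_le_mul_right ?_ _
        refine (wnorm_prod_le v s _ _).trans ?_
        rw [Finsupp.degree_apply, ← Finset.prod_pow_eq_pow_sum]
        exact Finset.prod_le_prod' fun i _ => (wnorm_pow_le v s _ _).trans (pow_le_pow_left' (h i) _)

/-- If `f` has order at least `n`, its norms shrink like the `n`-th power of the radius. -/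
theorem wnorm_mul_le_of_order {σ : Type*} {f : MvPowerSeries σ K} {n : ℕ}
    (h : ∀ α : σ →₀ ℕ, α.degree < n → MvPowerSeries.coeff α f = 0) {c : ℝ≥0} (hc : c ≤ 1)
    (s : ℝ≥0) : wnorm v (c * s) f ≤ c ^ n * wnorm v s f := by
  unfold wnorm
  rw [← ENNReal.tsum_mul_left]
  refine ENNReal.tsum_le_tsum fun α => ?_
  by_cases hα : α.degree < n
  · simp [h α hα]
  · rw [ENNReal.coe_mul, mul_pow]
    have : (c : ℝ≥0∞) ^ α.degree ≤ (c : ℝ≥0∞) ^ n :=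
      pow_le_pow_right_of_le_one' (by exact_mod_cast hc) (not_lt.mp hα)
    calc _ = (c : ℝ≥0∞) ^ α.degree * (ENNReal.ofReal (v (MvPowerSeries.coeff α f)) *
          (s : ℝ≥0∞) ^ α.degree) := by ring
      _ ≤ _ := mul_le_mul_left this _

/-- Without constant term the series has order at least one, so shrinking the radius by the factor
`c` shrinks the norm by at least this factor. -/
theorem exists_wnorm_le {σ : Type*} {f : MvPowerSeries σ K} (hf : Converges v f)
    (hf0 : MvPowerSeries.constantCoeff f = 0) {r : ℝ≥0} (hr : 0 < r) :
    ∃ s : ℝ≥0, 0 < s ∧ wnorm v s f ≤ r := by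
  obtain ⟨s, hs, hfs⟩ := (converges_iff v f).mp hf
  lift wnorm v s f to ℝ≥0 using hfs with C hC
  have hc : ∃ c : ℝ≥0, 0 < c ∧ c ≤ 1 ∧ c * C ≤ r := by
    refine ⟨min 1 (r / (C + 1)), by positivity, min_le_left _ _, ?_⟩
    calc min 1 (r / (C + 1)) * C ≤ r / (C + 1) * (C + 1) := by
          gcongr
          · exact min_le_right _ _
          · simp
      _ = r := div_mul_cancel₀ _ (by positivity)
  obtain ⟨c, hc0, hc1, hcC⟩ := hc
  refine ⟨c * s, by positivity, ?_⟩
  refine (wnorm_mul_le_of_order v (n := 1) ?_ hc1 s).trans ?_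
  · intro α hα
    have : α = 0 := by
      rw [← Finsupp.degree_eq_zero_iff]; omega
    rw [this, MvPowerSeries.coeff_zero_eq_constantCoeff_apply, hf0]
  · rw [← hC, pow_one]
    exact_mod_cast hcC

/-- At a small common radius all `a i` have norm at most a radius `r` of convergence of `f`;
finiteness of `σ` provides the common radius. -/
theorem converges_subst {σ τ : Type*} [Finite σ] {f : MvPowerSeries σ K}
    {a : σ → MvPowerSeries τ K} (ha : ∀ i, MvPowerSeries.constantCoeff (a i) = 0)
    (hf : Converges v f) (haa : ∀ i, Converges v (a i)) :
    Converges v (MvPowerSeries.subst a f) := by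
  have := Fintype.ofFinite σ
  have hsa := MvPowerSeries.hasSubst_of_constantCoeff_zero ha
  obtain ⟨r, hr, hfr⟩ := (converges_iff v f).mp hf
  choose s hs hsr using fun i => exists_wnorm_le v (haa i) (ha i) hr
  obtain ⟨s₀, hs₀, hle⟩ : ∃ s₀ : ℝ≥0, 0 < s₀ ∧ ∀ i, s₀ ≤ s i := by
    rcases isEmpty_or_nonempty σ with h | h
    · exact ⟨1, one_pos, fun i => h.elim i⟩
    · obtain ⟨i, hi⟩ := Finite.exists_min s
      exact ⟨s i, hs i, hi⟩
  refine (converges_iff v _).mpr ⟨s₀, hs₀, ne_top_of_le_ne_top hfr ?_⟩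
  exact wnorm_subst_le v hsa (fun i => (wnorm_mono v (hle i) _).trans (hsr i)) f

/-- Division by a variable only shifts the exponents, which costs the factor `s⁻¹`. -/
theorem converges_of_X_mul {σ : Type*} {i : σ} {f : MvPowerSeries σ K}
    (h : Converges v (MvPowerSeries.X i * f)) : Converges v f := by
  obtain ⟨s, hs, h⟩ := h
  refine ⟨s, hs, ?_⟩
  have h1 := h.comp_injective (add_right_injective (Finsupp.single i 1))
  have h2 := h1.mul_left s⁻¹
  refine h2.congr fun α => ?_
  simp only [Function.comp_apply, map_add, Finsupp.degree_single]
  rw [MvPowerSeries.X, MvPowerSeries.coeff_add_monomial_mul, one_mul, pow_add, pow_one]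
  field_simp

end WeightedNorm

section Subst

variable {σ τ ι : Type*} {a : σ → MvPowerSeries τ K}

theorem subst_zero (ha : HasSubst a) : MvPowerSeries.subst a (0 : MvPowerSeries σ K) = 0 := by
  rw [← MvPowerSeries.coe_substAlgHom ha, map_zero]

theorem subst_sum (ha : HasSubst a) (s : Finset ι) (f : ι → MvPowerSeries σ K) :
    MvPowerSeries.subst a (∑ i ∈ s, f i) = ∑ i ∈ s, MvPowerSeries.subst a (f i) := by
  rw [← MvPowerSeries.coe_substAlgHom ha, map_sum]

end Subst

/-! ### Closure properties of the power series of a given quality -/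

theorem mem_series_algebraic {σ : Type*} {f : MvPowerSeries σ K} :
    f ∈ (Quality.algebraic : Quality K).series σ ↔ IsAlgebraic (MvPolynomial σ K) f := Iff.rfl

theorem mem_series_formal {σ : Type*} (f : MvPowerSeries σ K) :
    f ∈ (Quality.formal : Quality K).series σ := Algebra.mem_top

namespace Quality

theorem X_mem (Q : Quality K) {σ : Type*} (i : σ) : MvPowerSeries.X i ∈ Q.series σ := by
  cases Q with
  | formal => exact mem_series_formal _
  | convergent v =>
    exact (converges_iff v _).mpr ⟨1, one_pos, ne_top_of_le_ne_top (by simp) (wnorm_X_le v 1 i)⟩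
  | algebraic =>
    have := isAlgebraic_algebraMap (R := MvPolynomial σ K) (A := MvPowerSeries σ K)
      (MvPolynomial.X i)
    rwa [show algebraMap (MvPolynomial σ K) (MvPowerSeries σ K) (MvPolynomial.X i) =
      MvPowerSeries.X i from MvPolynomial.coe_X ..] at this

theorem subst_mem (Q : Quality K) {σ τ : Type*} [Finite σ] [Finite τ] {f : MvPowerSeries σ K}
    {a : σ → MvPowerSeries τ K} (ha : ∀ i, MvPowerSeries.constantCoeff (a i) = 0)
    (hf : f ∈ Q.series σ) (haa : ∀ i, a i ∈ Q.series τ) :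
    MvPowerSeries.subst a f ∈ Q.series τ := by
  cases Q with
  | formal => exact mem_series_formal _
  | convergent v => exact converges_subst v ha hf haa
  | algebraic => exact isAlgebraic_subst ha hf haa

/-- The division property behind all Taylor formulas below: their coefficients arise by repeated
division by variables and so keep the quality. -/
theorem mem_of_X_mul_mem (Q : Quality K) {σ : Type*} {i : σ} {f : MvPowerSeries σ K}
    (h : MvPowerSeries.X i * f ∈ Q.series σ) : f ∈ Q.series σ := by
  cases Q with
  | formal => exact mem_series_formal _
  | convergent v => exact converges_of_X_mul v h
  | algebraic =>
    exact IsAlgebraic.of_mul (MvPowerSeries.X_mem_nonzeroDivisors (i := i))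
      (X_mem .algebraic i) h

theorem C_mem (Q : Quality K) {σ : Type*} (a : K) : MvPowerSeries.C a ∈ Q.series σ :=
  (Q.series σ).algebraMap_mem a

/-- The geometric series `∑ t ^ n`. Inverses of units in any number of variables are obtained by
substitution into it. -/
theorem invOneSubPow_mem (Q : Quality K) : (PowerSeries.mk 1 : K⟦X⟧) ∈ Q.series Unit := by
  cases Q with
  | formal => exact mem_series_formal _
  | convergent v =>
    refine ⟨1 / 2, by norm_num, ?_⟩
    have h := (summable_geometric_of_lt_one (r := (1 / 2 : ℝ)) (by norm_num) (by norm_num))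
    have hinj : Function.Injective (fun α : Unit →₀ ℕ => α.degree) := by
      intro a b hab
      ext
      simpa [Finsupp.degree_eq_sum] using hab
    refine (h.comp_injective hinj).congr fun α => ?_
    have : MvPowerSeries.coeff α (PowerSeries.mk 1 : K⟦X⟧) = 1 := rfl
    rw [this]
    simp
  | algebraic =>
    have h1 : (PowerSeries.X - 1 : K⟦X⟧) * (PowerSeries.mk 1 : K⟦X⟧) = -1 := by
      have := PowerSeries.mk_one_mul_one_sub_eq_one K
      linear_combination -this
    refine IsAlgebraic.of_mul (y := (PowerSeries.X - 1 : K⟦X⟧)) ?_ ?_ ?_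
    · refine mem_nonZeroDivisors_of_ne_zero fun h => ?_
      rw [h, zero_mul] at h1
      exact one_ne_zero (neg_eq_zero.mp h1.symm)
    · exact mem_series_algebraic.mp (sub_mem (X_mem .algebraic ()) (one_mem _))
    · rw [h1]
      exact mem_series_algebraic.mp (neg_mem (one_mem _))

/-- The inverse of a unit of the power series ring has the same quality. -/
theorem inv_mem (Q : Quality K) {σ : Type*} [Finite σ] {f : MvPowerSeries σ K}
    (hf : f ∈ Q.series σ) (h0 : MvPowerSeries.constantCoeff f ≠ 0) :
    ∃ g ∈ Q.series σ, f * g = 1 := by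
  set c := MvPowerSeries.constantCoeff f
  -- Here `f = c (1 - u)` and `u` has no constant term, so the inverse is `c⁻¹ ∑ u ^ n`.
  set u : MvPowerSeries σ K := 1 - MvPowerSeries.C c⁻¹ * f
  have hu : u ∈ Q.series σ := sub_mem (one_mem _) (mul_mem (Q.C_mem _) hf)
  have hu0 : MvPowerSeries.constantCoeff u = 0 := by
    simp only [u, map_sub, map_mul, map_one, MvPowerSeries.constantCoeff_C]
    rw [inv_mul_cancel₀ h0, sub_self]
  have hs : HasSubst (fun _ : Unit => u) :=
    MvPowerSeries.hasSubst_of_constantCoeff_zero fun _ => hu0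
  refine ⟨MvPowerSeries.C c⁻¹ * MvPowerSeries.subst (fun _ : Unit => u) (PowerSeries.mk 1 : K⟦X⟧),
    mul_mem (Q.C_mem _) (Q.subst_mem (fun _ => hu0) Q.invOneSubPow_mem fun _ => hu), ?_⟩
  have h := congrArg (MvPowerSeries.substAlgHom (R := K) hs) (PowerSeries.mk_one_mul_one_sub_eq_one K)
  rw [map_mul, map_sub, map_one] at h
  have hX : MvPowerSeries.substAlgHom (R := K) hs (PowerSeries.X : K⟦X⟧) = u :=
    MvPowerSeries.substAlgHom_X hs ()
  rw [hX, MvPowerSeries.coe_substAlgHom] at h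
  rw [← h]
  simp only [u]
  ring

end Quality

/-! ### The ideals of power series of order at least `n` -/

/-- The power series all of whose exponents have weight at least `n`. -/
def weightIdeal (K : Type*) [Field K] {σ : Type*} (w : (σ →₀ ℕ) →+ ℕ) (n : ℕ) :
    Ideal (MvPowerSeries σ K) where
  carrier := {f | ∀ α : σ →₀ ℕ, w α < n → MvPowerSeries.coeff α f = 0}
  add_mem' := fun ha hb α hα => by rw [map_add, ha α hα, hb α hα, add_zero]
  zero_mem' := fun α _ => map_zero _
  smul_mem' := fun c f hf α hα => by
    classical
    rw [smul_eq_mul, MvPowerSeries.coeff_mul]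
    refine Finset.sum_eq_zero fun p hp => ?_
    have hd : w α = w p.1 + w p.2 := by
      rw [← map_add, Finset.HasAntidiagonal.mem_antidiagonal.mp hp]
    rw [hf p.2 (by omega), mul_zero]

theorem mul_mem_weightIdeal {σ : Type*} {w : (σ →₀ ℕ) →+ ℕ} {m n : ℕ} {f g : MvPowerSeries σ K}
    (hf : f ∈ weightIdeal K w m) (hg : g ∈ weightIdeal K w n) :
    f * g ∈ weightIdeal K w (m + n) := by
  classical
  intro α hα
  rw [MvPowerSeries.coeff_mul]
  refine Finset.sum_eq_zero fun p hp => ?_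
  have hd : w α = w p.1 + w p.2 := by
    rw [← map_add, Finset.HasAntidiagonal.mem_antidiagonal.mp hp]
  by_cases h : w p.1 < m
  · rw [hf _ h, zero_mul]
  · rw [hg _ (by omega), mul_zero]

/-- The power series of order at least `n`. -/
def ordIdeal (K : Type*) [Field K] (σ : Type*) (n : ℕ) : Ideal (MvPowerSeries σ K) :=
  weightIdeal K Finsupp.degree n

theorem mem_ordIdeal_zero {σ : Type*} (f : MvPowerSeries σ K) : f ∈ ordIdeal K σ 0 :=
  fun _ h => absurd h (Nat.not_lt_zero _)

theorem mem_ordIdeal_one {σ : Type*} {f : MvPowerSeries σ K} :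
    f ∈ ordIdeal K σ 1 ↔ MvPowerSeries.constantCoeff f = 0 := by
  constructor
  · intro h
    have := h 0 (by simp)
    simpa using this
  · intro h α hα
    have : α = 0 := by
      rw [← Finsupp.degree_eq_zero_iff]; omega
    rw [this, MvPowerSeries.coeff_zero_eq_constantCoeff_apply, h]

theorem mul_mem_ordIdeal {σ : Type*} {m n : ℕ} {f g : MvPowerSeries σ K}
    (hf : f ∈ ordIdeal K σ m) (hg : g ∈ ordIdeal K σ n) : f * g ∈ ordIdeal K σ (m + n) :=
  mul_mem_weightIdeal hf hg

theorem ordIdeal_anti {σ : Type*} {m n : ℕ} (h : m ≤ n) : ordIdeal K σ n ≤ ordIdeal K σ m :=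
  fun _ hf α hα => hf α (hα.trans_le h)

theorem eq_of_forall_sub_mem_ordIdeal {σ : Type*} {f g : MvPowerSeries σ K}
    (h : ∀ n, f - g ∈ ordIdeal K σ n) : f = g := by
  ext α
  have := h (α.degree + 1) α (by omega)
  rwa [map_sub, sub_eq_zero] at this

theorem X_mem_ordIdeal {σ : Type*} (i : σ) : MvPowerSeries.X i ∈ ordIdeal K σ 1 :=
  mem_ordIdeal_one.mpr (MvPowerSeries.constantCoeff_X i)

/-! ### Division by variables and Taylor expansion -/

/-- A power series is the sum of its restriction to a coordinate subspace and of a combination of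
the equations of this subspace, with coefficients of the same quality. -/
theorem exists_eq_kill_add (Q : Quality K) {τ : Type*} [Finite τ] [DecidableEq τ] (S : Finset τ)
    {G : MvPowerSeries τ K} (hG : G ∈ Q.series τ) :
    ∃ c : τ → MvPowerSeries τ K, (∀ i, c i ∈ Q.series τ) ∧
      G = MvPowerSeries.subst (fun j => if j ∈ (S : Set τ) then (0 : MvPowerSeries τ K) else
        MvPowerSeries.X j) G + ∑ i ∈ S, MvPowerSeries.X i * c i := by
  induction S using Finset.induction_on with
  | empty =>
    refine ⟨0, fun i => zero_mem _, ?_⟩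
    ext e
    rw [Finset.sum_empty, add_zero, coeff_subst_kill]
    simp
  | insert i S hi ih =>
    obtain ⟨c, hc, hGc⟩ := ih
    set G' := MvPowerSeries.subst (fun j => if j ∈ (S : Set τ) then (0 : MvPowerSeries τ K) else
        MvPowerSeries.X j) G with hG'
    set G'' := MvPowerSeries.subst (fun j => if j ∈ ((insert i S : Finset τ) : Set τ) then
        (0 : MvPowerSeries τ K) else MvPowerSeries.X j) G with hG''
    have hkill : ∀ S : Set τ, ∀ [DecidablePred (· ∈ S)], MvPowerSeries.subst (fun j => if j ∈ S then
        (0 : MvPowerSeries τ K) else MvPowerSeries.X j) G ∈ Q.series τ := by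
      intro S _
      refine Q.subst_mem (fun j => ?_) hG fun j => ?_
      · split_ifs <;> simp
      · split_ifs
        · exact zero_mem _
        · exact Q.X_mem j
    -- The two restrictions differ only in monomials that contain the variable of index `i`.
    obtain ⟨d, hd⟩ : MvPowerSeries.X i ∣ G' - G'' := by
      rw [MvPowerSeries.X_dvd_iff]
      intro e he
      rw [map_sub, hG', hG'', coeff_subst_kill, coeff_subst_kill]
      have : (∀ j ∈ ((insert i S : Finset τ) : Set τ), e j = 0) ↔ ∀ j ∈ (S : Set τ), e j = 0 := by
        simp [he]
      simp only [this, sub_self]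
    have hdQ : d ∈ Q.series τ := Q.mem_of_X_mul_mem (by rw [← hd]; exact sub_mem (hkill _) (hkill _))
    refine ⟨Function.update c i d, fun j => ?_, ?_⟩
    · rcases eq_or_ne j i with rfl | hj
      · rwa [Function.update_self]
      · rw [Function.update_of_ne hj]; exact hc j
    · rw [Finset.sum_insert hi, Function.update_self, ← hd]
      have : ∑ j ∈ S, MvPowerSeries.X j * Function.update c i d j =
          ∑ j ∈ S, MvPowerSeries.X j * c j :=
        Finset.sum_congr rfl fun j hj => by
          rw [Function.update_of_ne (by rintro rfl; exact hi hj)]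
      rw [this]
      linear_combination hGc

section Sum

theorem hasSubst_X_inl {σ σ' : Type*} [Finite σ] : HasSubst (fun i => MvPowerSeries.X (Sum.inl i) :
    σ → MvPowerSeries (σ ⊕ σ') K) :=
  MvPowerSeries.hasSubst_of_constantCoeff_zero (by simp)

variable {σ σ' : Type*} [Fintype σ] [Fintype σ']

theorem hasSubst_inl_zero : HasSubst (Sum.elim MvPowerSeries.X (fun _ => 0) :
    σ ⊕ σ' → MvPowerSeries σ K) :=
  MvPowerSeries.hasSubst_of_constantCoeff_zero (by rintro (i | i) <;> simp)

theorem hasSubst_X_add_X : HasSubst (fun i => MvPowerSeries.X (Sum.inl i) +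
    MvPowerSeries.X (Sum.inr i) : σ → MvPowerSeries (σ ⊕ σ) K) :=
  MvPowerSeries.hasSubst_of_constantCoeff_zero (by simp)

theorem subst_inl_zero_X_add_X (f : MvPowerSeries σ K) : MvPowerSeries.subst
    (Sum.elim MvPowerSeries.X (fun _ => 0) : σ ⊕ σ → MvPowerSeries σ K)
    (MvPowerSeries.subst (fun i => MvPowerSeries.X (Sum.inl i) + MvPowerSeries.X (Sum.inr i) :
      σ → MvPowerSeries (σ ⊕ σ) K) f) = f := by
  rw [MvPowerSeries.subst_comp_subst_apply hasSubst_X_add_X hasSubst_inl_zero]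
  have : (fun i => MvPowerSeries.subst (Sum.elim MvPowerSeries.X (fun _ => 0) :
      σ ⊕ σ → MvPowerSeries σ K) (MvPowerSeries.X (Sum.inl i) + MvPowerSeries.X (Sum.inr i) :
        MvPowerSeries (σ ⊕ σ) K)) = MvPowerSeries.X := by
    funext i
    rw [MvPowerSeries.subst_add hasSubst_inl_zero, MvPowerSeries.subst_X hasSubst_inl_zero,
      MvPowerSeries.subst_X hasSubst_inl_zero]
    simp
  rw [this, MvPowerSeries.subst_self]
  rfl

/-- Hadamard's lemma for the second block of variables: `G(x, y) = G(x, 0) + ∑ y_i c_i(x, y)`. -/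
theorem exists_eq_subst_add_sum (Q : Quality K) {G : MvPowerSeries (σ ⊕ σ') K}
    (hG : G ∈ Q.series (σ ⊕ σ')) :
    ∃ c : σ' → MvPowerSeries (σ ⊕ σ') K, (∀ i, c i ∈ Q.series (σ ⊕ σ')) ∧
      G = MvPowerSeries.subst (fun i => MvPowerSeries.X (Sum.inl i) :
          σ → MvPowerSeries (σ ⊕ σ') K)
        (MvPowerSeries.subst (Sum.elim MvPowerSeries.X (fun _ => 0) :
          σ ⊕ σ' → MvPowerSeries σ K) G) + ∑ i, MvPowerSeries.X (Sum.inr i) * c i := by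
  classical
  obtain ⟨c, hc, hGc⟩ := exists_eq_kill_add Q (Finset.univ.map (Function.Embedding.inr : σ' ↪ σ ⊕ σ')) hG
  refine ⟨fun i => c (Sum.inr i), fun i => hc _, ?_⟩
  rw [Finset.sum_map] at hGc
  refine hGc.trans ?_
  congr 1
  rw [MvPowerSeries.subst_comp_subst_apply hasSubst_inl_zero hasSubst_X_inl]
  congr 1
  funext j
  rcases j with j | j
  · rw [if_neg (by simp)]
    exact (MvPowerSeries.subst_X (R := K) hasSubst_X_inl j).symm
  · rw [if_pos (by simp)]
    exact (subst_zero hasSubst_X_inl).symm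

end Sum

section Taylor

variable {σ : Type*} [Fintype σ]

/-- Write `f` as a constant plus `∑ X i * c i`. Then `D f = ∑ X i * D (c i)`, so by induction every
value of `D` has arbitrarily high order. No continuity of `D` needs to be assumed. -/
theorem eq_zero_of_map_X_mul (D : MvPowerSeries σ K →+ MvPowerSeries σ K)
    (hC : ∀ a, D (MvPowerSeries.C a) = 0)
    (hX : ∀ i c, D (MvPowerSeries.X i * c) = MvPowerSeries.X i * D c) (f : MvPowerSeries σ K) :
    D f = 0 := by
  classical
  refine eq_of_forall_sub_mem_ordIdeal fun n => ?_
  rw [sub_zero]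
  induction n generalizing f with
  | zero => exact mem_ordIdeal_zero _
  | succ n ih =>
    obtain ⟨c, -, hc⟩ := exists_eq_kill_add .formal Finset.univ (mem_series_formal f)
    have hkill : MvPowerSeries.subst (fun j => if j ∈ ((Finset.univ : Finset σ) : Set σ) then
        (0 : MvPowerSeries σ K) else MvPowerSeries.X j) f =
        MvPowerSeries.C (MvPowerSeries.constantCoeff f) := by
      ext e
      rw [coeff_subst_kill, MvPowerSeries.coeff_C]
      have : (∀ i ∈ ((Finset.univ : Finset σ) : Set σ), e i = 0) ↔ e = 0 := by
        simp [Finsupp.ext_iff]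
      simp only [this]
      split_ifs with h
      · rw [h, MvPowerSeries.coeff_zero_eq_constantCoeff_apply]
      · rfl
    rw [hc, hkill, map_add, hC, zero_add, map_sum]
    refine sum_mem fun i _ => ?_
    rw [hX, add_comm n 1]
    exact mul_mem_ordIdeal (X_mem_ordIdeal i) (ih _)

/-- Existence is Hadamard's lemma applied to `f(x + y)`. To identify `h j (x, 0)` with the formal
derivative, both are seen as values of operators with the same behaviour on constants and under
multiplication by variables. -/
theorem exists_taylor_one (Q : Quality K) {f : MvPowerSeries σ K} (hf : f ∈ Q.series σ) :
    ∃ h : σ → MvPowerSeries (σ ⊕ σ) K, (∀ j, h j ∈ Q.series (σ ⊕ σ)) ∧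
      MvPowerSeries.subst (fun i => MvPowerSeries.X (Sum.inl i) + MvPowerSeries.X (Sum.inr i) :
        σ → MvPowerSeries (σ ⊕ σ) K) f =
        MvPowerSeries.subst (fun i => MvPowerSeries.X (Sum.inl i) :
          σ → MvPowerSeries (σ ⊕ σ) K) f + ∑ j, MvPowerSeries.X (Sum.inr j) * h j ∧
      ∀ j, MvPowerSeries.subst (Sum.elim MvPowerSeries.X (fun _ => 0) :
        σ ⊕ σ → MvPowerSeries σ K) (h j) = MvPowerSeries.pderiv K j f := by
  classical
  obtain ⟨h, hQ, hh⟩ := exists_eq_subst_add_sum Q (σ := σ) (σ' := σ)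
    (Q.subst_mem (f := f) (a := fun i => MvPowerSeries.X (Sum.inl i) + MvPowerSeries.X (Sum.inr i))
      (by simp) hf (fun i => add_mem (Q.X_mem _) (Q.X_mem _)))
  rw [subst_inl_zero_X_add_X] at hh
  refine ⟨h, hQ, hh, fun j => ?_⟩
  let z := MvPowerSeries.substAlgHom (R := K) (hasSubst_inl_zero (K := K) (σ := σ) (σ' := σ))
  let A := MvPowerSeries.substAlgHom (R := K) (hasSubst_X_add_X (K := K) (σ := σ))
  let B := MvPowerSeries.substAlgHom (R := K) (hasSubst_X_inl (K := K) (σ := σ) (σ' := σ))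
  let δ : Derivation K (MvPowerSeries (σ ⊕ σ) K) (MvPowerSeries (σ ⊕ σ) K) :=
    MvPowerSeries.pderiv K (Sum.inr j)
  have hzA : ∀ c, z (A c) = c := fun c => by
    simpa only [z, A, MvPowerSeries.coe_substAlgHom] using subst_inl_zero_X_add_X c
  have hzX : ∀ i, z (MvPowerSeries.X (Sum.inl i)) = MvPowerSeries.X i := fun i =>
    MvPowerSeries.substAlgHom_X _ _
  have hzX' : ∀ i, z (MvPowerSeries.X (Sum.inr i)) = 0 := fun i =>
    MvPowerSeries.substAlgHom_X _ _
  have hAX : ∀ i, A (MvPowerSeries.X i) = MvPowerSeries.X (Sum.inl i) +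
      MvPowerSeries.X (Sum.inr i) := fun i => MvPowerSeries.substAlgHom_X _ _
  have hBX : ∀ i, B (MvPowerSeries.X i) = MvPowerSeries.X (Sum.inl i) := fun i =>
    MvPowerSeries.substAlgHom_X _ _
  have hdl : ∀ i, δ (MvPowerSeries.X (Sum.inl i)) = 0 := fun i =>
    MvPowerSeries.pderiv_X_of_ne (by simp)
  have hdr : ∀ i, δ (MvPowerSeries.X (Sum.inr i)) = if i = j then 1 else 0 := by
    intro i
    split_ifs with hij
    · rw [hij]; exact MvPowerSeries.pderiv_X_self
    · exact MvPowerSeries.pderiv_X_of_ne (by simpa using hij)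
  have hpX : ∀ i, MvPowerSeries.pderiv K j (MvPowerSeries.X i : MvPowerSeries σ K) =
      if i = j then 1 else 0 := by
    intro i
    split_ifs with hij
    · rw [hij]; exact MvPowerSeries.pderiv_X_self
    · exact MvPowerSeries.pderiv_X_of_ne hij
  -- The difference of `∂/∂y_j (c(x + y) - c(x))` at `y = 0` and `∂_j c`. Keeping the term `c(x)`
  -- matches the expansion and avoids a separate proof that its `y`-derivative vanishes.
  let D : MvPowerSeries σ K →+ MvPowerSeries σ K :=
    { toFun := fun c => z (δ (A c - B c)) - MvPowerSeries.pderiv K j c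
      map_zero' := by simp
      map_add' := fun a b => by simp only [map_add, map_sub]; ring }
  have hD : D f = 0 := by
    refine eq_zero_of_map_X_mul D (fun a => ?_) (fun i c => ?_) f
    · change z (δ (A (algebraMap K _ a) - B (algebraMap K _ a))) -
        MvPowerSeries.pderiv K j (algebraMap K _ a) = 0
      rw [AlgHom.commutes, AlgHom.commutes, sub_self, map_zero, map_zero, Derivation.map_algebraMap,
        sub_zero]
    · change z (δ (A (MvPowerSeries.X i * c) - B (MvPowerSeries.X i * c))) -
        MvPowerSeries.pderiv K j (MvPowerSeries.X i * c) =
          MvPowerSeries.X i * (z (δ (A c - B c)) - MvPowerSeries.pderiv K j c)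
      simp only [map_mul, map_sub, Derivation.leibniz, hAX, hBX, map_add, hdl, hdr, hpX, hzX, hzX',
        hzA, smul_eq_mul]
      split_ifs <;> simp only [map_one, map_zero] <;> ring
  have hAB : A f - B f = ∑ i, MvPowerSeries.X (Sum.inr i) * h i := by
    simp only [A, B, MvPowerSeries.coe_substAlgHom]
    rw [hh, add_sub_cancel_left]
  have hD' : z (δ (A f - B f)) = MvPowerSeries.pderiv K j f := sub_eq_zero.mp hD
  rw [← hD', hAB, map_sum, map_sum, Finset.sum_eq_single j]
  · simp only [Derivation.leibniz, hdr, smul_eq_mul, map_add, map_mul, hzX', if_true,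
      zero_mul, zero_add, mul_one, z, MvPowerSeries.coe_substAlgHom]
  · intro i _ hij
    simp only [Derivation.leibniz, hdr, if_neg hij, smul_eq_mul, mul_zero, add_zero, map_mul, hzX',
      zero_mul]
  · simp

/-- The derivative is a Taylor coefficient restricted to `y = 0`, which settles the three qualities
at once. -/
theorem Quality.pderiv_mem (Q : Quality K) {f : MvPowerSeries σ K} (hf : f ∈ Q.series σ) (j : σ) :
    MvPowerSeries.pderiv K j f ∈ Q.series σ := by
  obtain ⟨h, hQ, -, hh⟩ := exists_taylor_one Q hf
  rw [← hh j]
  refine Q.subst_mem ?_ (hQ j) ?_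
  · rintro (i | i) <;> simp
  · rintro (i | i)
    · exact Q.X_mem i
    · exact zero_mem _

/-- Hadamard's lemma is applied again, to the first order coefficients. No factorials are divided
by, so the expansion is valid in every characteristic. -/
theorem exists_taylor_two (Q : Quality K) {f : MvPowerSeries σ K} (hf : f ∈ Q.series σ) :
    ∃ h : σ → σ → MvPowerSeries (σ ⊕ σ) K, (∀ j l, h j l ∈ Q.series (σ ⊕ σ)) ∧
      MvPowerSeries.subst (fun i => MvPowerSeries.X (Sum.inl i) + MvPowerSeries.X (Sum.inr i) :
        σ → MvPowerSeries (σ ⊕ σ) K) f =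
        MvPowerSeries.subst (fun i => MvPowerSeries.X (Sum.inl i) :
          σ → MvPowerSeries (σ ⊕ σ) K) f +
        ∑ j, MvPowerSeries.X (Sum.inr j) * MvPowerSeries.subst
          (fun i => MvPowerSeries.X (Sum.inl i) : σ → MvPowerSeries (σ ⊕ σ) K)
          (MvPowerSeries.pderiv K j f) +
        ∑ j, ∑ l, MvPowerSeries.X (Sum.inr j) * MvPowerSeries.X (Sum.inr l) * h j l := by
  obtain ⟨h, hQ, hh, hp⟩ := exists_taylor_one Q hf
  choose h2 hQ2 hh2 using fun j => exists_eq_subst_add_sum Q (hQ j)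
  refine ⟨h2, hQ2, ?_⟩
  rw [hh, add_assoc, ← Finset.sum_add_distrib]
  congr 1
  refine Finset.sum_congr rfl fun j _ => ?_
  conv_lhs => rw [hh2 j, hp j]
  rw [mul_add, Finset.mul_sum]
  congr 1
  exact Finset.sum_congr rfl fun l _ => by ring

variable {τ : Type*}

theorem hasSubst_sumElim {σ' : Type*} [Finite σ'] {u : σ → MvPowerSeries τ K}
    {e : σ' → MvPowerSeries τ K}
    (hu : ∀ i, MvPowerSeries.constantCoeff (u i) = 0)
    (he : ∀ i, MvPowerSeries.constantCoeff (e i) = 0) : HasSubst (Sum.elim u e) :=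
  MvPowerSeries.hasSubst_of_constantCoeff_zero (by rintro (i | i); exacts [hu i, he i])

theorem subst_sumElim_X_inl {σ' : Type*} [Finite σ'] {u : σ → MvPowerSeries τ K}
    {e : σ' → MvPowerSeries τ K}
    (hu : ∀ i, MvPowerSeries.constantCoeff (u i) = 0)
    (he : ∀ i, MvPowerSeries.constantCoeff (e i) = 0) (f : MvPowerSeries σ K) :
    MvPowerSeries.subst (Sum.elim u e) (MvPowerSeries.subst
      (fun i => MvPowerSeries.X (Sum.inl i) : σ → MvPowerSeries (σ ⊕ σ') K) f) =
      MvPowerSeries.subst u f := by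
  have hs := hasSubst_sumElim hu he
  rw [MvPowerSeries.subst_comp_subst_apply hasSubst_X_inl hs]
  congr 1
  funext i
  rw [MvPowerSeries.subst_X (R := K) hs]
  rfl

theorem subst_sumElim_X_add_X {u e : σ → MvPowerSeries τ K}
    (hu : ∀ i, MvPowerSeries.constantCoeff (u i) = 0)
    (he : ∀ i, MvPowerSeries.constantCoeff (e i) = 0) (f : MvPowerSeries σ K) :
    MvPowerSeries.subst (Sum.elim u e) (MvPowerSeries.subst
      (fun i => MvPowerSeries.X (Sum.inl i) + MvPowerSeries.X (Sum.inr i) :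
        σ → MvPowerSeries (σ ⊕ σ) K) f) = MvPowerSeries.subst (u + e) f := by
  have hs := hasSubst_sumElim hu he
  rw [MvPowerSeries.subst_comp_subst_apply hasSubst_X_add_X hs]
  congr 1
  funext i
  rw [MvPowerSeries.subst_add hs, MvPowerSeries.subst_X hs, MvPowerSeries.subst_X hs]
  rfl

end Taylor

/-! ### Inversion of the identity plus terms of order two -/

section Inverse

variable {σ : Type*} [Fintype σ] {τ : Type*}

/-- A power series of order at least two is a contraction. -/
theorem subst_sub_subst_mem_ordIdeal {p : MvPowerSeries σ K} (hp : p ∈ ordIdeal K σ 2)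
    {u u' : σ → MvPowerSeries τ K}
    (hu : ∀ i, MvPowerSeries.constantCoeff (u i) = 0)
    (hu' : ∀ i, MvPowerSeries.constantCoeff (u' i) = 0) {n : ℕ}
    (h : ∀ i, u' i - u i ∈ ordIdeal K τ n) :
    MvPowerSeries.subst u' p - MvPowerSeries.subst u p ∈ ordIdeal K τ (n + 1) := by
  classical
  obtain ⟨c, -, hc, hc'⟩ := exists_taylor_one .formal (mem_series_formal p)
  have he : ∀ i, MvPowerSeries.constantCoeff ((u' - u) i) = 0 := by simp [hu, hu']
  have hs := hasSubst_sumElim hu he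
  have := congrArg (MvPowerSeries.subst (Sum.elim u (u' - u))) hc
  rw [subst_sumElim_X_add_X hu he, MvPowerSeries.subst_add hs, subst_sumElim_X_inl hu he,
    subst_sum hs, add_sub_cancel] at this
  rw [this, add_sub_cancel_left]
  refine sum_mem fun j _ => ?_
  rw [MvPowerSeries.subst_mul hs, MvPowerSeries.subst_X hs]
  refine mul_mem_ordIdeal (h j) (mem_ordIdeal_one.mpr ?_)
  refine MvPowerSeries.constantCoeff_subst_eq_zero hs (by rintro (i | i); exacts [hu i, he i]) ?_
  have h1 := congrArg MvPowerSeries.constantCoeff (hc' j)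
  have h2 : MvPowerSeries.constantCoeff (MvPowerSeries.pderiv K j p) = 0 := by
    rw [← MvPowerSeries.coeff_zero_eq_constantCoeff_apply, MvPowerSeries.coeff_pderiv, hp _ (by simp),
      zero_mul]
  -- The constant term of `c j` survives setting `y = 0`, where `c j` becomes the `j`-th derivative
  -- of `p`; that derivative has no constant term as `p` has order two.
  have h3 : MvPowerSeries.constantCoeff (MvPowerSeries.subst (Sum.elim MvPowerSeries.X (fun _ => 0) :
        σ ⊕ σ → MvPowerSeries σ K) (c j - MvPowerSeries.C (MvPowerSeries.constantCoeff (c j)))) = 0 :=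
    MvPowerSeries.constantCoeff_subst_eq_zero hasSubst_inl_zero (by rintro (i | i) <;> simp) (by simp)
  rw [MvPowerSeries.subst_sub hasSubst_inl_zero, map_sub, h1, h2, MvPowerSeries.subst_C] at h3
  simpa using h3

/-- If two solutions agree up to order `n`, their difference is, up to sign, the difference of the
values of `p`, which has order at least `n + 1`. -/
theorem eq_of_add_subst_eq {p : σ → MvPowerSeries σ K} (hp : ∀ i, p i ∈ ordIdeal K σ 2)
    {u u' : σ → MvPowerSeries τ K}
    (hu : ∀ i, MvPowerSeries.constantCoeff (u i) = 0)
    (hu' : ∀ i, MvPowerSeries.constantCoeff (u' i) = 0)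
    (h : ∀ i, u i + MvPowerSeries.subst u (p i) = u' i + MvPowerSeries.subst u' (p i)) : u = u' := by
  have key : ∀ n i, u i - u' i ∈ ordIdeal K τ n := by
    intro n
    induction n with
    | zero => exact fun i => mem_ordIdeal_zero _
    | succ n ih =>
      intro i
      have h1 := subst_sub_subst_mem_ordIdeal (hp i) hu' hu ih
      have h2 : u i - u' i = -(MvPowerSeries.subst u (p i) - MvPowerSeries.subst u' (p i)) := by
        linear_combination h i
      rw [h2]
      exact neg_mem h1
  funext i
  exact eq_of_forall_sub_mem_ordIdeal fun n => key n i

/-- The Picard iteration for the solution `w` of `w + p(w) = x`. -/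
def picard (p : σ → MvPowerSeries σ K) : ℕ → σ → MvPowerSeries σ K
  | 0 => 0
  | n + 1 => fun i => MvPowerSeries.X i - MvPowerSeries.subst (picard p n) (p i)

/-- The limit of the Picard iteration. -/
def picardLimit (p : σ → MvPowerSeries σ K) : σ → MvPowerSeries σ K :=
  fun i α => MvPowerSeries.coeff α (picard p α.degree i)

variable {p : σ → MvPowerSeries σ K} (hp : ∀ i, p i ∈ ordIdeal K σ 2)
include hp

theorem constantCoeff_picard (n : ℕ) (i : σ) :
    MvPowerSeries.constantCoeff (picard p n i) = 0 := by
  induction n generalizing i with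
  | zero => simp [picard]
  | succ n ih =>
    rw [picard, map_sub, MvPowerSeries.constantCoeff_X, zero_sub, neg_eq_zero]
    exact MvPowerSeries.constantCoeff_subst_eq_zero
      (MvPowerSeries.hasSubst_of_constantCoeff_zero ih) ih
      (mem_ordIdeal_one.mp (ordIdeal_anti (by norm_num) (hp i)))

/-- By the contraction property the coefficients of degree at most `n` are final from step `n` on.
This is why `picardLimit` reads off the coefficient of `α` at step `α.degree`. -/
theorem picard_succ_sub_mem (n : ℕ) (i : σ) :
    picard p (n + 1) i - picard p n i ∈ ordIdeal K σ (n + 1) := by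
  induction n generalizing i with
  | zero =>
    exact sub_mem (mem_ordIdeal_one.mpr (constantCoeff_picard hp _ i))
      (mem_ordIdeal_one.mpr (constantCoeff_picard hp _ i))
  | succ n ih =>
    have h1 := subst_sub_subst_mem_ordIdeal (hp i) (constantCoeff_picard hp n)
      (constantCoeff_picard hp (n + 1)) ih
    have : picard p (n + 1 + 1) i - picard p (n + 1) i =
        -(MvPowerSeries.subst (picard p (n + 1)) (p i) - MvPowerSeries.subst (picard p n) (p i)) := by
      rw [picard, picard]
      ring
    rw [this]
    exact neg_mem h1

theorem picard_add_sub_mem (n m : ℕ) (i : σ) :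
    picard p (n + m) i - picard p n i ∈ ordIdeal K σ (n + 1) := by
  induction m with
  | zero => simp
  | succ m ih =>
    have h := ordIdeal_anti (m := n + 1) (by omega) (picard_succ_sub_mem hp (n + m) i)
    have := add_mem h ih
    rwa [sub_add_sub_cancel] at this

theorem picardLimit_sub_mem (n : ℕ) (i : σ) :
    picardLimit p i - picard p n i ∈ ordIdeal K σ (n + 1) := by
  intro α hα
  obtain ⟨m, rfl⟩ := Nat.exists_eq_add_of_le (Nat.lt_succ_iff.mp hα)
  have h := picard_add_sub_mem hp α.degree m i α (Nat.lt_succ_self _)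
  have h2 : MvPowerSeries.coeff α (picardLimit p i) =
    MvPowerSeries.coeff α (picard p α.degree i) := rfl
  rw [map_sub, h2]
  rw [map_sub] at h
  linear_combination -h

theorem constantCoeff_picardLimit (i : σ) :
    MvPowerSeries.constantCoeff (picardLimit p i) = 0 := by
  have h := picardLimit_sub_mem hp 0 i
  rw [mem_ordIdeal_one, map_sub, constantCoeff_picard hp, sub_zero] at h
  exact h

/-- Modulo order `n + 2` the limit may be replaced by step `n` inside `p` and by step `n + 1`
outside, where the recursion is the equation itself. -/
theorem picardLimit_add_subst (i : σ) :
    picardLimit p i + MvPowerSeries.subst (picardLimit p) (p i) = MvPowerSeries.X i := by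
  refine eq_of_forall_sub_mem_ordIdeal fun n => ?_
  have h1 := subst_sub_subst_mem_ordIdeal (hp i) (constantCoeff_picard hp n)
    (constantCoeff_picardLimit hp) (picardLimit_sub_mem hp n)
  have h2 := picardLimit_sub_mem hp (n + 1) i
  refine ordIdeal_anti (m := n) (n := n + 1 + 1) (by omega) ?_
  have := add_mem h1 h2
  rw [picard] at this
  convert this using 1
  ring

/-- Order two makes the norm of `p i` at radius `2 * s` at most `s` for small `s`. Then the bound `2
* s` on the norm of an iterate at radius `s` reproduces itself as `s + s`, and the uniform bound
passes to the limit. -/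
theorem converges_picardLimit (v : AbsoluteValue K ℝ) (hc : ∀ i, Converges v (p i)) (i : σ) :
    Converges v (picardLimit p i) := by
  classical
  have hex : ∀ i, ∃ r : ℝ≥0, 0 < r ∧ ∀ s ≤ r, wnorm v (2 * s) (p i) ≤ s := by
    intro i
    obtain ⟨s₀, hs₀, h⟩ := (converges_iff v _).mp (hc i)
    lift wnorm v s₀ (p i) to ℝ≥0 using h with C hC
    -- The first bound places `2 * s` inside the radius `s₀`; the second is `(2 s / s₀)² C ≤ s`
    -- solved for `s`, with `C + 1` in place of `C` to avoid dividing by zero.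
    refine ⟨min (s₀ / 2) (s₀ ^ 2 / (4 * (C + 1))), by positivity, fun s hs => ?_⟩
    have h1 : 2 * s ≤ s₀ := by
      have := hs.trans (min_le_left _ _)
      rw [le_div_iff₀ (by norm_num)] at this
      linarith
    have h2 : s * (4 * (C + 1)) ≤ s₀ ^ 2 := by
      have := hs.trans (min_le_right _ _)
      rwa [le_div_iff₀ (by positivity)] at this
    have h3 := wnorm_mul_le_of_order v (hp i) (c := 2 * s / s₀) (div_le_one_of_le₀ h1 zero_le) s₀
    rw [div_mul_cancel₀ _ hs₀.ne', ← hC] at h3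
    refine h3.trans ?_
    have h4 : (2 * s / s₀) ^ 2 * C ≤ s := by
      rw [div_pow, div_mul_eq_mul_div, div_le_iff₀ (by positivity)]
      calc (2 * s) ^ 2 * C = s * (s * (4 * C)) := by ring
        _ ≤ s * (s * (4 * (C + 1))) := by gcongr; simp
        _ ≤ s * s₀ ^ 2 := by gcongr
    exact_mod_cast h4
  choose r hr hrs using hex
  obtain ⟨s, hs, hle⟩ : ∃ s : ℝ≥0, 0 < s ∧ ∀ i, s ≤ r i := by
    obtain ⟨j, hj⟩ := @Finite.exists_min _ _ _ ⟨i⟩ _ r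
    exact ⟨r j, hr j, hj⟩
  have hbound : ∀ n j, wnorm v s (picard p n j) ≤ (2 * s : ℝ≥0) := by
    intro n
    induction n with
    | zero => intro j; simp [picard, wnorm]
    | succ n ih =>
      intro j
      change wnorm v s (MvPowerSeries.X j - MvPowerSeries.subst (picard p n) (p j)) ≤ _
      rw [sub_eq_add_neg]
      refine (wnorm_add_le v s _ _).trans ?_
      rw [wnorm_neg, two_mul, ENNReal.coe_add]
      refine add_le_add (wnorm_X_le v s j) ?_
      exact (wnorm_subst_le v (MvPowerSeries.hasSubst_of_constantCoeff_zero
        (constantCoeff_picard hp n)) ih _).trans (hrs j s (hle j))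
  refine (converges_iff v _).mpr ⟨s, hs, ne_top_of_le_ne_top (b := ((2 * s : ℝ≥0) : ℝ≥0∞))
    ENNReal.coe_ne_top ?_⟩
  unfold wnorm
  rw [ENNReal.tsum_eq_iSup_sum]
  refine iSup_le fun t => ?_
  -- A finite partial sum of the norm of the limit only sees coefficients that are already final at
  -- some step `N`.
  obtain ⟨N, hN⟩ : ∃ N, ∀ α ∈ t, α.degree < N + 1 := by
    refine ⟨t.sup Finsupp.degree, fun α hα => Nat.lt_succ_of_le (Finset.le_sup (f := Finsupp.degree) hα)⟩
  refine le_trans (le_of_eq ?_) ((ENNReal.sum_le_tsum t).trans (hbound N i))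
  refine Finset.sum_congr rfl fun α hα => ?_
  have := picardLimit_sub_mem hp N i α (hN α hα)
  rw [map_sub, sub_eq_zero] at this
  rw [this]

/-- The series `u j = x_j + p_j` are algebraically independent, because substituting the limit `w`
turns them into the variables. Since `L` is algebraic over `K[x]`, its transcendence degree is at
most the number of variables, so the `u j` form a transcendence basis and `x_i` is algebraic over
`K[u]`. Substituting `w` in this relation sends `u` to `x` and `x_i` to `w_i`. The subalgebra `L`
takes the place of the ring of all power series, which is too large for this count. -/
theorem isAlgebraic_picardLimit (L : Subalgebra K (MvPowerSeries σ K))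
    (hL : ∀ f ∈ L, IsAlgebraic (MvPolynomial σ K) f) (hX : ∀ j, MvPowerSeries.X j ∈ L)
    (hc : ∀ i, p i ∈ L) (i : σ) : IsAlgebraic (MvPolynomial σ K) (picardLimit p i) := by
  classical
  let u : σ → MvPowerSeries σ K := fun j => MvPowerSeries.X j + p j
  have hw := MvPowerSeries.hasSubst_of_constantCoeff_zero (constantCoeff_picardLimit hp)
  have hu : HasSubst u := MvPowerSeries.hasSubst_of_constantCoeff_zero fun j => by
    rw [map_add, MvPowerSeries.constantCoeff_X, zero_add,
      mem_ordIdeal_one.mp (ordIdeal_anti (by norm_num) (hp j))]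
  have hback : ∀ F : MvPowerSeries σ K, MvPowerSeries.subst (picardLimit p)
      (MvPowerSeries.subst u F) = F := by
    intro F
    rw [MvPowerSeries.subst_comp_subst_apply hu hw]
    have : (fun j => MvPowerSeries.subst (picardLimit p) (u j)) = MvPowerSeries.X := by
      funext j
      rw [MvPowerSeries.subst_add hw, MvPowerSeries.subst_X hw, picardLimit_add_subst hp]
    rw [this, MvPowerSeries.subst_self]
    rfl
  let uL : σ → L := fun j => ⟨u j, add_mem (hX j) (hc j)⟩
  let xL : σ → L := fun j => ⟨MvPowerSeries.X j, hX j⟩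
  have huL : ∀ P : MvPolynomial σ K, (MvPolynomial.aeval uL P : MvPowerSeries σ K) =
      MvPowerSeries.subst u (P : MvPowerSeries σ K) := by
    intro P
    rw [MvPowerSeries.subst_coe]
    have : L.val.comp (MvPolynomial.aeval uL) = MvPolynomial.aeval u := by
      ext j
      simp [uL]
    exact DFunLike.congr_fun this P
  have hxL : ∀ P : MvPolynomial σ K, (MvPolynomial.aeval xL P : MvPowerSeries σ K) = P := by
    intro P
    have : L.val.comp (MvPolynomial.aeval xL) = MvPolynomial.coeToMvPowerSeries.algHom K := by
      ext j
      simp [xL]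
    rw [show (P : MvPowerSeries σ K) = MvPolynomial.coeToMvPowerSeries.algHom K P by simp, ← this]
    rfl
  have hind : AlgebraicIndependent K uL := by
    rw [algebraicIndependent_iff_injective_aeval, injective_iff_map_eq_zero]
    intro P hP
    have h1 := huL P
    rw [hP] at h1
    have h2 := hback P
    rw [← h1] at h2
    have h3 : (0 : MvPowerSeries σ K) = P := by
      rw [← h2]
      exact (subst_zero hw).symm
    exact_mod_cast h3.symm
  have halg : Algebra.IsAlgebraic (Algebra.adjoin K (Set.range xL)) L := by
    refine ⟨fun f => ?_⟩
    obtain ⟨N, c, hcf, j, hj, hcj⟩ := exists_sum_eq_zero (hL _ f.2)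
    have hmem : ∀ P : MvPolynomial σ K, MvPolynomial.aeval xL P ∈
        Algebra.adjoin K (Set.range xL) := by
      intro P
      rw [Algebra.adjoin_range_eq_range_aeval]
      exact ⟨P, rfl⟩
    refine isAlgebraic_of_sum_eq_zero (N := N)
      (c := fun l => ⟨MvPolynomial.aeval xL (c l), hmem _⟩) ?_ ⟨j, hj, fun h => hcj ?_⟩
    · apply Subtype.ext
      rw [← L.val_apply, map_sum, ZeroMemClass.coe_zero, ← hcf]
      refine Finset.sum_congr rfl fun l _ => ?_
      rw [coe_smul_eq, ← hxL]
      rfl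
    · have h1 : MvPolynomial.aeval xL (c j) = 0 := congrArg Subtype.val h
      have h2 := hxL (c j)
      rw [h1] at h2
      have h3 : (0 : MvPowerSeries σ K) = c j := h2
      exact_mod_cast h3.symm
  -- The variables generate a subalgebra over which `L` is algebraic, so their number bounds the
  -- transcendence degree, and an independent family of this size is a basis.
  have hbasis := hind.isTranscendenceBasis_of_lift_trdeg_le_of_finite
    ((Cardinal.lift_le.mpr (Algebra.IsAlgebraic.trdeg_le_cardinalMk K (Set.range xL))).trans
      Cardinal.mk_range_le_lift)
  have halg' := hbasis.isAlgebraic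
  obtain ⟨N, c, hcf, j, hj, hcj⟩ := exists_sum_eq_zero (halg'.isAlgebraic (xL i))
  have hrep : ∀ l, ∃ P : MvPolynomial σ K, MvPolynomial.aeval uL P = (c l : L) := by
    intro l
    exact (Algebra.adjoin_range_eq_range_aeval K uL).le (c l).2
  choose P hP using hrep
  refine isAlgebraic_of_sum_eq_zero (N := N) (c := P) ?_ ⟨j, hj, fun h => hcj ?_⟩
  -- The relation of `x_i` over `K[u]`, after substitution of `w`.
  · have h1 := congrArg (fun f : L => MvPowerSeries.subst (picardLimit p) (f : MvPowerSeries σ K)) hcf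
    simp only [ZeroMemClass.coe_zero] at h1
    rw [subst_zero hw, ← L.val_apply, map_sum, subst_sum hw] at h1
    rw [← h1]
    refine Finset.sum_congr rfl fun l _ => ?_
    have h2 : L.val (c l • xL i ^ l) = (MvPolynomial.aeval uL (P l) : MvPowerSeries σ K) *
        MvPowerSeries.X i ^ l := by
      rw [hP]
      rfl
    rw [h2, huL, MvPowerSeries.subst_mul hw, MvPowerSeries.subst_pow hw, MvPowerSeries.subst_X hw,
      hback, coe_smul_eq]
  · apply Subtype.ext
    rw [← hP j, h, map_zero]
    rfl

theorem picardLimit_mem (Q : Quality K) (hc : ∀ i, p i ∈ Q.series σ) (i : σ) :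
    picardLimit p i ∈ Q.series σ := by
  cases Q with
  | formal => exact mem_series_formal _
  | convergent v => exact converges_picardLimit hp v hc i
  | algebraic => exact isAlgebraic_picardLimit hp _ (fun _ h => h) (Quality.X_mem .algebraic) hc i

end Inverse

/-! ### Evaluation at arcs -/

section Arcs

variable {Q : Quality K} {ι : Type*}

theorem zero_mem_arcSeries : (0 : K⟦X⟧) ∈ arcSeries Q := ⟨zero_mem _, map_zero _⟩

theorem add_mem_arcSeries {x y : K⟦X⟧} (hx : x ∈ arcSeries Q) (hy : y ∈ arcSeries Q) :
    x + y ∈ arcSeries Q := ⟨add_mem hx.1 hy.1, by rw [map_add, hx.2, hy.2, add_zero]⟩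

theorem neg_mem_arcSeries {x : K⟦X⟧} (hx : x ∈ arcSeries Q) : -x ∈ arcSeries Q :=
  ⟨neg_mem hx.1, by rw [map_neg, hx.2, neg_zero]⟩

theorem sub_mem_arcSeries {x y : K⟦X⟧} (hx : x ∈ arcSeries Q) (hy : y ∈ arcSeries Q) :
    x - y ∈ arcSeries Q := by
  rw [sub_eq_add_neg]
  exact add_mem_arcSeries hx (neg_mem_arcSeries hy)

theorem mul_mem_arcSeries {u x : K⟦X⟧} (hu : u ∈ Q.series Unit) (hx : x ∈ arcSeries Q) :
    u * x ∈ arcSeries Q := ⟨mul_mem hu hx.1, by rw [map_mul, hx.2, mul_zero]⟩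

theorem sum_mem_arcSeries {κ : Type*} (s : Finset κ) {x : κ → K⟦X⟧}
    (hx : ∀ i ∈ s, x i ∈ arcSeries Q) : ∑ i ∈ s, x i ∈ arcSeries Q :=
  ⟨sum_mem fun i hi => (hx i hi).1, by
    rw [map_sum]; exact Finset.sum_eq_zero fun i hi => (hx i hi).2⟩

theorem constantCoeff_elim {y : ι → K⟦X⟧} (hy : ∀ i, PowerSeries.constantCoeff (y i) = 0)
    (o : Option ι) :
    MvPowerSeries.constantCoeff (o.elim (PowerSeries.X : K⟦X⟧) y : MvPowerSeries Unit K) = 0 := by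
  cases o with
  | none => exact PowerSeries.constantCoeff_X
  | some i => exact hy i

theorem elim_mem_series {y : ι → K⟦X⟧} (hy : y ∈ arcs Q ι) (o : Option ι) :
    (o.elim (PowerSeries.X : K⟦X⟧) y : MvPowerSeries Unit K) ∈ Q.series Unit := by
  cases o with
  | none => exact Q.X_mem ()
  | some i => exact (hy i).1

variable [Fintype ι]

theorem hasSubst_elim {y : ι → K⟦X⟧} (hy : ∀ i, PowerSeries.constantCoeff (y i) = 0) :
    HasSubst (fun o : Option ι => o.elim (PowerSeries.X : K⟦X⟧) y) :=
  MvPowerSeries.hasSubst_of_constantCoeff_zero (constantCoeff_elim hy)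

/-- Evaluation at an arc, as an algebra homomorphism. -/
def evalHom {y : ι → K⟦X⟧} (hy : ∀ i, PowerSeries.constantCoeff (y i) = 0) :
    MvPowerSeries (Option ι) K →ₐ[K] K⟦X⟧ :=
  MvPowerSeries.substAlgHom (hasSubst_elim hy)

theorem evalHom_apply {y : ι → K⟦X⟧} (hy : ∀ i, PowerSeries.constantCoeff (y i) = 0)
    (f : MvPowerSeries (Option ι) K) : evalHom hy f = subst f y :=
  congrFun (MvPowerSeries.coe_substAlgHom (hasSubst_elim hy)) f

theorem subst_X_some {y : ι → K⟦X⟧} (hy : ∀ i, PowerSeries.constantCoeff (y i) = 0) (i : ι) :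
    subst (MvPowerSeries.X (some i) : MvPowerSeries (Option ι) K) y = y i :=
  MvPowerSeries.subst_X (hasSubst_elim hy) _

theorem subst_X_none {y : ι → K⟦X⟧} (hy : ∀ i, PowerSeries.constantCoeff (y i) = 0) :
    subst (MvPowerSeries.X none : MvPowerSeries (Option ι) K) y = PowerSeries.X :=
  MvPowerSeries.subst_X (hasSubst_elim hy) _

theorem constantCoeff_subst_arc {y : ι → K⟦X⟧} (hy : ∀ i, PowerSeries.constantCoeff (y i) = 0)
    {f : MvPowerSeries (Option ι) K} (hf : MvPowerSeries.constantCoeff f = 0) :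
    PowerSeries.constantCoeff (subst f y) = 0 :=
  MvPowerSeries.constantCoeff_subst_eq_zero (hasSubst_elim hy) (constantCoeff_elim hy) hf

/-- Evaluation at an arc of a composition of power series. -/
theorem subst_subst {y : ι → K⟦X⟧} (hy : ∀ i, PowerSeries.constantCoeff (y i) = 0) {σ : Type*}
    {θ : σ → MvPowerSeries (Option ι) K} (hθ : HasSubst θ) (F : MvPowerSeries σ K) :
    subst (MvPowerSeries.subst θ F) y = MvPowerSeries.subst (fun i => subst (θ i) y) F :=
  MvPowerSeries.subst_comp_subst_apply hθ (hasSubst_elim hy) F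

theorem subst_mem_series {y : ι → K⟦X⟧} (hy : y ∈ arcs Q ι) {f : MvPowerSeries (Option ι) K}
    (hf : f ∈ Q.series (Option ι)) : subst f y ∈ Q.series Unit :=
  Q.subst_mem (constantCoeff_elim fun i => (hy i).2) hf (elim_mem_series hy)

/-- First order Taylor expansion at an arc. -/
theorem exists_subst_add_eq {f : MvPowerSeries (Option ι) K} (hf : f ∈ Q.series (Option ι)) :
    ∃ h : Option ι → MvPowerSeries (Option ι ⊕ Option ι) K,
      (∀ o, h o ∈ Q.series (Option ι ⊕ Option ι)) ∧
      ∀ y v : ι → K⟦X⟧, (∀ i, PowerSeries.constantCoeff (y i) = 0) →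
        (∀ i, PowerSeries.constantCoeff (v i) = 0) →
        subst f (y + v) = subst f y + ∑ i, v i * MvPowerSeries.subst
          (Sum.elim (fun o : Option ι => o.elim (PowerSeries.X : K⟦X⟧) y)
            (fun o : Option ι => o.elim (0 : K⟦X⟧) v)) (h (some i)) := by
  obtain ⟨h, hQ, hh, -⟩ := exists_taylor_one Q hf
  refine ⟨h, hQ, fun y v hy hv => ?_⟩
  have hu := constantCoeff_elim hy
  have he : ∀ o : Option ι, MvPowerSeries.constantCoeff
      (o.elim (0 : K⟦X⟧) v : MvPowerSeries Unit K) = 0 := by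
    rintro (_ | i)
    · exact map_zero _
    · exact hv i
  have hs := hasSubst_sumElim hu he
  have := congrArg (MvPowerSeries.subst (Sum.elim (fun o : Option ι => o.elim (PowerSeries.X : K⟦X⟧) y)
    (fun o : Option ι => o.elim (0 : K⟦X⟧) v))) hh
  rw [subst_sumElim_X_add_X hu he, MvPowerSeries.subst_add hs, subst_sumElim_X_inl hu he,
    subst_sum hs, Fintype.sum_option, MvPowerSeries.subst_mul hs, MvPowerSeries.subst_X hs] at this
  have hadd : ((fun o : Option ι => o.elim (PowerSeries.X : K⟦X⟧) y) +
      fun o : Option ι => o.elim (0 : K⟦X⟧) v) =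
      fun o : Option ι => o.elim (PowerSeries.X : K⟦X⟧) (y + v) := by
    funext o
    cases o
    · exact add_zero _
    · rfl
  rw [hadd] at this
  refine this.trans ?_
  congr 1
  -- The variable `t` has increment zero, so the summand of index `none` drops out.
  rw [show Sum.elim (fun o : Option ι => o.elim (PowerSeries.X : K⟦X⟧) y)
    (fun o : Option ι => o.elim (0 : K⟦X⟧) v) (Sum.inr none) = 0 from rfl, zero_mul, zero_add]
  refine Finset.sum_congr rfl fun i _ => ?_
  rw [MvPowerSeries.subst_mul hs, MvPowerSeries.subst_X hs]
  rfl

/-- Moving an arc by multiples of `g` changes the value of `g` by a unit. -/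
theorem exists_unit_subst_add {g : MvPowerSeries (Option ι) K} (hg : g ∈ Q.series (Option ι))
    {y v : ι → K⟦X⟧} (hy : y ∈ arcs Q ι) (hv : ∀ i, ∃ x ∈ arcSeries Q, v i = subst g y * x) :
    ∃ u ∈ Q.series Unit, PowerSeries.constantCoeff u = 1 ∧
      subst g (y + v) = subst g y * u := by
  obtain ⟨h, hQ, hh⟩ := exists_subst_add_eq hg
  choose x hx hvx using hv
  have hvarc : v ∈ arcs Q ι := fun i => by
    rw [hvx i]
    exact mul_mem_arcSeries (subst_mem_series hy hg) (hx i)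
  have he : ∀ i, x i * MvPowerSeries.subst
      (Sum.elim (fun o : Option ι => o.elim (PowerSeries.X : K⟦X⟧) y)
        (fun o : Option ι => o.elim (0 : K⟦X⟧) v)) (h (some i)) ∈ arcSeries Q := by
    intro i
    rw [mul_comm]
    refine mul_mem_arcSeries (Q.subst_mem ?_ (hQ _) ?_) (hx i)
    · rintro (o | (_ | i))
      · exact constantCoeff_elim (fun i => (hy i).2) o
      · exact map_zero _
      · exact (hvarc i).2
    · rintro (o | (_ | i))
      · exact elim_mem_series hy o
      · exact zero_mem _
      · exact (hvarc i).1
  have hsum := sum_mem_arcSeries Finset.univ fun i _ => he i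
  refine ⟨1 + ∑ i, x i * MvPowerSeries.subst
      (Sum.elim (fun o : Option ι => o.elim (PowerSeries.X : K⟦X⟧) y)
        (fun o : Option ι => o.elim (0 : K⟦X⟧) v)) (h (some i)), add_mem (one_mem _) hsum.1, ?_, ?_⟩
  · rw [map_add, hsum.2, map_one, add_zero]
  · rw [hh y v (fun i => (hy i).2) (fun i => (hvarc i).2), mul_add, mul_one, Finset.mul_sum]
    congr 1
    refine Finset.sum_congr rfl fun i _ => ?_
    rw [hvx i, mul_assoc]

end Arcs

/-! ### The division module -/

theorem det_mem_subalgebra {A : Type*} [CommRing A] [Algebra K A] (S : Subalgebra K A) {n : Type*}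
    [Fintype n] [DecidableEq n] {M : Matrix n n A} (hM : ∀ i j, M i j ∈ S) : M.det ∈ S := by
  rw [Matrix.det_apply]
  refine sum_mem fun σ _ => ?_
  rw [Units.smul_def]
  exact zsmul_mem (prod_mem fun i _ => hM _ _) _

section Division

variable {Q : Quality K} {k m : ℕ} {F : Fin k → MvPowerSeries (Option (Fin m)) K}
  (hF : ∀ j, F j ∈ Q.series (Option (Fin m))) (c : Fin k ↪ Fin m)

theorem one_le_expo (i : Fin m) : 1 ≤ expo c i := by
  unfold expo; split_ifs <;> norm_num

theorem expo_apply (l : Fin k) : expo c (c l) = 1 := by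
  unfold expo; rw [if_pos ⟨l, rfl⟩]

theorem expo_rest (i : Rest c) : expo c i.1 = 2 := by
  unfold expo; rw [if_neg i.2]

theorem subst_gens {y : Fin m → K⟦X⟧} (hy : ∀ i, PowerSeries.constantCoeff (y i) = 0)
    (i : Fin m) : subst (gens F c i) y = subst (minor F c) y ^ expo c i :=
  MvPowerSeries.subst_pow (hasSubst_elim hy) _ _

include hF

theorem jac_mem (j : Fin k) (i : Fin m) : jac F j i ∈ Q.series (Option (Fin m)) :=
  Q.pderiv_mem (hF j) _

theorem minor_mem : minor F c ∈ Q.series (Option (Fin m)) :=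
  det_mem_subalgebra _ fun i j => jac_mem hF i (c j)

theorem gens_mem (i : Fin m) : gens F c i ∈ Q.series (Option (Fin m)) :=
  pow_mem (minor_mem hF c) _

theorem adjugate_mem (i j : Fin k) :
    ((jac F).submatrix id c).adjugate i j ∈ Q.series (Option (Fin m)) := by
  rw [Matrix.adjugate_apply]
  refine det_mem_subalgebra _ fun a b => ?_
  rw [Matrix.updateRow_apply]
  split_ifs
  · rw [Pi.single_apply]
    split_ifs
    · exact one_mem _
    · exact zero_mem _
  · exact jac_mem hF a (c b)

/-- Every exponent of `g` in the module is at least one, so the increments are multiples of `g(z)`,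
and the general statement on arcs applies to `g` itself. -/
theorem exists_unit_subst_minor {z v : Fin m → K⟦X⟧} (hz : z ∈ arcs Q (Fin m))
    (hv : v ∈ moduleAt Q (gens F c) z) :
    ∃ u ∈ Q.series Unit, PowerSeries.constantCoeff u = 1 ∧
      subst (minor F c) (z + v) = subst (minor F c) z * u := by
  refine exists_unit_subst_add (minor_mem hF c) hz fun i => ?_
  obtain ⟨x, hx, hvx⟩ := hv i
  rw [subst_gens c fun i => (hz i).2] at hvx
  refine ⟨subst (minor F c) z ^ (expo c i - 1) * x,
    mul_mem_arcSeries (pow_mem (subst_mem_series hz (minor_mem hF c)) _) hx, ?_⟩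
  rw [hvx, ← mul_assoc, ← pow_succ', Nat.sub_add_cancel (one_le_expo c i)]

theorem moduleAt_subset_arcs {z v : Fin m → K⟦X⟧} (hz : z ∈ arcs Q (Fin m))
    (hv : v ∈ moduleAt Q (gens F c) z) : v ∈ arcs Q (Fin m) := fun i => by
  obtain ⟨x, hx, hvx⟩ := hv i
  rw [hvx]
  exact mul_mem_arcSeries (subst_mem_series hz (gens_mem hF c i)) hx

/-- The values of `g` at `z` and `z + v` differ by a unit, hence so do the generators, which are
powers of `g`. -/
theorem moduleAt_add {z v : Fin m → K⟦X⟧} (hz : z ∈ arcs Q (Fin m))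
    (hv : v ∈ moduleAt Q (gens F c) z) :
    moduleAt Q (gens F c) z = moduleAt Q (gens F c) (z + v) := by
  obtain ⟨u, hu, hu1, hgu⟩ := exists_unit_subst_minor hF c hz hv
  obtain ⟨u', hu', huu'⟩ := Q.inv_mem hu (by
    change PowerSeries.constantCoeff u ≠ 0
    rw [hu1]; exact one_ne_zero)
  have hvarc := moduleAt_subset_arcs hF c hz hv
  have hzv : ∀ i, PowerSeries.constantCoeff ((z + v) i) = 0 := fun i => by
    rw [Pi.add_apply, map_add, (hz i).2, (hvarc i).2, add_zero]
  ext w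
  refine forall_congr' fun i => ?_
  rw [subst_gens c fun i => (hz i).2, subst_gens c hzv, hgu]
  constructor
  · rintro ⟨x, hx, hwx⟩
    refine ⟨u' ^ expo c i * x, mul_mem_arcSeries (pow_mem hu' _) hx, ?_⟩
    have : u ^ expo c i * u' ^ expo c i = 1 := by rw [← mul_pow, huu', one_pow]
    rw [hwx, mul_pow]
    linear_combination -(subst (minor F c) z ^ expo c i * x) * this
  · rintro ⟨x, hx, hwx⟩
    exact ⟨u ^ expo c i * x, mul_mem_arcSeries (pow_mem hu _) hx, by rw [hwx]; ring⟩

end Division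

/-! ### The Taylor remainder -/

section Remainder

variable {Q : Quality K} {k m : ℕ}

/-- The variables `t, z` among the variables `t, z, a`. -/
def zVars (K : Type*) [Field K] (m : ℕ) (o : Option (Fin m)) :
    MvPowerSeries (Option (Fin m ⊕ Fin m)) K :=
  o.elim (MvPowerSeries.X none) fun i => MvPowerSeries.X (some (Sum.inl i))

theorem constantCoeff_zVars (o : Option (Fin m)) :
    MvPowerSeries.constantCoeff (zVars K m o) = 0 := by
  cases o <;> exact MvPowerSeries.constantCoeff_X _

theorem hasSubst_zVars : HasSubst (zVars K m) :=
  MvPowerSeries.hasSubst_of_constantCoeff_zero constantCoeff_zVars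

theorem zVars_mem (o : Option (Fin m)) : zVars K m o ∈ Q.series _ := by
  cases o <;> exact Q.X_mem _

theorem constantCoeff_sumElim {z a : Fin m → K⟦X⟧} (hz : ∀ i, PowerSeries.constantCoeff (z i) = 0)
    (ha : ∀ i, PowerSeries.constantCoeff (a i) = 0) (i : Fin m ⊕ Fin m) :
    PowerSeries.constantCoeff (Sum.elim z a i) = 0 := by
  rcases i with i | i
  exacts [hz i, ha i]

theorem sumElim_mem_arcs {ι κ : Type*} {z : ι → K⟦X⟧} {a : κ → K⟦X⟧} (hz : z ∈ arcs Q ι)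
    (ha : a ∈ arcs Q κ) : Sum.elim z a ∈ arcs Q (ι ⊕ κ) := by
  rintro (i | i)
  exacts [hz i, ha i]

theorem subst_zVars {z a : Fin m → K⟦X⟧} (hz : ∀ i, PowerSeries.constantCoeff (z i) = 0)
    (ha : ∀ i, PowerSeries.constantCoeff (a i) = 0) (f : MvPowerSeries (Option (Fin m)) K) :
    subst (MvPowerSeries.subst (zVars K m) f) (Sum.elim z a) = subst f z := by
  have hs := constantCoeff_sumElim hz ha
  rw [subst_subst hs hasSubst_zVars]
  unfold subst
  congr 1
  funext o
  cases o with
  | none => exact subst_X_none hs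
  | some i => exact subst_X_some hs _

variable (F : Fin k → MvPowerSeries (Option (Fin m)) K) (c : Fin k ↪ Fin m)

/-- The entries of `a' = (a¹, g a²)`. -/
def scaledVars (i : Fin m) : MvPowerSeries (Option (Fin m ⊕ Fin m)) K :=
  MvPowerSeries.subst (zVars K m) (minor F c) ^ (expo c i - 1) * MvPowerSeries.X (some (Sum.inr i))

/-- The increments `g a'`. -/
def increments (o : Option (Fin m)) : MvPowerSeries (Option (Fin m ⊕ Fin m)) K :=
  o.elim 0 fun i => MvPowerSeries.subst (zVars K m) (minor F c) * scaledVars F c i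

/-- The second order part of the Taylor expansion, divided by `g²`. -/
def quadraticPart (h : Option (Fin m) → Option (Fin m) →
      MvPowerSeries (Option (Fin m) ⊕ Option (Fin m)) K) :
    MvPowerSeries (Option (Fin m ⊕ Fin m)) K :=
  ∑ i, ∑ l, scaledVars F c i * scaledVars F c l *
    MvPowerSeries.subst (Sum.elim (zVars K m) (increments F c)) (h (some i) (some l))

theorem constantCoeff_increments (o : Option (Fin m)) :
    MvPowerSeries.constantCoeff (increments F c o) = 0 := by
  cases o with
  | none => exact map_zero _
  | some i => simp [increments, scaledVars]

theorem hasSubst_zVars_increments : HasSubst (Sum.elim (zVars K m) (increments F c)) :=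
  hasSubst_sumElim constantCoeff_zVars (constantCoeff_increments F c)

/-- The total degree in the variables `a`. -/
def aDegree (m : ℕ) : (Option (Fin m ⊕ Fin m) →₀ ℕ) →+ ℕ :=
  ∑ j : Fin m, Finsupp.applyAddHom (some (Sum.inr j))

theorem aDegree_apply (α : Option (Fin m ⊕ Fin m) →₀ ℕ) :
    aDegree m α = ∑ j : Fin m, α (some (Sum.inr j)) := by
  simp [aDegree]

theorem scaledVars_mem_weightIdeal (i : Fin m) :
    scaledVars F c i ∈ weightIdeal K (aDegree m) 1 := by
  classical
  refine Ideal.mul_mem_left _ _ fun α hα => ?_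
  rw [MvPowerSeries.coeff_X, if_neg]
  rintro rfl
  rw [aDegree_apply] at hα
  have := Finset.single_le_sum (f := fun j : Fin m =>
    (Finsupp.single (some (Sum.inr i)) 1 : Option (Fin m ⊕ Fin m) →₀ ℕ) (some (Sum.inr j)))
    (fun _ _ => Nat.zero_le _) (Finset.mem_univ i)
  simp only [Finsupp.single_eq_same] at this
  omega

theorem quadraticPart_mem_weightIdeal (h : Option (Fin m) → Option (Fin m) →
      MvPowerSeries (Option (Fin m) ⊕ Option (Fin m)) K) :
    quadraticPart F c h ∈ weightIdeal K (aDegree m) 2 :=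
  sum_mem fun i _ => sum_mem fun l _ => Ideal.mul_mem_right _ _
    (mul_mem_weightIdeal (scaledVars_mem_weightIdeal F c i) (scaledVars_mem_weightIdeal F c l))

section Quality

variable {F} (hF : ∀ j, F j ∈ Q.series (Option (Fin m)))
include hF

theorem scaledVars_mem (i : Fin m) : scaledVars F c i ∈ Q.series _ :=
  mul_mem (pow_mem (Q.subst_mem constantCoeff_zVars (minor_mem hF c) zVars_mem) _) (Q.X_mem _)

theorem quadraticPart_mem {h : Option (Fin m) → Option (Fin m) →
      MvPowerSeries (Option (Fin m) ⊕ Option (Fin m)) K} (hh : ∀ i l, h i l ∈ Q.series _) :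
    quadraticPart F c h ∈ Q.series _ := by
  refine sum_mem fun i _ => sum_mem fun l _ => mul_mem
    (mul_mem (scaledVars_mem c hF i) (scaledVars_mem c hF l)) (Q.subst_mem ?_ (hh _ _) ?_)
  · rintro (o | o)
    exacts [constantCoeff_zVars o, constantCoeff_increments F c o]
  · rintro (o | (_ | i))
    · exact zVars_mem o
    · exact zero_mem _
    · exact mul_mem (Q.subst_mem constantCoeff_zVars (minor_mem hF c) zVars_mem)
        (scaledVars_mem c hF i)

end Quality

theorem subst_scaledVars {z a : Fin m → K⟦X⟧} (hz : ∀ i, PowerSeries.constantCoeff (z i) = 0)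
    (ha : ∀ i, PowerSeries.constantCoeff (a i) = 0) (i : Fin m) :
    subst (minor F c) z * subst (scaledVars F c i) (Sum.elim z a) = scale (gens F c) z a i := by
  have hs := constantCoeff_sumElim hz ha
  rw [scale, subst_gens c hz, scaledVars, ← evalHom_apply hs, map_mul, map_pow, evalHom_apply,
    evalHom_apply, subst_zVars hz ha, subst_X_some hs, Sum.elim_inr, ← mul_assoc, ← pow_succ',
    Nat.sub_add_cancel (one_le_expo c i)]

theorem constantCoeff_scale {z a : Fin m → K⟦X⟧}
    (ha : ∀ i, PowerSeries.constantCoeff (a i) = 0) (i : Fin m) :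
    PowerSeries.constantCoeff (scale (gens F c) z a i) = 0 := by
  rw [scale, map_mul, ha, mul_zero]

/-- Second order Taylor expansion with coefficients `h` for the second order part. -/
def HasTaylorTwo {σ : Type*} [Fintype σ] (f : MvPowerSeries σ K)
    (h : σ → σ → MvPowerSeries (σ ⊕ σ) K) : Prop :=
  MvPowerSeries.subst (fun i => MvPowerSeries.X (Sum.inl i) + MvPowerSeries.X (Sum.inr i) :
      σ → MvPowerSeries (σ ⊕ σ) K) f =
    MvPowerSeries.subst (fun i => MvPowerSeries.X (Sum.inl i) : σ → MvPowerSeries (σ ⊕ σ) K) f +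
    ∑ j, MvPowerSeries.X (Sum.inr j) * MvPowerSeries.subst
      (fun i => MvPowerSeries.X (Sum.inl i) : σ → MvPowerSeries (σ ⊕ σ) K)
      (MvPowerSeries.pderiv K j f) +
    ∑ j, ∑ l, MvPowerSeries.X (Sum.inr j) * MvPowerSeries.X (Sum.inr l) * h j l

theorem HasTaylorTwo.subst_add {σ τ : Type*} [Fintype σ] {f : MvPowerSeries σ K}
    {h : σ → σ → MvPowerSeries (σ ⊕ σ) K} (hh : HasTaylorTwo f h) {u e : σ → MvPowerSeries τ K}
    (hu : ∀ i, MvPowerSeries.constantCoeff (u i) = 0)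
    (he : ∀ i, MvPowerSeries.constantCoeff (e i) = 0) :
    MvPowerSeries.subst (u + e) f = MvPowerSeries.subst u f +
      ∑ j, e j * MvPowerSeries.subst u (MvPowerSeries.pderiv K j f) +
      ∑ j, ∑ l, e j * e l * MvPowerSeries.subst (Sum.elim u e) (h j l) := by
  have hs := hasSubst_sumElim hu he
  have key := congrArg (MvPowerSeries.subst (Sum.elim u e)) hh
  rw [subst_sumElim_X_add_X hu he, MvPowerSeries.subst_add hs, MvPowerSeries.subst_add hs,
    subst_sumElim_X_inl hu he, subst_sum hs, subst_sum hs] at key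
  refine key.trans ?_
  congr 1
  · congr 1
    refine Finset.sum_congr rfl fun j _ => ?_
    rw [MvPowerSeries.subst_mul hs, MvPowerSeries.subst_X hs, subst_sumElim_X_inl hu he]
    rfl
  · refine Finset.sum_congr rfl fun j _ => ?_
    rw [subst_sum hs]
    refine Finset.sum_congr rfl fun l _ => ?_
    rw [MvPowerSeries.subst_mul hs, MvPowerSeries.subst_mul hs, MvPowerSeries.subst_X hs,
      MvPowerSeries.subst_X hs]
    rfl

/-- Each increment is `g(z)` times a value of `scaledVars`, so `g(z)²` can be extracted from every
product of two of them. -/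
theorem subst_quadraticPart {z a : Fin m → K⟦X⟧} (hz : ∀ i, PowerSeries.constantCoeff (z i) = 0)
    (ha : ∀ i, PowerSeries.constantCoeff (a i) = 0)
    (h : Option (Fin m) → Option (Fin m) → MvPowerSeries (Option (Fin m) ⊕ Option (Fin m)) K) :
    subst (minor F c) z ^ 2 * subst (quadraticPart F c h) (Sum.elim z a) =
      ∑ i, ∑ l, scale (gens F c) z a i * scale (gens F c) z a l * MvPowerSeries.subst
        (Sum.elim (fun o : Option (Fin m) => o.elim (PowerSeries.X : K⟦X⟧) z)
          (fun o : Option (Fin m) => o.elim (0 : K⟦X⟧) (scale (gens F c) z a)))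
        (h (some i) (some l)) := by
  have hs := constantCoeff_sumElim hz ha
  have hE := evalHom_apply hs
  have hfun : (fun i => subst (Sum.elim (zVars K m) (increments F c) i) (Sum.elim z a)) =
      Sum.elim (fun o : Option (Fin m) => o.elim (PowerSeries.X : K⟦X⟧) z)
        (fun o : Option (Fin m) => o.elim (0 : K⟦X⟧) (scale (gens F c) z a)) := by
    funext o
    rcases o with (_ | i) | (_ | i)
    · exact subst_X_none hs
    · exact subst_X_some hs _
    · change subst 0 (Sum.elim z a) = 0
      rw [← hE, map_zero]
    · change subst (MvPowerSeries.subst (zVars K m) (minor F c) * scaledVars F c i)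
        (Sum.elim z a) = scale (gens F c) z a i
      rw [← hE, map_mul, hE, hE, subst_zVars hz ha, subst_scaledVars F c hz ha]
  rw [quadraticPart, ← hE]
  simp only [map_sum, map_mul, Finset.mul_sum]
  refine Finset.sum_congr rfl fun i _ => Finset.sum_congr rfl fun l _ => ?_
  rw [hE, hE, hE, subst_subst hs (hasSubst_zVars_increments F c), hfun,
    ← subst_scaledVars F c hz ha, ← subst_scaledVars F c hz ha]
  ring

/-- Second order Taylor expansion along the increments `Δ(z) a`. -/
theorem subst_add_scale {z a : Fin m → K⟦X⟧} (hz : ∀ i, PowerSeries.constantCoeff (z i) = 0)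
    (ha : ∀ i, PowerSeries.constantCoeff (a i) = 0) {f : MvPowerSeries (Option (Fin m)) K}
    {h : Option (Fin m) → Option (Fin m) → MvPowerSeries (Option (Fin m) ⊕ Option (Fin m)) K}
    (hh : HasTaylorTwo f h) :
    subst f (z + scale (gens F c) z a) = subst f z +
      ∑ i, scale (gens F c) z a i * subst (MvPowerSeries.pderiv K (some i) f) z +
      subst (minor F c) z ^ 2 * subst (quadraticPart F c h) (Sum.elim z a) := by
  have he : ∀ o : Option (Fin m), MvPowerSeries.constantCoeff
      (o.elim (0 : K⟦X⟧) (scale (gens F c) z a) : MvPowerSeries Unit K) = 0 := by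
    rintro (_ | i)
    · exact map_zero _
    · exact constantCoeff_scale F c ha i
  have key := hh.subst_add (constantCoeff_elim hz) he
  have hadd : ((fun o : Option (Fin m) => o.elim (PowerSeries.X : K⟦X⟧) z) +
      fun o : Option (Fin m) => o.elim (0 : K⟦X⟧) (scale (gens F c) z a)) =
      fun o : Option (Fin m) => o.elim (PowerSeries.X : K⟦X⟧) (z + scale (gens F c) z a) := by
    funext o
    cases o
    · exact add_zero _
    · rfl
  rw [hadd] at key
  refine key.trans ?_
  rw [subst_quadraticPart F c hz ha]
  simp only [Fintype.sum_option, Option.elim_none, Option.elim_some, zero_mul, mul_zero, zero_add,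
    Finset.sum_const_zero]
  rfl

/-- The vector `p` whose components of index in `c` are `∂_{y¹}^* f · r`, the others being zero. -/
def remainderVec (r : Fin k → MvPowerSeries (Option (Fin m ⊕ Fin m)) K) (i : Fin m) :
    MvPowerSeries (Option (Fin m ⊕ Fin m)) K :=
  ∑ l, (if c l = i then ∑ j, MvPowerSeries.subst (zVars K m)
    (((jac F).submatrix id c).adjugate l j) * r j else 0)

theorem remainderVec_apply (r : Fin k → MvPowerSeries (Option (Fin m ⊕ Fin m)) K) (l : Fin k) :
    remainderVec F c r (c l) = ∑ j, MvPowerSeries.subst (zVars K m)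
      (((jac F).submatrix id c).adjugate l j) * r j := by
  rw [remainderVec, Finset.sum_eq_single l]
  · rw [if_pos rfl]
  · intro l' _ hl'
    rw [if_neg fun h => hl' (c.injective h)]
  · simp

theorem remainderVec_rest (r : Fin k → MvPowerSeries (Option (Fin m ⊕ Fin m)) K) {i : Fin m}
    (hi : i ∉ Set.range c) : remainderVec F c r i = 0 :=
  Finset.sum_eq_zero fun l _ => if_neg fun h => hi ⟨l, h⟩

/-- Sums over all variables split according to the columns of the minor. -/
theorem sum_eq_sum_add_sum_rest {A : Type*} [AddCommMonoid A] (φ : Fin m → A) :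
    ∑ i, φ i = ∑ l, φ (c l) + ∑ i : Rest c, φ i.1 := by
  classical
  rw [← Finset.sum_add_sum_compl (Finset.univ.map c) φ, Finset.sum_map]
  congr 1
  refine (Finset.sum_bij (fun (i : Rest c) _ => i.1) ?_ ?_ ?_ ?_).symm
  · intro i _
    have := i.2
    simpa using this
  · intro i _ j _ hij
    exact Subtype.ext hij
  · intro i hi
    refine ⟨⟨i, ?_⟩, Finset.mem_univ _, rfl⟩
    simpa using hi
  · intro i _
    rfl

/-- Evaluation of the adjugate identity `∂_{y¹} f · ∂_{y¹}^* f = g`. -/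
theorem jacAt_submatrix_mul_adjAt {z : Fin m → K⟦X⟧}
    (hz : ∀ i, PowerSeries.constantCoeff (z i) = 0) :
    (jacAt F z).submatrix id c * adjAt F c z = subst (minor F c) z • (1 : Matrix (Fin k) (Fin k) _) ∧
    adjAt F c z * (jacAt F z).submatrix id c = subst (minor F c) z • (1 : Matrix (Fin k) (Fin k) _) ∧
    ∀ l j, adjAt F c z l j = subst (((jac F).submatrix id c).adjugate l j) z := by
  have hM : (jacAt F z).submatrix id c = ((evalHom hz).mapMatrix ((jac F).submatrix id c)) := by
    ext i j
    simp only [jacAt, Matrix.submatrix_apply, Matrix.map_apply, AlgHom.mapMatrix_apply,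
      evalHom_apply]
  have hdet : ((jacAt F z).submatrix id c).det = subst (minor F c) z := by
    rw [hM, ← AlgHom.map_det, evalHom_apply]
    rfl
  refine ⟨?_, ?_, fun l j => ?_⟩
  · rw [adjAt, Matrix.mul_adjugate, hdet]
  · rw [adjAt, Matrix.adjugate_mul, hdet]
  · rw [adjAt, hM, ← AlgHom.map_adjugate, AlgHom.mapMatrix_apply, Matrix.map_apply, evalHom_apply]

/-- The second order part is `g² r`. Since `∂_{y¹} f · (g ∂_{y¹}^* f · r) = g² r`, the vector
`(∂_{y¹}^* f · r, 0)` serves as remainder; it inherits order two in `a` from `r`. -/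
theorem exists_isTaylorRemainder {F} (hF : ∀ j, F j ∈ Q.series (Option (Fin m))) :
    ∃ p, IsTaylorRemainder Q F (gens F c) p := by
  choose h hQ hh using fun j => exists_taylor_two Q (hF j)
  refine ⟨remainderVec F c fun j => quadraticPart F c (h j), ⟨fun i => ?_, fun i => ?_, ?_⟩⟩
  · refine sum_mem fun l _ => ?_
    split_ifs
    · exact sum_mem fun j _ => mul_mem (Q.subst_mem constantCoeff_zVars (adjugate_mem hF c l j)
        zVars_mem) (quadraticPart_mem c hF (hQ j))
    · exact zero_mem _
  · have : remainderVec F c (fun j => quadraticPart F c (h j)) i ∈ weightIdeal K (aDegree m) 2 := by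
      refine sum_mem fun l _ => ?_
      split_ifs
      · exact sum_mem fun j _ => Ideal.mul_mem_left _ _ (quadraticPart_mem_weightIdeal F c (h j))
      · exact zero_mem _
    intro α hα
    by_contra hlt
    rw [← aDegree_apply, not_le] at hlt
    exact hα (this α hlt)
  · intro z hz a ha
    have hz0 := fun i => (hz i).2
    have ha0 := fun i => (ha i).2
    have hs := constantCoeff_sumElim hz0 ha0
    obtain ⟨h1, -, h3⟩ := jacAt_submatrix_mul_adjAt F c hz0
    funext j
    simp only [Pi.add_apply, evalVec]
    rw [subst_add_scale F c hz0 ha0 (hh j)]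
    congr 1
    · congr 1
      simp only [Matrix.mulVec, dotProduct]
      exact Finset.sum_congr rfl fun i _ => mul_comm _ _
    -- One factor `g(z)` comes from the scaling of the columns in `c`, the other from the Jacobian
    -- submatrix times its adjugate; the remaining columns contribute nothing.
    · set r : Fin k → K⟦X⟧ := fun j => subst (quadraticPart F c (h j)) (Sum.elim z a) with hr
      have hrest : ∀ i : Rest c, scale (gens F c) z
          (evalPair (remainderVec F c fun j => quadraticPart F c (h j)) z a) i.1 = 0 := by
        intro i
        rw [scale, evalPair, remainderVec_rest F c _ i.2, ← evalHom_apply hs, map_zero, mul_zero]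
      have hc : ∀ l, scale (gens F c) z
          (evalPair (remainderVec F c fun j => quadraticPart F c (h j)) z a) (c l) =
          subst (minor F c) z * (adjAt F c z).mulVec r l := by
        intro l
        rw [scale, evalPair, remainderVec_apply, ← evalHom_apply hs, map_sum, subst_gens c hz0,
          expo_apply, pow_one]
        congr 1
        simp only [Matrix.mulVec, dotProduct]
        refine Finset.sum_congr rfl fun j' _ => ?_
        rw [map_mul, evalHom_apply, evalHom_apply, subst_zVars hz0 ha0, h3]
      have hmul : ((jacAt F z).submatrix id c).mulVec ((adjAt F c z).mulVec r) j =
          subst (minor F c) z * r j := by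
        rw [Matrix.mulVec_mulVec, h1, Matrix.smul_mulVec, Matrix.one_mulVec]
        rfl
      rw [Matrix.mulVec, dotProduct, sum_eq_sum_add_sum_rest c]
      simp only [hrest, hc, mul_zero, Finset.sum_const_zero, add_zero]
      rw [Matrix.mulVec, dotProduct] at hmul
      simp only [Matrix.submatrix_apply, id] at hmul
      have : ∑ l, jacAt F z j (c l) * (subst (minor F c) z * (adjAt F c z).mulVec r l) =
          subst (minor F c) z * ∑ l, jacAt F z j (c l) * (adjAt F c z).mulVec r l := by
        rw [Finset.mul_sum]
        exact Finset.sum_congr rfl fun l _ => by ring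
      rw [this, hmul, hr]
      ring

theorem isDivisionModule_gens {F} (hF : ∀ j, F j ∈ Q.series (Option (Fin m)))
    (hg : minor F c ≠ 0) : IsDivisionModule Q F (gens F c) where
  quality := gens_mem hF c
  ne_zero _ := pow_ne_zero _ hg
  stable _ hz _ hv := moduleAt_add hF c hz hv
  taylor := exists_isTaylorRemainder c hF

end Remainder

/-! ### Univariate series: polynomials, division, order -/

section Univariate

variable {Q : Quality K}

theorem Quality.X_pow_mem (Q : Quality K) (n : ℕ) : (PowerSeries.X ^ n : K⟦X⟧) ∈ Q.series Unit :=
  pow_mem (Q.X_mem ()) n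

theorem Quality.mem_of_X_pow_mul_mem (Q : Quality K) {n : ℕ} {f : K⟦X⟧}
    (h : (PowerSeries.X ^ n * f : K⟦X⟧) ∈ Q.series Unit) : f ∈ Q.series Unit := by
  induction n with
  | zero => simpa using h
  | succ n ih =>
    rw [pow_succ', mul_assoc] at h
    exact ih (Q.mem_of_X_mul_mem h)

theorem Quality.polynomial_mem (Q : Quality K) (P : Polynomial K) :
    (P : K⟦X⟧) ∈ Q.series Unit := by
  induction P using Polynomial.induction_on' with
  | add p q hp hq =>
    rw [Polynomial.coe_add]
    exact add_mem hp hq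
  | monomial n a =>
    rw [Polynomial.coe_monomial, PowerSeries.monomial_eq_C_mul_X_pow]
    exact mul_mem (Q.C_mem a) (Q.X_pow_mem n)

/-- A series of order `d` is `t ^ d` times a unit of the same quality. -/
theorem exists_eq_X_pow_mul {h : K⟦X⟧} (hQ : h ∈ Q.series Unit) {d : ℕ}
    (hd : h.order = (d : ℕ∞)) :
    ∃ u ∈ Q.series Unit, ∃ u' ∈ Q.series Unit, h = PowerSeries.X ^ d * u ∧ u * u' = 1 := by
  obtain ⟨hne, hlt⟩ := PowerSeries.order_eq_nat.mp hd
  obtain ⟨u, hu⟩ := PowerSeries.X_pow_dvd_iff.mpr hlt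
  have huQ : u ∈ Q.series Unit := Q.mem_of_X_pow_mul_mem (n := d) (hu ▸ hQ)
  have h0 : PowerSeries.constantCoeff u ≠ 0 := by
    rw [hu] at hne
    simpa [PowerSeries.coeff_X_pow_mul'] using hne
  obtain ⟨u', hu', huu'⟩ := Q.inv_mem huQ h0
  exact ⟨u, huQ, u', hu', hu, huu'⟩

theorem quotient_mul {h x : K⟦X⟧} (hh : h ≠ 0) : quotient (h * x) h = x := by
  have H : h ∣ h * x := dvd_mul_right _ _
  rw [quotient, dif_pos H]
  exact (mul_left_cancel₀ hh H.choose_spec).symm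

theorem order_mul_unit {h u : K⟦X⟧} (hu : PowerSeries.constantCoeff u = 1) :
    (h * u).order = h.order := by
  rw [PowerSeries.order_mul]
  have : u.order = 0 := by
    rw [PowerSeries.order_zero_of_unit]
    rw [PowerSeries.isUnit_iff_constantCoeff, hu]
    exact isUnit_one
  rw [this, add_zero]

end Univariate

/-! ### Inversion of `a ↦ a + p(z, a)` -/

section Solve

variable {Q : Quality K} {k m : ℕ} {F : Fin k → MvPowerSeries (Option (Fin m)) K}
  {γ : Fin m → MvPowerSeries (Option (Fin m)) K}
  {p : Fin m → MvPowerSeries (Option (Fin m ⊕ Fin m)) K}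

/-- The vector `(0, 0, p)` in the variables `t, z, a`. -/
def extendZero (p : Fin m → MvPowerSeries (Option (Fin m ⊕ Fin m)) K)
    (o : Option (Fin m ⊕ Fin m)) : MvPowerSeries (Option (Fin m ⊕ Fin m)) K :=
  o.elim 0 (Sum.elim (fun _ => 0) p)

/-- The solution `a` of `a + p(z, a) = b`. -/
def solve (p : Fin m → MvPowerSeries (Option (Fin m ⊕ Fin m)) K) (z b : Fin m → K⟦X⟧) :
    Fin m → K⟦X⟧ :=
  fun i => subst (picardLimit (extendZero p) (some (Sum.inr i))) (Sum.elim z b)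

section

variable (hp : IsTaylorRemainder Q F γ p)
include hp

theorem IsTaylorRemainder.constantCoeff_eq_zero (i : Fin m) :
    MvPowerSeries.constantCoeff (p i) = 0 := by
  by_contra h
  have := hp.order_two i 0 (by rwa [MvPowerSeries.coeff_zero_eq_constantCoeff_apply])
  simp at this

/-- Total degree is at least the degree in `a`. Padding by zeros makes `(t, z, a) ↦ (t, z, a + p)` a
self-map of the kind inverted above, with the parameters `t, z` treated as variables. -/
theorem IsTaylorRemainder.extendZero_mem_ordIdeal (o : Option (Fin m ⊕ Fin m)) :
    extendZero p o ∈ ordIdeal K _ 2 := by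
  rcases o with _ | (i | i)
  · exact zero_mem _
  · exact zero_mem _
  · intro α hα
    by_contra h
    have h1 := hp.order_two i α h
    have h2 : ∑ j : Fin m, α (some (Sum.inr j)) ≤ α.degree := by
      rw [Finsupp.degree_eq_sum, Fintype.sum_option, Fintype.sum_sum_type]
      omega
    omega

theorem IsTaylorRemainder.extendZero_mem (o : Option (Fin m ⊕ Fin m)) :
    extendZero p o ∈ Q.series _ := by
  rcases o with _ | (i | i)
  · exact zero_mem _
  · exact zero_mem _
  · exact hp.quality i

theorem IsTaylorRemainder.evalPair_mem {z a : Fin m → K⟦X⟧} (hz : z ∈ arcs Q (Fin m))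
    (ha : a ∈ arcs Q (Fin m)) : evalPair p z a ∈ arcs Q (Fin m) := fun i =>
  ⟨subst_mem_series (sumElim_mem_arcs hz ha) (hp.quality i),
    constantCoeff_subst_arc (fun i => (sumElim_mem_arcs hz ha i).2) (hp.constantCoeff_eq_zero i)⟩

theorem IsTaylorRemainder.solve_mem {z b : Fin m → K⟦X⟧} (hz : z ∈ arcs Q (Fin m))
    (hb : b ∈ arcs Q (Fin m)) : solve p z b ∈ arcs Q (Fin m) := fun _ =>
  ⟨subst_mem_series (sumElim_mem_arcs hz hb)
      (picardLimit_mem hp.extendZero_mem_ordIdeal Q hp.extendZero_mem _),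
    constantCoeff_subst_arc (fun i => (sumElim_mem_arcs hz hb i).2)
      (constantCoeff_picardLimit hp.extendZero_mem_ordIdeal _)⟩

/-- The identity of the Picard limit, evaluated at the arc `(t, z, b)`. -/
theorem IsTaylorRemainder.solve_add_evalPair {z b : Fin m → K⟦X⟧} (hz : z ∈ arcs Q (Fin m))
    (hb : b ∈ arcs Q (Fin m)) : solve p z b + evalPair p z (solve p z b) = b := by
  have hs : ∀ i, PowerSeries.constantCoeff (Sum.elim z b i) = 0 :=
    fun i => (sumElim_mem_arcs hz hb i).2
  have hord := hp.extendZero_mem_ordIdeal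
  have hw := MvPowerSeries.hasSubst_of_constantCoeff_zero (constantCoeff_picardLimit hord)
  have key : ∀ o, subst (picardLimit (extendZero p) o) (Sum.elim z b) +
      MvPowerSeries.subst (fun o => subst (picardLimit (extendZero p) o) (Sum.elim z b))
        (extendZero p o) = subst (MvPowerSeries.X o) (Sum.elim z b) := by
    intro o
    rw [← subst_subst hs hw, ← picardLimit_add_subst hord o, ← evalHom_apply hs,
      ← evalHom_apply hs, ← evalHom_apply hs, map_add]
  -- The components of the inverse in `t` and `z` are the variables themselves, because the padded
  -- vector vanishes there.
  have hfun : (fun o => subst (picardLimit (extendZero p) o) (Sum.elim z b)) =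
      fun o : Option (Fin m ⊕ Fin m) => o.elim PowerSeries.X (Sum.elim z (solve p z b)) := by
    have hzero : MvPowerSeries.subst (fun o => subst (picardLimit (extendZero p) o) (Sum.elim z b))
        (0 : MvPowerSeries (Option (Fin m ⊕ Fin m)) K) = 0 :=
      subst_zero (MvPowerSeries.hasSubst_of_constantCoeff_zero fun o =>
        constantCoeff_subst_arc hs (constantCoeff_picardLimit hord o))
    funext o
    rcases o with _ | (i | i)
    · have := key none
      rw [show extendZero p none = 0 from rfl, hzero, subst_X_none hs, add_zero] at this
      exact this
    · have := key (some (Sum.inl i))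
      rw [show extendZero p (some (Sum.inl i)) = 0 from rfl, hzero, subst_X_some hs,
        add_zero] at this
      exact this
    · rfl
  funext i
  have := key (some (Sum.inr i))
  rw [hfun, subst_X_some hs] at this
  exact this

/-- Both sides solve the same fixed point equation for univariate series, and the contraction
argument makes the solution unique. -/
theorem IsTaylorRemainder.solve_apply {z a : Fin m → K⟦X⟧} (hz : z ∈ arcs Q (Fin m))
    (ha : a ∈ arcs Q (Fin m)) : solve p z (a + evalPair p z a) = a := by
  have hpa := hp.evalPair_mem hz ha
  have hb : a + evalPair p z a ∈ arcs Q (Fin m) := fun i => add_mem_arcSeries (ha i) (hpa i)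
  set b := a + evalPair p z a with hbdef
  have ha' := hp.solve_mem hz hb
  have h1 := hp.solve_add_evalPair hz hb
  have hu := eq_of_add_subst_eq (τ := Unit) hp.extendZero_mem_ordIdeal
    (u := fun o : Option (Fin m ⊕ Fin m) => o.elim PowerSeries.X (Sum.elim z (solve p z b)))
    (u' := fun o : Option (Fin m ⊕ Fin m) => o.elim PowerSeries.X (Sum.elim z a))
    (constantCoeff_elim fun i => (sumElim_mem_arcs hz ha' i).2)
    (constantCoeff_elim fun i => (sumElim_mem_arcs hz ha i).2) ?_
  · funext i
    exact congrFun hu (some (Sum.inr i))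
  · have hs1 := hasSubst_elim fun i => (sumElim_mem_arcs hz ha' i).2
    have hs2 := hasSubst_elim fun i => (sumElim_mem_arcs hz ha i).2
    rintro (_ | (i | i))
    · rw [show extendZero p none = 0 from rfl, subst_zero hs1, subst_zero hs2]
      rfl
    · rw [show extendZero p (some (Sum.inl i)) = 0 from rfl, subst_zero hs1, subst_zero hs2]
      rfl
    · exact congrFun (h1.trans hbdef) i

end

end Solve

/-! ### Structure of the strata -/

section Strata

variable {Q : Quality K} {k m : ℕ} {F : Fin k → MvPowerSeries (Option (Fin m)) K}
  {c : Fin k ↪ Fin m} {d : ℕ}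

theorem polyVecs_subset_arcs {z : Fin m → K⟦X⟧} (hz : z ∈ polyVecs K c d) :
    z ∈ arcs Q (Fin m) := fun i => by
  refine ⟨?_, (hz i).1⟩
  have : z i = (PowerSeries.trunc (expo c i * d + 1) (z i) : K⟦X⟧) := by
    ext n
    rw [Polynomial.coeff_coe, PowerSeries.coeff_trunc]
    split_ifs with h
    · rfl
    · exact (hz i).2 n (by omega)
  rw [this]
  exact Q.polynomial_mem _

theorem remainder_mem_polyVecs {y : Fin m → K⟦X⟧}
    (hy : ∀ i, PowerSeries.constantCoeff (y i) = 0) : remainder c d y ∈ polyVecs K c d := by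
  refine fun i => ⟨?_, fun j hj => ?_⟩
  · rw [← PowerSeries.coeff_zero_eq_constantCoeff_apply, remainder, Polynomial.coeff_coe,
      PowerSeries.coeff_trunc, if_pos (Nat.succ_pos _),
      PowerSeries.coeff_zero_eq_constantCoeff_apply, hy i]
  · rw [remainder, Polynomial.coeff_coe, PowerSeries.coeff_trunc, if_neg (by omega)]

/-- The quotients lie in `𝒜_∘` and have no constant term, so the coefficient of index exactly `expo
c i * d` vanishes as well. This matches the truncation at `expo c i * d + 1` in `remainder`. -/
theorem mem_tailModule_iff {v : Fin m → K⟦X⟧} : v ∈ tailModule Q c d ↔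
    ∀ i, v i ∈ Q.series Unit ∧ ∀ n ≤ expo c i * d, PowerSeries.coeff n (v i) = 0 := by
  refine forall_congr' fun i => ⟨?_, ?_⟩
  · rintro ⟨x, hx, hv⟩
    rw [hv]
    refine ⟨mul_mem (Q.X_pow_mem _) hx.1, fun n hn => ?_⟩
    rw [PowerSeries.coeff_X_pow_mul']
    split_ifs with h
    · rw [le_antisymm hn h, Nat.sub_self, PowerSeries.coeff_zero_eq_constantCoeff_apply, hx.2]
    · rfl
  · rintro ⟨hv, hn⟩
    obtain ⟨x, hx⟩ := PowerSeries.X_pow_dvd_iff.mpr fun n h => hn n (Nat.le_of_lt h)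
    refine ⟨x, ⟨Q.mem_of_X_pow_mul_mem (n := expo c i * d) (by rw [← hx]; exact hv), ?_⟩, hx⟩
    have := hn _ le_rfl
    rw [hx] at this
    simpa [PowerSeries.coeff_X_pow_mul'] using this

theorem sub_remainder_mem_tailModule {y : Fin m → K⟦X⟧} (hy : y ∈ arcs Q (Fin m)) :
    y - remainder c d y ∈ tailModule Q c d := by
  refine mem_tailModule_iff.mpr fun i => ⟨?_, fun n hn => ?_⟩
  · exact sub_mem (hy i).1 (Q.polynomial_mem _)
  · rw [Pi.sub_apply, map_sub, remainder, Polynomial.coeff_coe, PowerSeries.coeff_trunc,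
      if_pos (by omega), sub_self]

theorem remainder_add {z v : Fin m → K⟦X⟧} (hz : z ∈ polyVecs K c d)
    (hv : v ∈ tailModule Q c d) : remainder c d (z + v) = z := by
  funext i
  ext n
  rw [remainder, Polynomial.coeff_coe, PowerSeries.coeff_trunc, Pi.add_apply, map_add]
  split_ifs with h
  · rw [(mem_tailModule_iff.mp hv i).2 n (by omega), add_zero]
  · exact ((hz i).2 n (by omega)).symm

theorem neg_mem_tailModule {v : Fin m → K⟦X⟧} (hv : v ∈ tailModule Q c d) :
    -v ∈ tailModule Q c d := by
  rw [mem_tailModule_iff] at hv ⊢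
  refine fun i => ⟨neg_mem (hv i).1, fun n hn => ?_⟩
  rw [Pi.neg_apply, map_neg, (hv i).2 n hn, neg_zero]

theorem mem_moduleAt_iff {γ : Fin m → MvPowerSeries (Option (Fin m)) K} {z v : Fin m → K⟦X⟧} :
    v ∈ moduleAt Q γ z ↔ ∃ a ∈ arcs Q (Fin m), v = scale γ z a := by
  constructor
  · intro h
    choose a ha hv using h
    exact ⟨a, ha, funext hv⟩
  · rintro ⟨a, ha, rfl⟩ i
    exact ⟨a i, ha i, rfl⟩

theorem unscale_scale {γ : Fin m → MvPowerSeries (Option (Fin m)) K} {z : Fin m → K⟦X⟧}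
    (hγ : ∀ i, subst (γ i) z ≠ 0) (a : Fin m → K⟦X⟧) : unscale γ z (scale γ z a) = a :=
  funext fun i => quotient_mul (hγ i)

/-- The vector with components `b¹` in and `b²` outside of `c`. -/
def combine (c : Fin k ↪ Fin m) {A : Type*} (b₁ : Fin k → A) (b₂ : Rest c → A) (i : Fin m) : A :=
  haveI := Classical.dec (i ∈ Set.range c)
  if h : i ∈ Set.range c then b₁ h.choose else b₂ ⟨i, h⟩

theorem combine_apply {A : Type*} (b₁ : Fin k → A) (b₂ : Rest c → A) (l : Fin k) :
    combine c b₁ b₂ (c l) = b₁ l := by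
  have h : c l ∈ Set.range c := ⟨l, rfl⟩
  rw [combine, dif_pos h, c.injective h.choose_spec]

theorem combine_rest {A : Type*} (b₁ : Fin k → A) (b₂ : Rest c → A) (i : Rest c) :
    combine c b₁ b₂ i.1 = b₂ i := by
  rw [combine, dif_neg i.2]
  rfl

theorem combine_eta {A : Type*} (b : Fin m → A) :
    combine c (fun l => b (c l)) (fun i => b i.1) = b := by
  funext i
  by_cases h : i ∈ Set.range c
  · obtain ⟨l, rfl⟩ := h
    exact combine_apply _ _ l
  · exact combine_rest _ _ (⟨i, h⟩ : Rest c)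

theorem combine_mem_arcs {b₁ : Fin k → K⟦X⟧} {b₂ : Rest c → K⟦X⟧} (h₁ : b₁ ∈ arcs Q (Fin k))
    (h₂ : b₂ ∈ arcs Q (Rest c)) : combine c b₁ b₂ ∈ arcs Q (Fin m) := fun i => by
  by_cases h : i ∈ Set.range c
  · obtain ⟨l, rfl⟩ := h
    rw [combine_apply]
    exact h₁ l
  · have := combine_rest b₁ b₂ (⟨i, h⟩ : Rest c)
    rw [this]
    exact h₂ _

/-- The correction term `∂_{y¹}^* f(z) · ∂_{y²} f(z) · b²`. -/
def correction (F : Fin k → MvPowerSeries (Option (Fin m)) K) (c : Fin k ↪ Fin m)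
    (z : Fin m → K⟦X⟧) (b₂ : Rest c → K⟦X⟧) : Fin k → K⟦X⟧ :=
  (adjAt F c z).mulVec ((jacRestAt F c z).mulVec b₂)

/-- The linearized equations in terms of `b¹` and `b²`. -/
theorem evalVec_add_mulVec_scale_eq_zero_iff {z : Fin m → K⟦X⟧}
    (hz : ∀ i, PowerSeries.constantCoeff (z i) = 0) (hg : subst (minor F c) z ≠ 0)
    (b : Fin m → K⟦X⟧) :
    evalVec F z + (jacAt F z).mulVec (scale (gens F c) z b) = 0 ↔
      (adjAt F c z).mulVec (evalVec F z) + (subst (minor F c) z ^ 2) •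
        ((fun l => b (c l)) + correction F c z fun i => b i.1) = 0 := by
  obtain ⟨h1, h2, -⟩ := jacAt_submatrix_mul_adjAt F c hz
  set g := subst (minor F c) z with hgdef
  set J₁ := (jacAt F z).submatrix id c with hJ₁
  -- The exponents one and two of `g` are made for this splitting: the adjugate times the first
  -- block yields another `g`, so that both blocks end up with `g²`.
  have hJ : (jacAt F z).mulVec (scale (gens F c) z b) =
      g • J₁.mulVec (fun l => b (c l)) + g ^ 2 • (jacRestAt F c z).mulVec fun i => b i.1 := by
    funext j
    simp only [Matrix.mulVec, dotProduct, Pi.add_apply, Pi.smul_apply, smul_eq_mul,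
      sum_eq_sum_add_sum_rest c, Finset.mul_sum]
    congr 1
    · refine Finset.sum_congr rfl fun l _ => ?_
      rw [scale, subst_gens c hz, expo_apply, pow_one, hJ₁, Matrix.submatrix_apply]
      simp only [id]
      ring
    · refine Finset.sum_congr rfl fun i _ => ?_
      rw [scale, subst_gens c hz, expo_rest]
      change jacAt F z j i.1 * (g ^ 2 * b i.1) = g ^ 2 * (jacAt F z j i.1 * b i.1)
      ring
  have hadj : (adjAt F c z).mulVec (evalVec F z + (jacAt F z).mulVec (scale (gens F c) z b)) =
      (adjAt F c z).mulVec (evalVec F z) + (g ^ 2) •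
        ((fun l => b (c l)) + correction F c z fun i => b i.1) := by
    rw [hJ, Matrix.mulVec_add, Matrix.mulVec_add, Matrix.mulVec_smul, Matrix.mulVec_smul,
      Matrix.mulVec_mulVec, h2, Matrix.smul_mulVec, Matrix.one_mulVec, smul_smul, ← pow_two,
      smul_add]
    rfl
  rw [← hadj]
  constructor
  · intro h
    rw [h, Matrix.mulVec_zero]
  -- The adjugate can be cancelled, since the submatrix times its adjugate is `g(z)` times the
  -- identity and `g(z) ≠ 0`.
  · intro h
    have := congrArg J₁.mulVec h
    rw [Matrix.mulVec_mulVec, h1, Matrix.smul_mulVec, Matrix.one_mulVec, Matrix.mulVec_zero] at this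
    exact (smul_eq_zero.mp this).resolve_left hg

section

variable (hF : ∀ j, F j ∈ Q.series (Option (Fin m)))
include hF

/-- A value `g(z)` of order `d` is `t ^ d` times a unit of the same quality, and units may be moved
into the elements of `𝒜_∘`. -/
theorem tailModule_eq_moduleAt {z : Fin m → K⟦X⟧} (hz : z ∈ arcs Q (Fin m))
    (hd : (subst (minor F c) z).order = (d : ℕ∞)) :
    tailModule Q c d = moduleAt Q (gens F c) z := by
  obtain ⟨u, hu, u', hu', hgu, huu'⟩ := exists_eq_X_pow_mul
    (subst_mem_series hz (minor_mem hF c)) hd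
  have hpow : ∀ i, u ^ expo c i * u' ^ expo c i = 1 := fun i => by
    rw [← mul_pow, huu', one_pow]
  ext v
  refine forall_congr' fun i => ?_
  rw [subst_gens c fun i => (hz i).2, hgu, mul_pow, ← pow_mul, mul_comm d]
  constructor
  · rintro ⟨x, hx, hv⟩
    refine ⟨u' ^ expo c i * x, mul_mem_arcSeries (pow_mem hu' _) hx, ?_⟩
    rw [hv]
    linear_combination -(PowerSeries.X ^ (expo c i * d) * x) * hpow i
  · rintro ⟨x, hx, hv⟩
    exact ⟨u ^ expo c i * x, mul_mem_arcSeries (pow_mem hu _) hx, by rw [hv, mul_assoc]⟩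

theorem adjAt_mem_series {z : Fin m → K⟦X⟧} (hz : z ∈ arcs Q (Fin m)) (l j : Fin k) :
    adjAt F c z l j ∈ Q.series Unit := by
  rw [(jacAt_submatrix_mul_adjAt F c fun i => (hz i).2).2.2]
  exact subst_mem_series hz (adjugate_mem hF c l j)

theorem correction_mem_arcs {z : Fin m → K⟦X⟧} (hz : z ∈ arcs Q (Fin m)) {b₂ : Rest c → K⟦X⟧}
    (hb : b₂ ∈ arcs Q (Rest c)) : correction F c z b₂ ∈ arcs Q (Fin k) := fun l => by
  change ∑ j, adjAt F c z l j * ∑ i : Rest c, subst (jac F j i.1) z * b₂ i ∈ arcSeries Q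
  exact sum_mem_arcSeries _ fun j _ => mul_mem_arcSeries (adjAt_mem_series hF hz l j)
    (sum_mem_arcSeries _ fun i _ =>
      mul_mem_arcSeries (subst_mem_series hz (jac_mem hF j i.1)) (hb i))

theorem adjAt_mulVec_evalVec_mem {z : Fin m → K⟦X⟧} (hz : z ∈ arcs Q (Fin m)) (l : Fin k) :
    (adjAt F c z).mulVec (evalVec F z) l ∈ Q.series Unit := by
  change ∑ j, adjAt F c z l j * subst (F j) z ∈ Q.series Unit
  exact sum_mem fun j _ => mul_mem (adjAt_mem_series hF hz l j) (subst_mem_series hz (hF j))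

/-- Membership in `𝒵_d^*` in terms of the divisibility of `∂_{y¹}^* f(z) · f(z)`. -/
theorem mem_zStar_iff {z : Fin m → K⟦X⟧} : z ∈ zStar Q F c d ↔
    z ∈ polyVecs K c d ∧ (subst (minor F c) z).order = (d : ℕ∞) ∧
      ∀ l, ∀ n ≤ 2 * d, PowerSeries.coeff n ((adjAt F c z).mulVec (evalVec F z) l) = 0 := by
  refine and_congr_right fun hzp => and_congr_right fun hd => ?_
  have hz : z ∈ arcs Q (Fin m) := polyVecs_subset_arcs hzp
  have hz0 := fun i => (hz i).2
  have hg : subst (minor F c) z ≠ 0 := fun h => by simp [h] at hd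
  obtain ⟨u, hu, u', hu', hgu, huu'⟩ := exists_eq_X_pow_mul
    (subst_mem_series hz (minor_mem hF c)) hd
  rw [tailModule_eq_moduleAt hF hz hd]
  constructor
  · rintro ⟨v, hv, hfv⟩ l n hn
    obtain ⟨a, ha, rfl⟩ := mem_moduleAt_iff.mp hv
    have h1 : evalVec F z + (jacAt F z).mulVec (scale (gens F c) z (-a)) = 0 := by
      have : scale (gens F c) z (-a) = -scale (gens F c) z a := by
        funext i; simp [scale]
      rw [this, Matrix.mulVec_neg, hfv, add_neg_cancel]
    rw [evalVec_add_mulVec_scale_eq_zero_iff hz0 hg] at h1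
    have h2 := congrFun h1 l
    have hna : -a ∈ arcs Q (Fin m) := fun i => neg_mem_arcSeries (ha i)
    -- The bracket has no constant term, so its product with `g(z)²` vanishes up to and including
    -- degree `2 * d`.
    have h3 : ((fun l => (-a) (c l)) + correction F c z fun i => (-a) i.1) l ∈ arcSeries Q :=
      add_mem_arcSeries (hna (c l)) (correction_mem_arcs hF hz (fun i => hna i.1) l)
    rw [Pi.add_apply, Pi.smul_apply, smul_eq_mul, hgu, mul_pow, ← pow_mul, Pi.zero_apply,
      add_eq_zero_iff_eq_neg] at h2
    rw [h2, map_neg, mul_assoc, mul_comm d, PowerSeries.coeff_X_pow_mul']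
    split_ifs with h
    · rw [le_antisymm hn h, Nat.sub_self, PowerSeries.coeff_zero_eq_constantCoeff_apply, map_mul,
        h3.2, mul_zero, neg_zero]
    · exact neg_zero
  · intro h
    have hex : ∀ l, ∃ e ∈ arcSeries Q,
        (adjAt F c z).mulVec (evalVec F z) l + subst (minor F c) z ^ 2 * e = 0 := by
      intro l
      obtain ⟨x, hx⟩ := PowerSeries.X_pow_dvd_iff.mpr fun n hn => h l n (Nat.le_of_lt hn)
      have hxQ : x ∈ Q.series Unit := Q.mem_of_X_pow_mul_mem (n := 2 * d) (by
        rw [← hx]; exact adjAt_mulVec_evalVec_mem hF hz l)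
      have hx0 : PowerSeries.constantCoeff x = 0 := by
        have := h l _ le_rfl
        rw [hx] at this
        simpa [PowerSeries.coeff_X_pow_mul'] using this
      refine ⟨-(u' ^ 2) * x, mul_mem_arcSeries (neg_mem (pow_mem hu' 2)) ⟨hxQ, hx0⟩, ?_⟩
      have h1 : u ^ 2 * u' ^ 2 = 1 := by rw [← mul_pow, huu', one_pow]
      rw [hx, hgu, mul_pow, ← pow_mul, mul_comm d]
      linear_combination -(PowerSeries.X ^ (2 * d) * x) * h1
    choose e he hee using hex
    -- The choice `b² = 0` gives a solution: the adjugate equation is then satisfied by `b¹ = e`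
    -- alone.
    have hb : combine c e (0 : Rest c → K⟦X⟧) ∈ arcs Q (Fin m) :=
      combine_mem_arcs he fun _ => zero_mem_arcSeries
    have h1 : evalVec F z + (jacAt F z).mulVec
        (scale (gens F c) z (combine c e (0 : Rest c → K⟦X⟧))) = 0 := by
      rw [evalVec_add_mulVec_scale_eq_zero_iff hz0 hg]
      have h2 : (fun i : Rest c => combine c e (0 : Rest c → K⟦X⟧) i.1) = 0 :=
        funext fun i => combine_rest _ _ i
      have h3 : (fun l => combine c e (0 : Rest c → K⟦X⟧) (c l)) = e :=
        funext fun i => combine_apply _ _ i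
      rw [h2, h3]
      funext l
      simpa [correction] using hee l
    refine ⟨scale (gens F c) z (-combine c e (0 : Rest c → K⟦X⟧)), mem_moduleAt_iff.mpr
      ⟨_, fun i => neg_mem_arcSeries (hb i), rfl⟩, ?_⟩
    have h2 : scale (gens F c) z (-combine c e (0 : Rest c → K⟦X⟧)) =
        -scale (gens F c) z (combine c e (0 : Rest c → K⟦X⟧)) := by
      funext i; simp [scale]
    rw [h2, Matrix.mulVec_neg]
    exact add_eq_zero_iff_eq_neg.mp h1

end

end Strata

/-! ### The bijection between a stratum and its straightening -/

section Straighten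

variable {Q : Quality K} {k m : ℕ} {F : Fin k → MvPowerSeries (Option (Fin m)) K}
  {c : Fin k ↪ Fin m} {d : ℕ} {p : Fin m → MvPowerSeries (Option (Fin m ⊕ Fin m)) K}

/-- The arcs of order `d` in `g` on which `f` vanishes. -/
def zeroStratum (Q : Quality K) (F : Fin k → MvPowerSeries (Option (Fin m)) K) (c : Fin k ↪ Fin m)
    (d : ℕ∞) : Set (Fin m → K⟦X⟧) :=
  {y | y ∈ arcs Q (Fin m) ∧ evalVec F y = 0 ∧ (subst (minor F c) y).order = d}

/-- The series vanishing at a fixed arc form the kernel of a ring homomorphism, so testing the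
generators suffices. -/
theorem stratum_eq_zeroStratum (f : Fin k → Q.series (Option (Fin m))) (d : ℕ∞) :
    stratum Q (Ideal.span (Set.range f)) (minor (underlying f) c) d =
      zeroStratum Q (underlying f) c d := by
  ext y
  have : y ∈ variety Q (Ideal.span (Set.range f)) ↔
      y ∈ arcs Q (Fin m) ∧ evalVec (underlying f) y = 0 := by
    refine and_congr_right fun hy => ?_
    have hy0 := fun i => (hy i).2
    constructor
    · intro h
      funext j
      exact h (f j) (Ideal.subset_span ⟨j, rfl⟩)
    · intro h
      have hle : Ideal.span (Set.range f) ≤ RingHom.ker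
          ((evalHom hy0).comp (Q.series (Option (Fin m))).val) := by
        rw [Ideal.span_le]
        rintro _ ⟨j, rfl⟩
        change evalHom hy0 (f j : MvPowerSeries (Option (Fin m)) K) = 0
        rw [evalHom_apply]
        exact congrFun h j
      intro h' hh'
      rw [← evalHom_apply hy0]
      exact hle hh'
  change _ ∧ _ ↔ _
  rw [this, and_assoc]
  rfl

/-- The arc with straightening `(z, e, b²)`. -/
def assemble (F : Fin k → MvPowerSeries (Option (Fin m)) K) (c : Fin k ↪ Fin m)
    (p : Fin m → MvPowerSeries (Option (Fin m ⊕ Fin m)) K)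
    (w : (Fin m → K⟦X⟧) × (Fin k → K⟦X⟧) × (Rest c → K⟦X⟧)) : Fin m → K⟦X⟧ :=
  w.1 + scale (gens F c) w.1 (solve p w.1 (combine c (w.2.1 - correction F c w.1 w.2.2) w.2.2))

theorem gens_ne_zero {z : Fin m → K⟦X⟧} (hz : ∀ i, PowerSeries.constantCoeff (z i) = 0)
    (hg : subst (minor F c) z ≠ 0) (i : Fin m) : subst (gens F c i) z ≠ 0 := by
  rw [subst_gens c hz]
  exact pow_ne_zero _ hg

theorem straighten_eq {z a : Fin m → K⟦X⟧} (hz : ∀ i, PowerSeries.constantCoeff (z i) = 0)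
    (hg : subst (minor F c) z ≠ 0)
    (hr : remainder c d (z + scale (gens F c) z a) = z) :
    straighten F c p d (z + scale (gens F c) z a) =
      (z, (fun l => (a + evalPair p z a) (c l)) +
        correction F c z (fun i => (a + evalPair p z a) i.1),
        fun i => (a + evalPair p z a) i.1) := by
  have h := unscale_scale (gens_ne_zero hz hg)
  unfold straighten psi phi lam
  simp only [hr, add_sub_cancel_left, h]
  rfl

theorem evalVec_add_scale_eq_zero_iff (hp : IsTaylorRemainder Q F (gens F c) p)
    {z a : Fin m → K⟦X⟧} (hz : z ∈ arcs Q (Fin m)) (ha : a ∈ arcs Q (Fin m))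
    (hg : subst (minor F c) z ≠ 0) :
    evalVec F (z + scale (gens F c) z a) = 0 ↔
      (adjAt F c z).mulVec (evalVec F z) + (subst (minor F c) z ^ 2) •
        ((fun l => (a + evalPair p z a) (c l)) +
          correction F c z fun i => (a + evalPair p z a) i.1) = 0 := by
  rw [← evalVec_add_mulVec_scale_eq_zero_iff (fun i => (hz i).2) hg, hp.expansion z hz a ha,
    add_assoc, ← Matrix.mulVec_add]
  have : scale (gens F c) z a + scale (gens F c) z (evalPair p z a) =
      scale (gens F c) z (a + evalPair p z a) := by
    funext i
    simp only [scale, Pi.add_apply]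
    ring
  rw [this]

section

variable (hF : ∀ j, F j ∈ Q.series (Option (Fin m)))
include hF

/-- An arc of the stratum is `z + Δ(z) a` with `z ∈ 𝒵_d^*`. -/
theorem exists_eq_remainder_add (hp : IsTaylorRemainder Q F (gens F c) p) {y : Fin m → K⟦X⟧}
    (hy : y ∈ zeroStratum Q F c d) :
    remainder c d y ∈ zStar Q F c d ∧ ∃ a ∈ arcs Q (Fin m),
      y = remainder c d y + scale (gens F c) (remainder c d y) a := by
  obtain ⟨hya, hfy, hdy⟩ := hy
  have hzp : remainder c d y ∈ polyVecs K c d := remainder_mem_polyVecs fun i => (hya i).2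
  set z := remainder c d y with hzdef
  have hz : z ∈ arcs Q (Fin m) := polyVecs_subset_arcs hzp
  have hv : y - z ∈ tailModule Q c d := sub_remainder_mem_tailModule hya
  -- The order of `g` is known at `y` and not yet at `z`, so one first moves from `y` to `z` inside
  -- `𝒢(y) = 𝒱_d`; afterwards `𝒢(z) = 𝒱_d` is available too.
  have hnv := neg_mem_tailModule hv
  rw [tailModule_eq_moduleAt hF hya hdy] at hnv
  obtain ⟨u, -, hu1, hgu⟩ := exists_unit_subst_minor hF c hya hnv
  have hyz : y + -(y - z) = z := by abel
  rw [hyz] at hgu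
  have hdz : (subst (minor F c) z).order = (d : ℕ∞) := by
    rw [hgu, order_mul_unit hu1, hdy]
  have hvz := hv
  rw [tailModule_eq_moduleAt hF hz hdz] at hvz
  obtain ⟨a, ha, hva⟩ := mem_moduleAt_iff.mp hvz
  have hya' : y = z + scale (gens F c) z a := by rw [← hva]; abel
  -- With `f(y) = 0`, the Taylor formula expresses `f(z)` as `∂_y f(z)` applied to `-Δ(z) (a + p(z,
  -- a))`.
  refine ⟨⟨hzp, hdz, scale (gens F c) z (-(a + evalPair p z a)), ?_, ?_⟩, a, ha, hya'⟩
  · rw [tailModule_eq_moduleAt hF hz hdz]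
    exact mem_moduleAt_iff.mpr ⟨_, fun i => neg_mem_arcSeries
      (add_mem_arcSeries (ha i) (hp.evalPair_mem hz ha i)), rfl⟩
  · have h1 := hp.expansion z hz a ha
    rw [← hya', hfy, add_assoc, ← Matrix.mulVec_add] at h1
    have h2 : scale (gens F c) z (-(a + evalPair p z a)) =
        -(scale (gens F c) z a + scale (gens F c) z (evalPair p z a)) := by
      funext i
      simp only [scale, Pi.neg_apply, Pi.add_apply]
      ring
    rw [h2, Matrix.mulVec_neg]
    exact add_eq_zero_iff_eq_neg.mp h1.symm

/-- A displacement in `𝒢(z) = 𝒱_d` preserves the order of `g` and is invisible to the truncation. -/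
theorem add_scale_mem_zeroStratum {z a : Fin m → K⟦X⟧} (hz : z ∈ zStar Q F c d)
    (ha : a ∈ arcs Q (Fin m)) (h0 : evalVec F (z + scale (gens F c) z a) = 0) :
    z + scale (gens F c) z a ∈ zeroStratum Q F c d ∧
      remainder c d (z + scale (gens F c) z a) = z := by
  obtain ⟨hzp, hdz, -⟩ := hz
  have hza : z ∈ arcs Q (Fin m) := polyVecs_subset_arcs hzp
  have hv : scale (gens F c) z a ∈ moduleAt Q (gens F c) z := mem_moduleAt_iff.mpr ⟨a, ha, rfl⟩
  obtain ⟨u, -, hu1, hgu⟩ := exists_unit_subst_minor hF c hza hv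
  refine ⟨⟨fun i => add_mem_arcSeries (hza i) (moduleAt_subset_arcs hF c hza hv i), h0, ?_⟩, ?_⟩
  · rw [hgu, order_mul_unit hu1, hdz]
  · rw [← tailModule_eq_moduleAt hF hza hdz] at hv
    exact remainder_add hzp hv

theorem mapsTo_straighten (hp : IsTaylorRemainder Q F (gens F c) p) :
    Set.MapsTo (straighten F c p d) (zeroStratum Q F c d) (straightened Q F c d) ∧
      ∀ y ∈ zeroStratum Q F c d, assemble F c p (straighten F c p d y) = y ∧
        (straighten F c p d y).1 = remainder c d y := by
  rw [Set.MapsTo, ← forall₂_and]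
  intro y hy
  obtain ⟨hz, a, ha, hya⟩ := exists_eq_remainder_add hF hp hy
  obtain ⟨hzp, hdz, -⟩ := id hz
  have hr : remainder c d (remainder c d y + scale (gens F c) (remainder c d y) a) =
    remainder c d y := by rw [← hya]
  have hfy := hy.2.1
  -- From here on `z` and `a` are independent data and `y` is replaced by `z + Δ(z) a`.
  generalize remainder c d y = z at *
  subst hya
  have hza : z ∈ arcs Q (Fin m) := polyVecs_subset_arcs hzp
  have hg : subst (minor F c) z ≠ 0 := fun h => by simp [h] at hdz
  rw [evalVec_add_scale_eq_zero_iff hp hza ha hg] at hfy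
  have hb : a + evalPair p z a ∈ arcs Q (Fin m) :=
    fun i => add_mem_arcSeries (ha i) (hp.evalPair_mem hza ha i)
  rw [straighten_eq (fun i => (hza i).2) hg hr]
  refine ⟨⟨hz, ?_, fun i => hb i.1, hfy⟩, ?_, rfl⟩
  · exact fun l => add_mem_arcSeries (hb (c l)) (correction_mem_arcs hF hza (fun i => hb i.1) l)
  · simp only [assemble, add_sub_cancel_right, combine_eta (A := K⟦X⟧)]
    rw [hp.solve_apply hza ha]

theorem mapsTo_assemble (hp : IsTaylorRemainder Q F (gens F c) p) :
    Set.MapsTo (assemble F c p) (straightened Q F c d) (zeroStratum Q F c d) ∧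
      ∀ w ∈ straightened Q F c d, straighten F c p d (assemble F c p w) = w := by
  rw [Set.MapsTo, ← forall₂_and]
  rintro ⟨z, e, b₂⟩ ⟨hz, he, hb₂, heq⟩
  simp only at hz he hb₂ heq
  obtain ⟨hzp, hdz, -⟩ := id hz
  have hza : z ∈ arcs Q (Fin m) := polyVecs_subset_arcs hzp
  have hg : subst (minor F c) z ≠ 0 := fun h => by simp [h] at hdz
  have hb : combine c (e - correction F c z b₂) b₂ ∈ arcs Q (Fin m) :=
    combine_mem_arcs (fun l => sub_mem_arcSeries (he l) (correction_mem_arcs hF hza hb₂ l)) hb₂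
  have ha := hp.solve_mem hza hb
  have hab := hp.solve_add_evalPair hza hb
  have h2 : (fun i : Rest c => combine c (e - correction F c z b₂) b₂ i.1) = b₂ :=
    funext fun i => combine_rest _ _ i
  have h1 : (fun l => combine c (e - correction F c z b₂) b₂ (c l)) = e - correction F c z b₂ :=
    funext fun i => combine_apply _ _ i
  have h0 : evalVec F (z + scale (gens F c) z
      (solve p z (combine c (e - correction F c z b₂) b₂))) = 0 := by
    rw [evalVec_add_scale_eq_zero_iff hp hza ha hg, hab, h2, h1, sub_add_cancel]
    exact heq
  obtain ⟨hmem, hrem⟩ := add_scale_mem_zeroStratum hF hz ha h0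
  refine ⟨hmem, ?_⟩
  rw [assemble, straighten_eq (fun i => (hza i).2) hg hrem, hab, h2, h1, sub_add_cancel]

theorem bijOn_straighten (hp : IsTaylorRemainder Q F (gens F c) p) :
    Set.BijOn (straighten F c p d) (zeroStratum Q F c d) (straightened Q F c d) :=
  Set.InvOn.bijOn (f' := assemble F c p)
    ⟨fun y hy => ((mapsTo_straighten hF hp).2 y hy).1, (mapsTo_assemble hF hp).2⟩
    (mapsTo_straighten hF hp).1 (mapsTo_assemble hF hp).1

end

/-- The component `b¹` determined by `z`. -/
def determined (F : Fin k → MvPowerSeries (Option (Fin m)) K) (c : Fin k ↪ Fin m)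
    (z : Fin m → K⟦X⟧) : Fin k → K⟦X⟧ :=
  fun l => quotient (-(adjAt F c z).mulVec (evalVec F z) l) (subst (minor F c) z ^ 2)

/-- The inverse of `Φ_d`. -/
def factorInv (F : Fin k → MvPowerSeries (Option (Fin m)) K) (c : Fin k ↪ Fin m)
    (p : Fin m → MvPowerSeries (Option (Fin m ⊕ Fin m)) K) (w : Fin m ⊕ Rest c → K⟦X⟧) :
    Fin m → K⟦X⟧ :=
  assemble F c p (fun i => w (Sum.inl i), determined F c (fun i => w (Sum.inl i)),
    fun i => w (Sum.inr i))

theorem determined_eq {z : Fin m → K⟦X⟧} (hg : subst (minor F c) z ≠ 0) {e : Fin k → K⟦X⟧}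
    (h : (adjAt F c z).mulVec (evalVec F z) + (subst (minor F c) z ^ 2) • e = 0) :
    determined F c z = e := by
  funext l
  have hl := congrFun h l
  rw [Pi.add_apply, Pi.smul_apply, smul_eq_mul, Pi.zero_apply] at hl
  rw [determined, show -(adjAt F c z).mulVec (evalVec F z) l = subst (minor F c) z ^ 2 * e l by
    linear_combination -hl]
  exact quotient_mul (pow_ne_zero 2 hg)

theorem minor_ne_zero_of_mem_zStar {z : Fin m → K⟦X⟧} (hz : z ∈ zStar Q F c d) :
    subst (minor F c) z ≠ 0 := fun h => by simpa [h] using hz.2.1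

/-- Every point of `𝒵_d^* × 𝒜_∘ ^ (m - k)` extends uniquely to the straightening. -/
theorem mem_straightened_of_mem_prodArcs (hF : ∀ j, F j ∈ Q.series (Option (Fin m)))
    {w : Fin m ⊕ Rest c → K⟦X⟧} (hw : w ∈ prodArcs Q (zStar Q F c d) (Rest c)) :
    ((fun i => w (Sum.inl i), determined F c (fun i => w (Sum.inl i)),
      fun i => w (Sum.inr i)) : (Fin m → K⟦X⟧) × (Fin k → K⟦X⟧) × (Rest c → K⟦X⟧)) ∈
        straightened Q F c d := by
  obtain ⟨hz, hb⟩ := hw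
  generalize (fun i => w (Sum.inl i)) = z at *
  have hg := minor_ne_zero_of_mem_zStar hz
  have hza : z ∈ arcs Q (Fin m) := polyVecs_subset_arcs hz.1
  obtain ⟨v, hv, hfv⟩ := hz.2.2
  rw [tailModule_eq_moduleAt hF hza hz.2.1] at hv
  obtain ⟨a, ha, rfl⟩ := mem_moduleAt_iff.mp hv
  have hna : -a ∈ arcs Q (Fin m) := fun i => neg_mem_arcSeries (ha i)
  -- A preimage of `f(z)` under `∂_y f(z)` provides, up to sign, one solution of the linearized
  -- equation; its bracket is the determined component.
  have h1 : evalVec F z + (jacAt F z).mulVec (scale (gens F c) z (-a)) = 0 := by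
    have : scale (gens F c) z (-a) = -scale (gens F c) z a := by
      funext i; simp [scale]
    rw [this, Matrix.mulVec_neg, hfv, add_neg_cancel]
  rw [evalVec_add_mulVec_scale_eq_zero_iff (fun i => (hza i).2) hg] at h1
  rw [determined_eq hg h1]
  exact ⟨hz, fun l => add_mem_arcSeries (hna (c l))
    (correction_mem_arcs hF hza (fun i => hna i.1) l), hb, h1⟩

theorem invOn_factorInv (hF : ∀ j, F j ∈ Q.series (Option (Fin m)))
    (hp : IsTaylorRemainder Q F (gens F c) p) :
    Set.MapsTo (factorMap F c p d) (zeroStratum Q F c d) (prodArcs Q (zStar Q F c d) (Rest c)) ∧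
    Set.MapsTo (factorInv F c p) (prodArcs Q (zStar Q F c d) (Rest c)) (zeroStratum Q F c d) ∧
    Set.InvOn (factorInv F c p) (factorMap F c p d) (zeroStratum Q F c d)
      (prodArcs Q (zStar Q F c d) (Rest c)) := by
  have hm := mapsTo_straighten (d := d) hF hp
  have hm' := mapsTo_assemble (d := d) hF hp
  refine ⟨fun y hy => ?_, fun w hw => ?_, fun y hy => ?_, fun w hw => ?_⟩
  · have := hm.1 hy
    exact ⟨this.1, this.2.2.1⟩
  · exact hm'.1 (mem_straightened_of_mem_prodArcs hF hw)
  · have hs := hm.1 hy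
    have h1 := determined_eq (minor_ne_zero_of_mem_zStar hs.1) hs.2.2.2
    have h2 := (hm.2 y hy).1
    conv_rhs => rw [← h2]
    unfold factorInv factorMap
    simp only [Sum.elim_inl, Sum.elim_inr]
    rw [show (fun i => (straighten F c p d y).1 i) = (straighten F c p d y).1 from rfl, h1]
  · have h := hm'.2 _ (mem_straightened_of_mem_prodArcs hF hw)
    unfold factorMap factorInv
    rw [h]
    funext i
    rcases i with i | i <;> rfl

end Straighten

/-! ### Algebras of functions, and families of series with coefficients in them -/

section FunctionAlgebras

variable {τ Y : Type*}

/-- The polynomial functions of the coordinates `e : Y → K ^ τ`. -/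
def polyFunctions (e : Y → τ → K) : Subalgebra K (Y → K) :=
  (MvPolynomial.aeval fun q y => e y q : MvPolynomial τ K →ₐ[K] (Y → K)).range

theorem mem_polyFunctions {e : Y → τ → K} {φ : Y → K} :
    φ ∈ polyFunctions e ↔ ∃ P : MvPolynomial τ K, ∀ y, φ y = MvPolynomial.eval (e y) P := by
  have key : ∀ (P : MvPolynomial τ K) (y : Y),
      (MvPolynomial.aeval fun q y => e y q : MvPolynomial τ K →ₐ[K] (Y → K)) P y =
        MvPolynomial.eval (e y) P := by
    intro P y
    induction P using MvPolynomial.induction_on with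
    | C a => simp
    | add p q hp hq => simp [hp, hq]
    | mul_X p q hp => simp [hp]
  constructor
  · rintro ⟨P, rfl⟩
    exact ⟨P, key P⟩
  · rintro ⟨P, hP⟩
    exact ⟨P, funext fun y => (key P y).trans (hP y).symm⟩

theorem coordinate_mem_polyFunctions (e : Y → τ → K) (q : τ) :
    (fun y => e y q) ∈ polyFunctions e :=
  mem_polyFunctions.mpr ⟨MvPolynomial.X q, fun y => by simp⟩

/-- The everywhere defined rational functions of the coordinates `e : Y → K ^ τ`. -/
def ratFunctions (e : Y → τ → K) : Subalgebra K (Y → K) where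
  carrier := {φ | ∃ N D : MvPolynomial τ K, ∀ y, MvPolynomial.eval (e y) D ≠ 0 ∧
    φ y = MvPolynomial.eval (e y) N / MvPolynomial.eval (e y) D}
  mul_mem' := by
    rintro φ ψ ⟨N, D, h⟩ ⟨N', D', h'⟩
    refine ⟨N * N', D * D', fun y => ⟨?_, ?_⟩⟩
    · rw [map_mul]
      exact mul_ne_zero (h y).1 (h' y).1
    · rw [Pi.mul_apply, (h y).2, (h' y).2, map_mul, map_mul, div_mul_div_comm]
  add_mem' := by
    rintro φ ψ ⟨N, D, h⟩ ⟨N', D', h'⟩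
    refine ⟨N * D' + D * N', D * D', fun y => ⟨?_, ?_⟩⟩
    · rw [map_mul]
      exact mul_ne_zero (h y).1 (h' y).1
    · rw [Pi.add_apply, (h y).2, (h' y).2, div_add_div _ _ (h y).1 (h' y).1]
      simp only [map_mul, map_add]
  algebraMap_mem' a := ⟨MvPolynomial.C a, 1, fun y => by simp⟩

theorem coordinate_mem_ratFunctions (e : Y → τ → K) (q : τ) :
    (fun y => e y q) ∈ ratFunctions e :=
  ⟨MvPolynomial.X q, 1, fun y => by simp⟩

theorem inv_mem_ratFunctions {e : Y → τ → K} {φ : Y → K} (hφ : φ ∈ ratFunctions e)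
    (h0 : ∀ y, φ y ≠ 0) : φ⁻¹ ∈ ratFunctions e := by
  obtain ⟨N, D, h⟩ := hφ
  refine ⟨D, N, fun y => ⟨fun hN => h0 y ?_, ?_⟩⟩
  · rw [(h y).2, hN, zero_div]
  · rw [Pi.inv_apply, (h y).2, inv_div]

/-- The families of series all of whose coefficients lie in `𝒜`. -/
def seriesOver (𝒜 : Subalgebra K (Y → K)) : Subalgebra K (Y → K⟦X⟧) where
  carrier := {φ | ∀ n, (fun y => PowerSeries.coeff n (φ y)) ∈ 𝒜}
  mul_mem' := by
    intro φ ψ hφ hψ n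
    have : (fun y => PowerSeries.coeff n ((φ * ψ) y)) =
        ∑ q ∈ Finset.HasAntidiagonal.antidiagonal n, (fun y => PowerSeries.coeff q.1 (φ y)) *
          fun y => PowerSeries.coeff q.2 (ψ y) := by
      funext y
      simp [PowerSeries.coeff_mul]
    rw [this]
    exact sum_mem fun q _ => mul_mem (hφ q.1) (hψ q.2)
  add_mem' := by
    intro φ ψ hφ hψ n
    have : (fun y => PowerSeries.coeff n ((φ + ψ) y)) =
        (fun y => PowerSeries.coeff n (φ y)) + fun y => PowerSeries.coeff n (ψ y) := by
      funext y
      simp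
    rw [this]
    exact add_mem (hφ n) (hψ n)
  algebraMap_mem' a n := 𝒜.algebraMap_mem
    (PowerSeries.coeff n (algebraMap K K⟦X⟧ a))

variable {𝒜 : Subalgebra K (Y → K)}

theorem const_mem_seriesOver (x : K⟦X⟧) : (fun _ => x) ∈ seriesOver 𝒜 :=
  fun n => 𝒜.algebraMap_mem (PowerSeries.coeff n x)

theorem trunc_mem_seriesOver {φ : Y → K⟦X⟧} (hφ : φ ∈ seriesOver 𝒜) (r : ℕ) :
    (fun y => (PowerSeries.trunc r (φ y) : K⟦X⟧)) ∈ seriesOver 𝒜 := by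
  intro n
  simp only [Polynomial.coeff_coe, PowerSeries.coeff_trunc]
  split_ifs with h
  · exact hφ n
  · exact zero_mem 𝒜

theorem sum_mul_mem_seriesOver {κ : Type*} (s : Finset κ) {φ ψ : κ → Y → K⟦X⟧}
    (hφ : ∀ i, φ i ∈ seriesOver 𝒜) (hψ : ∀ i, ψ i ∈ seriesOver 𝒜) :
    (fun y => ∑ i ∈ s, φ i y * ψ i y) ∈ seriesOver 𝒜 := by
  have : (fun y => ∑ i ∈ s, φ i y * ψ i y) = ∑ i ∈ s, φ i * ψ i := by
    funext y
    simp
  rw [this]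
  exact sum_mem fun i _ => mul_mem (hφ i) (hψ i)

theorem X_pow_degree_dvd {ι : Type*} (α : ι →₀ ℕ) {x : ι → K⟦X⟧}
    (hx : ∀ i, PowerSeries.constantCoeff (x i) = 0) :
    (PowerSeries.X : K⟦X⟧) ^ α.degree ∣ α.prod fun i n => x i ^ n := by
  rw [Finsupp.degree_apply, Finsupp.prod, ← Finset.prod_pow_eq_pow_sum]
  exact Finset.prod_dvd_prod_of_dvd _ _ fun i _ =>
    pow_dvd_pow_of_dvd (PowerSeries.X_dvd_iff.mpr (hx i)) _

/-- Every substituted series is divisible by `t`, so monomials of degree above `n` do not contribute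
to the coefficient of `t ^ n`. -/
theorem coeff_subst_eq_sum {ι : Type*} [Fintype ι] {y : ι → K⟦X⟧}
    (hy : ∀ i, PowerSeries.constantCoeff (y i) = 0) (f : MvPowerSeries (Option ι) K) (n : ℕ) :
    PowerSeries.coeff n (subst f y) =
      ∑ α ∈ (Finsupp.finite_of_degree_le (σ := Option ι) n).toFinset, MvPowerSeries.coeff α f *
        PowerSeries.coeff n (α.prod fun o r => (o.elim PowerSeries.X y : K⟦X⟧) ^ r) := by
  have h := MvPowerSeries.coeff_subst (hasSubst_elim hy) f (Finsupp.single () n)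
  refine h.trans (finsum_eq_sum_of_support_subset _ fun α hα => ?_)
  by_contra hn
  rw [Set.Finite.coe_toFinset, Set.mem_ofPred_eq, not_le] at hn
  refine hα ?_
  have hd := X_pow_degree_dvd α (x := fun o : Option ι => (o.elim PowerSeries.X y : K⟦X⟧))
    (constantCoeff_elim hy)
  have := PowerSeries.X_pow_dvd_iff.mp hd n hn
  change MvPowerSeries.coeff α f • PowerSeries.coeff n (α.prod _) = 0
  rw [this, smul_zero]

/-- Each coefficient of the result is a finite sum of products of coefficients, with fixed scalars
from `f`; hence evaluation of a fixed series is polynomial in the arc. -/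
theorem subst_mem_seriesOver {ι : Type*} [Fintype ι] {ψ : ι → Y → K⟦X⟧}
    (hψ : ∀ i, ψ i ∈ seriesOver 𝒜) (h0 : ∀ i y, PowerSeries.constantCoeff (ψ i y) = 0)
    (f : MvPowerSeries (Option ι) K) : (fun y => subst f fun i => ψ i y) ∈ seriesOver 𝒜 := by
  intro n
  have hprod : ∀ α : Option ι →₀ ℕ, (fun y => α.prod fun o r =>
      (o.elim PowerSeries.X fun i => ψ i y : K⟦X⟧) ^ r) ∈ seriesOver 𝒜 := by
    intro α
    have : (fun y => α.prod fun o r => (o.elim PowerSeries.X fun i => ψ i y : K⟦X⟧) ^ r) =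
        α.prod fun o r => (o.elim (fun _ => PowerSeries.X) ψ : Y → K⟦X⟧) ^ r := by
      funext y
      rw [Finsupp.prod, Finsupp.prod, Finset.prod_apply]
      refine Finset.prod_congr rfl fun o _ => ?_
      cases o <;> rfl
    rw [this]
    refine prod_mem fun o _ => pow_mem ?_ _
    cases o with
    | none => exact const_mem_seriesOver _
    | some i => exact hψ i
  have : (fun y => PowerSeries.coeff n (subst f fun i => ψ i y)) =
      ∑ α ∈ (Finsupp.finite_of_degree_le (σ := Option ι) n).toFinset, MvPowerSeries.coeff α f •
        fun y => PowerSeries.coeff n (α.prod fun o r =>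
          (o.elim PowerSeries.X fun i => ψ i y : K⟦X⟧) ^ r) := by
    funext y
    rw [coeff_subst_eq_sum fun i => h0 i y]
    simp
  rw [this]
  exact sum_mem fun α _ => 𝒜.smul_mem (hprod α n) _

/-- Long division with a divisor of constant order `D` inverts only its coefficient of index `D`,
which vanishes nowhere. The quotient is computed recursively from lower coefficients. -/
theorem quotient_mem_seriesOver (hinv : ∀ φ ∈ 𝒜, (∀ y, φ y ≠ 0) → φ⁻¹ ∈ 𝒜) {φ h : Y → K⟦X⟧}
    (hφ : φ ∈ seriesOver 𝒜) (hh : h ∈ seriesOver 𝒜) {D : ℕ}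
    (hD : ∀ y, (h y).order = (D : ℕ∞)) (hdvd : ∀ y, h y ∣ φ y) :
    (fun y => quotient (φ y) (h y)) ∈ seriesOver 𝒜 := by
  intro n
  induction n using Nat.strong_induction_on with
  | _ n ih =>
  have hne : ∀ y, PowerSeries.coeff D (h y) ≠ 0 := fun y =>
    (PowerSeries.order_eq_nat.mp (hD y)).1
  have hlt : ∀ y, ∀ j < D, PowerSeries.coeff j (h y) = 0 := fun y =>
    (PowerSeries.order_eq_nat.mp (hD y)).2
  have : (fun y => PowerSeries.coeff n (quotient (φ y) (h y))) =
      ((fun y => PowerSeries.coeff (n + D) (φ y)) - ∑ i ∈ Finset.range n,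
        (fun y => PowerSeries.coeff i (quotient (φ y) (h y))) *
          fun y => PowerSeries.coeff (n + D - i) (h y)) *
        (fun y => PowerSeries.coeff D (h y))⁻¹ := by
    funext y
    obtain ⟨x, hx⟩ := hdvd y
    have hy0 : h y ≠ 0 := fun h0 => hne y (by rw [h0, map_zero])
    have hq : quotient (φ y) (h y) = x := by rw [hx, quotient_mul hy0]
    -- In the convolution of degree `n + D`, coefficients of the quotient of index above `n` meet
    -- coefficients of `h y` of index below `D`.
    have htail : ∑ j ∈ Finset.range D, PowerSeries.coeff (n + 1 + j) x *
        PowerSeries.coeff (n + D - (n + 1 + j)) (h y) = 0 := by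
      refine Finset.sum_eq_zero fun j hj => ?_
      rw [Finset.mem_range] at hj
      rw [hlt y _ (by omega), mul_zero]
    simp only [Pi.mul_apply, Pi.sub_apply, Finset.sum_apply, Pi.inv_apply, hq]
    rw [eq_mul_inv_iff_mul_eq₀ (hne y), eq_sub_iff_add_eq, hx, mul_comm (h y) x,
      PowerSeries.coeff_mul, Finset.Nat.sum_antidiagonal_eq_sum_range_succ
        (fun i j => PowerSeries.coeff i x * PowerSeries.coeff j (h y)), Nat.succ_eq_add_one,
      add_right_comm n D 1, Finset.sum_range_add, Finset.sum_range_succ, Nat.add_sub_cancel_left,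
      htail]
    ring
  rw [this]
  refine mul_mem (sub_mem (hφ _) (sum_mem fun i hi => mul_mem (ih i (Finset.mem_range.mp hi))
    (hh _))) (hinv _ (hh D) hne)

end FunctionAlgebras

/-! ### Textile maps -/

section Textile

variable {ι κ : Type*}

theorem coeffs_mem_seriesOver_polyFunctions {Y : Type*} (y : Y → ι → K⟦X⟧) (i : ι) :
    (fun u => y u i) ∈ seriesOver (polyFunctions fun u => coeffs (y u)) :=
  fun n => coordinate_mem_polyFunctions (fun u => coeffs (y u)) (i, n)

theorem rationallyTextileOn_of_mem {F : (ι → K⟦X⟧) → (κ → K⟦X⟧)} {U : Set (ι → K⟦X⟧)}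
    (h : ∀ j, (fun y : U => F y j) ∈ seriesOver (ratFunctions fun y : U => coeffs y.1)) :
    RationallyTextileOn F U := by
  intro q
  obtain ⟨N, D, hND⟩ := h q.1 q.2
  exact ⟨N, D, fun y hy => hND ⟨y, hy⟩⟩

theorem coeffs_mem_seriesOver_ratFunctions (U : Set (ι → K⟦X⟧)) (i : ι) :
    (fun y : U => y.1 i) ∈ seriesOver (ratFunctions fun y : U => coeffs y.1) :=
  fun n => coordinate_mem_ratFunctions (fun y : U => coeffs y.1) (i, n)

/-- A polynomial involves finitely many coefficients, so it is locally constant for the `t`-adic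
topology, uniformly in the arc. -/
theorem exists_eval_coeffs_eq (P : MvPolynomial (ι × ℕ) K) :
    ∃ r : ℕ, ∀ y y' : ι → K⟦X⟧, (∀ i, (PowerSeries.X : K⟦X⟧) ^ r ∣ y' i - y i) →
      MvPolynomial.eval (coeffs y') P = MvPolynomial.eval (coeffs y) P := by
  have weaken : ∀ {r s : ℕ} {x : K⟦X⟧}, r ≤ s → PowerSeries.X ^ s ∣ x → PowerSeries.X ^ r ∣ x :=
    fun h => (pow_dvd_pow _ h).trans
  induction P using MvPolynomial.induction_on with
  | C a => exact ⟨0, fun y y' _ => by simp⟩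
  | add p q hp hq =>
    obtain ⟨r, hr⟩ := hp
    obtain ⟨s, hs⟩ := hq
    refine ⟨max r s, fun y y' h => ?_⟩
    rw [map_add, map_add, hr y y' fun i => weaken (le_max_left _ _) (h i),
      hs y y' fun i => weaken (le_max_right _ _) (h i)]
  | mul_X p q hp =>
    obtain ⟨r, hr⟩ := hp
    refine ⟨max r (q.2 + 1), fun y y' h => ?_⟩
    rw [map_mul, map_mul, hr y y' fun i => weaken (le_max_left _ _) (h i), MvPolynomial.eval_X,
      MvPolynomial.eval_X]
    have := PowerSeries.X_pow_dvd_iff.mp (weaken (le_max_right r _) (h q.1)) q.2 (Nat.lt_succ_self _)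
    rw [map_sub, sub_eq_zero] at this
    rw [coeffs, coeffs, this]

/-- Rationally textile maps to finitely many components are continuous. -/
theorem RationallyTextileOn.tAdicContinuousOn [Finite κ] {F : (ι → K⟦X⟧) → (κ → K⟦X⟧)}
    {U : Set (ι → K⟦X⟧)} (hF : RationallyTextileOn F U) : TAdicContinuousOn F U := by
  have hex : ∀ q : κ × ℕ, ∃ r : ℕ, ∀ y ∈ U, ∀ y' ∈ U,
      (∀ i, (PowerSeries.X : K⟦X⟧) ^ r ∣ y' i - y i) → coeffs (F y') q = coeffs (F y) q := by
    intro q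
    obtain ⟨N, D, h⟩ := hF q
    obtain ⟨r, hr⟩ := exists_eval_coeffs_eq N
    obtain ⟨s, hs⟩ := exists_eval_coeffs_eq D
    refine ⟨max r s, fun y hy y' hy' hd => ?_⟩
    rw [(h y hy).2, (h y' hy').2,
      hr y y' fun i => (pow_dvd_pow _ (le_max_left _ _)).trans (hd i),
      hs y y' fun i => (pow_dvd_pow _ (le_max_right _ _)).trans (hd i)]
  choose r hr using hex
  have := Fintype.ofFinite κ
  intro y hy n
  -- The sum merely serves as a common upper bound for the finitely many precisions needed.
  refine ⟨∑ j : κ, ∑ l ∈ Finset.range n, r (j, l), fun y' hy' hd j => ?_⟩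
  refine PowerSeries.X_pow_dvd_iff.mpr fun l hl => ?_
  rw [map_sub, sub_eq_zero]
  refine hr (j, l) y hy y' hy' fun i => (pow_dvd_pow _ ?_).trans (hd i)
  exact (Finset.single_le_sum (f := fun l => r (j, l)) (fun _ _ => Nat.zero_le _)
    (Finset.mem_range.mpr hl)).trans (Finset.single_le_sum
      (f := fun j => ∑ l ∈ Finset.range n, r (j, l)) (fun _ _ => Nat.zero_le _)
      (Finset.mem_univ j))

end Textile

/-! ### Families of arcs with coefficients in an algebra of functions -/

section ArcFamilies

variable {Y : Type*} {𝒜 : Subalgebra K (Y → K)} {k m : ℕ}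
  {F : Fin k → MvPowerSeries (Option (Fin m)) K} {c : Fin k ↪ Fin m} {z : Y → Fin m → K⟦X⟧}

section

variable (hz : ∀ i, (fun u => z u i) ∈ seriesOver 𝒜)
  (hz0 : ∀ u i, PowerSeries.constantCoeff (z u i) = 0)
include hz hz0

theorem subst_arc_mem_seriesOver (f : MvPowerSeries (Option (Fin m)) K) :
    (fun u => subst f (z u)) ∈ seriesOver 𝒜 :=
  subst_mem_seriesOver hz (fun i u => hz0 u i) f

theorem adjAt_mem_seriesOver (l j : Fin k) : (fun u => adjAt F c (z u) l j) ∈ seriesOver 𝒜 := by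
  simp only [fun u => (jacAt_submatrix_mul_adjAt F c (hz0 u)).2.2]
  exact subst_arc_mem_seriesOver hz hz0 _

theorem adjAt_mulVec_evalVec_mem_seriesOver (l : Fin k) :
    (fun u => (adjAt F c (z u)).mulVec (evalVec F (z u)) l) ∈ seriesOver 𝒜 :=
  sum_mul_mem_seriesOver Finset.univ (fun j => adjAt_mem_seriesOver hz hz0 l j)
    fun j => subst_arc_mem_seriesOver hz hz0 (F j)

theorem correction_mem_seriesOver {b₂ : Y → Rest c → K⟦X⟧}
    (hb : ∀ i, (fun u => b₂ u i) ∈ seriesOver 𝒜) (l : Fin k) :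
    (fun u => correction F c (z u) (b₂ u) l) ∈ seriesOver 𝒜 :=
  sum_mul_mem_seriesOver Finset.univ (fun j => adjAt_mem_seriesOver hz hz0 l j)
    fun j => sum_mul_mem_seriesOver Finset.univ
      (fun i : Rest c => subst_arc_mem_seriesOver hz hz0 (jac F j i.1)) hb

theorem subst_sumElim_mem_seriesOver {a : Y → Fin m → K⟦X⟧}
    (ha : ∀ i, (fun u => a u i) ∈ seriesOver 𝒜)
    (ha0 : ∀ u i, PowerSeries.constantCoeff (a u i) = 0)
    (f : MvPowerSeries (Option (Fin m ⊕ Fin m)) K) :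
    (fun u => subst f (Sum.elim (z u) (a u))) ∈ seriesOver 𝒜 :=
  subst_mem_seriesOver (ψ := fun s u => Sum.elim (z u) (a u) s)
    (by rintro (i | i); exacts [hz i, ha i]) (by rintro (i | i) u; exacts [hz0 u i, ha0 u i]) f

theorem scale_mem_seriesOver {a : Y → Fin m → K⟦X⟧} (ha : ∀ i, (fun u => a u i) ∈ seriesOver 𝒜)
    (γ : Fin m → MvPowerSeries (Option (Fin m)) K) (i : Fin m) :
    (fun u => scale γ (z u) (a u) i) ∈ seriesOver 𝒜 :=
  mul_mem (subst_arc_mem_seriesOver hz hz0 (γ i)) (ha i)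

end

theorem combine_mem_seriesOver {b₁ : Y → Fin k → K⟦X⟧} {b₂ : Y → Rest c → K⟦X⟧}
    (h₁ : ∀ l, (fun u => b₁ u l) ∈ seriesOver 𝒜) (h₂ : ∀ i, (fun u => b₂ u i) ∈ seriesOver 𝒜)
    (i : Fin m) : (fun u => combine c (b₁ u) (b₂ u) i) ∈ seriesOver 𝒜 := by
  by_cases h : i ∈ Set.range c
  · obtain ⟨l, rfl⟩ := h
    simp only [combine_apply]
    exact h₁ l
  · have := fun u => combine_rest (b₁ u) (b₂ u) (⟨i, h⟩ : Rest c)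
    simp only at this
    simp only [this]
    exact h₂ _

theorem order_subst_gens (hz0 : ∀ u i, PowerSeries.constantCoeff (z u i) = 0) {d : ℕ}
    (hd : ∀ u, (subst (minor F c) (z u)).order = (d : ℕ∞)) (i : Fin m) (u : Y) :
    (subst (gens F c i) (z u)).order = ((expo c i * d : ℕ) : ℕ∞) := by
  rw [subst_gens c (hz0 u), PowerSeries.order_pow, hd u]
  simp

end ArcFamilies

/-! ### Rational textility of `Φ_d` and its inverse -/

section Factorization

variable {Q : Quality K} {k m : ℕ} {F : Fin k → MvPowerSeries (Option (Fin m)) K}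
  {c : Fin k ↪ Fin m} {d : ℕ} {p : Fin m → MvPowerSeries (Option (Fin m ⊕ Fin m)) K}

/-- The truncation `z` is linear in `y`, and `a` is the quotient of `y - z` by powers of `g(z)`,
whose order is constant on the stratum. Evaluating the fixed series `p` introduces no further
denominators. -/
theorem rationallyTextileOn_factorMap (hF : ∀ j, F j ∈ Q.series (Option (Fin m)))
    (hp : IsTaylorRemainder Q F (gens F c) p) :
    RationallyTextileOn (factorMap F c p d) (zeroStratum Q F c d) := by
  set U := zeroStratum Q F c d
  have hst : ∀ u : U, ∃ a ∈ arcs Q (Fin m), remainder c d u.1 ∈ zStar Q F c d ∧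
      u.1 = remainder c d u.1 + scale (gens F c) (remainder c d u.1) a := fun u => by
    obtain ⟨hz, a, ha, h⟩ := exists_eq_remainder_add hF hp u.2
    exact ⟨a, ha, hz, h⟩
  choose a ha hz hu using hst
  set z : U → Fin m → K⟦X⟧ := fun u => remainder c d u.1 with hzdef
  have hz0 : ∀ u i, PowerSeries.constantCoeff (z u i) = 0 := fun u i => ((hz u).1 i).1
  have hzs : ∀ i, (fun u => z u i) ∈ seriesOver (ratFunctions fun u : U => coeffs u.1) :=
    fun i => trunc_mem_seriesOver (coeffs_mem_seriesOver_ratFunctions U i) _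
  have hg : ∀ u, subst (minor F c) (z u) ≠ 0 := fun u => minor_ne_zero_of_mem_zStar (hz u)
  have has : ∀ i, (fun u => a u i) ∈ seriesOver (ratFunctions fun u : U => coeffs u.1) := by
    intro i
    have hmul : ∀ u : U, u.1 i - z u i = subst (gens F c i) (z u) * a u i := fun u => by
      have := congrFun (hu u) i
      rw [Pi.add_apply] at this
      exact sub_eq_of_eq_add' this
    have hq : (fun u => a u i) =
        fun u => quotient (u.1 i - z u i) (subst (gens F c i) (z u)) := by
      funext u
      rw [hmul, quotient_mul (gens_ne_zero (hz0 u) (hg u) i)]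
    rw [hq]
    exact quotient_mem_seriesOver (fun φ hφ => inv_mem_ratFunctions hφ)
      (sub_mem (coeffs_mem_seriesOver_ratFunctions U i) (hzs i))
      (subst_arc_mem_seriesOver hzs hz0 _)
      (order_subst_gens hz0 (fun u => (hz u).2.1) i) fun u => Dvd.intro _ (hmul u).symm
  have hs : ∀ u : U, factorMap F c p d u.1 =
      Sum.elim (z u) fun i => (a u + evalPair p (z u) (a u)) i.1 := fun u => by
    have h := straighten_eq (p := p) (hz0 u) (hg u) (a := a u) (d := d) (by rw [← hu u])
    rw [← hu u] at h
    rw [factorMap, h]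
  refine rationallyTextileOn_of_mem ?_
  rintro (i | i)
  · simp only [hs]
    exact hzs i
  · simp only [hs]
    exact add_mem (has i.1) (subst_sumElim_mem_seriesOver hzs hz0 has (fun u i => (ha u i).2) _)

/-- The only division is by `g(z)²`, of constant order `2 * d`, in the determined component. The
inversion of `a ↦ a + p(z, a)` is the evaluation of a fixed power series. -/
theorem rationallyTextileOn_factorInv (hF : ∀ j, F j ∈ Q.series (Option (Fin m))) :
    RationallyTextileOn (factorInv F c p) (prodArcs Q (zStar Q F c d) (Rest c)) := by
  set V := prodArcs Q (zStar Q F c d) (Rest c)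
  set z : V → Fin m → K⟦X⟧ := fun w i => w.1 (Sum.inl i) with hzdef
  set b₂ : V → Rest c → K⟦X⟧ := fun w i => w.1 (Sum.inr i) with hbdef
  have hst : ∀ w : V, (z w, determined F c (z w), b₂ w) ∈ straightened Q F c d :=
    fun w => mem_straightened_of_mem_prodArcs hF w.2
  have hz : ∀ w, z w ∈ zStar Q F c d := fun w => (hst w).1
  have hza : ∀ w, z w ∈ arcs Q (Fin m) := fun w => polyVecs_subset_arcs (hz w).1
  have hz0 : ∀ w i, PowerSeries.constantCoeff (z w i) = 0 := fun w i => (hza w i).2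
  have hzs : ∀ i, (fun w => z w i) ∈ seriesOver (ratFunctions fun w : V => coeffs w.1) :=
    fun i => coeffs_mem_seriesOver_ratFunctions V (Sum.inl i)
  have hbs : ∀ i, (fun w => b₂ w i) ∈ seriesOver (ratFunctions fun w : V => coeffs w.1) :=
    fun i => coeffs_mem_seriesOver_ratFunctions V (Sum.inr i)
  have hes : ∀ l, (fun w => determined F c (z w) l) ∈
      seriesOver (ratFunctions fun w : V => coeffs w.1) := by
    intro l
    refine quotient_mem_seriesOver (D := 2 * d) (fun φ hφ => inv_mem_ratFunctions hφ)
      (neg_mem (adjAt_mulVec_evalVec_mem_seriesOver hzs hz0 l))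
      (pow_mem (subst_arc_mem_seriesOver hzs hz0 (minor F c)) 2) (fun w => ?_) fun w => ?_
    · rw [PowerSeries.order_pow, (hz w).2.1]
      simp
    · refine Dvd.intro (determined F c (z w) l) ?_
      have := congrFun (hst w).2.2.2 l
      rw [Pi.add_apply, Pi.smul_apply, smul_eq_mul, Pi.zero_apply] at this
      exact eq_neg_of_add_eq_zero_right this
  have hcs := combine_mem_seriesOver (c := c) (b₂ := b₂)
    (b₁ := fun w => determined F c (z w) - correction F c (z w) (b₂ w))
    (fun l => sub_mem (hes l) (correction_mem_seriesOver hzs hz0 hbs l)) hbs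
  have hc0 : ∀ w i, PowerSeries.constantCoeff
      (combine c (determined F c (z w) - correction F c (z w) (b₂ w)) (b₂ w) i) = 0 :=
    fun w i => (combine_mem_arcs (fun l => sub_mem_arcSeries ((hst w).2.1 l)
      (correction_mem_arcs hF (hza w) (hst w).2.2.1 l)) (hst w).2.2.1 i).2
  refine rationallyTextileOn_of_mem fun i => ?_
  exact add_mem (hzs i) (scale_mem_seriesOver hzs hz0
    (fun i => subst_sumElim_mem_seriesOver hzs hz0 hcs hc0 _) (gens F c) i)

end Factorization

/-! ### Locally closed sets -/

section LocallyClosed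

variable {Q : Quality K} {k m : ℕ} {F : Fin k → MvPowerSeries (Option (Fin m)) K}
  {c : Fin k ↪ Fin m}

theorem exists_zeros_iff {τ Y α : Type*} (e : Y → τ → K) {φ : α → Y → K}
    (hφ : ∀ a, φ a ∈ polyFunctions e) :
    ∃ S : Set (MvPolynomial τ K), ∀ y, e y ∈ zeros S ↔ ∀ a, φ a y = 0 := by
  choose P hP using fun a => mem_polyFunctions.mp (hφ a)
  exact ⟨Set.range P, fun y => by simp [zeros, hP]⟩

/-- The coefficients of `f(y)` and those of `g(y)` below `d` must vanish, and the coefficient of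
index `d` must not. These are all polynomial functions of the coefficients of `y`. -/
theorem isTextileLocallyClosed_zeroStratum (d : ℕ∞) :
    IsTextileLocallyClosed Q (zeroStratum Q F c d) := by
  have hy := coeffs_mem_seriesOver_polyFunctions fun y : arcs Q (Fin m) => y.1
  have hy0 : ∀ (y : arcs Q (Fin m)) i, PowerSeries.constantCoeff (y.1 i) = 0 :=
    fun y i => (y.2 i).2
  have hs := subst_arc_mem_seriesOver hy hy0
  have hS : ∃ S : Set (MvPolynomial (Fin m × ℕ) K), ∀ y : arcs Q (Fin m),
      coeffs y.1 ∈ zeros S ↔ evalVec F y.1 = 0 ∧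
        ∀ n : ℕ, (n : ℕ∞) < d → PowerSeries.coeff n (subst (minor F c) y.1) = 0 := by
    obtain ⟨S, hS⟩ := exists_zeros_iff (fun y : arcs Q (Fin m) => coeffs y.1)
      (φ := Sum.elim (fun (q : Fin k × ℕ) y => PowerSeries.coeff q.2 (subst (F q.1) y.1))
        fun (n : {n : ℕ // (n : ℕ∞) < d}) y => PowerSeries.coeff n.1 (subst (minor F c) y.1))
      (by rintro (q | n); exacts [hs _ _, hs _ _])
    refine ⟨S, fun y => (hS y).trans ?_⟩
    simp only [Sum.forall, Sum.elim_inl, Sum.elim_inr, Prod.forall, Subtype.forall, funext_iff,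
      Pi.zero_apply, evalVec, PowerSeries.ext_iff, map_zero]
  have hT : ∃ T : Set (MvPolynomial (Fin m × ℕ) K), ∀ y : arcs Q (Fin m),
      coeffs y.1 ∈ zeros T ↔
        ∃ n : ℕ, (n : ℕ∞) = d ∧ PowerSeries.coeff n (subst (minor F c) y.1) = 0 := by
    cases d with
    -- For infinite order nothing is removed: the constant polynomial one has no zeros.
    | top => exact ⟨{1}, fun y => by simp [zeros]⟩
    | coe d =>
      obtain ⟨T, hT⟩ := exists_zeros_iff (fun y : arcs Q (Fin m) => coeffs y.1)
        (φ := fun (_ : Unit) y => PowerSeries.coeff d (subst (minor F c) y.1)) fun _ => hs _ _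
      exact ⟨T, fun y => (hT y).trans (by simp)⟩
  obtain ⟨S, hS⟩ := hS
  obtain ⟨T, hT⟩ := hT
  refine ⟨S, T, ?_⟩
  ext y
  refine and_congr_right fun hya => ?_
  rw [Set.mem_sdiff, hS ⟨y, hya⟩, hT ⟨y, hya⟩, and_assoc]
  refine and_congr_right fun _ => ?_
  cases d with
  | top => 
    simp only [ENat.natCast_lt_top, forall_const, ENat.natCast_ne_top, false_and, exists_false, not_false_eq_true,
      and_true, PowerSeries.order_eq_top, PowerSeries.ext_iff, map_zero]
  | coe d => simp [PowerSeries.order_eq_nat, and_comm]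

/-- The condition `f(z) ∈ ∂_y f(z) · 𝒱_d` involves an existential quantifier; the criterion by the
adjugate replaces it by the vanishing of finitely many coefficients. -/
theorem isZariskiLocallyClosed_zStar (hF : ∀ j, F j ∈ Q.series (Option (Fin m))) (d : ℕ) :
    IsZariskiLocallyClosed (polyVec c d ⁻¹' zStar Q F c d) := by
  have hmem : ∀ x : PolyIdx c d → K, polyVec c d x ∈ polyVecs K c d :=
    fun x => (bijOn_polyVec c d).mapsTo (Set.mem_univ x)
  have hz : ∀ i, (fun x : PolyIdx c d → K => polyVec c d x i) ∈
      seriesOver (polyFunctions fun x : PolyIdx c d → K => x) := by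
    intro i n
    simp only [coeff_polyVec]
    split_ifs with h
    · exact coordinate_mem_polyFunctions (fun x : PolyIdx c d → K => x) _
    · exact zero_mem (polyFunctions _)
  have hz0 : ∀ (x : PolyIdx c d → K) i, PowerSeries.constantCoeff (polyVec c d x i) = 0 :=
    fun x i => (hmem x i).1
  have hs := subst_arc_mem_seriesOver hz hz0 (minor F c)
  obtain ⟨S, hS⟩ := exists_zeros_iff (fun x : PolyIdx c d → K => x)
    (φ := Sum.elim (fun (n : Fin d) x => PowerSeries.coeff n.1 (subst (minor F c) (polyVec c d x)))
      fun (q : Fin k × Fin (2 * d + 1)) x => PowerSeries.coeff q.2.1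
        ((adjAt F c (polyVec c d x)).mulVec (evalVec F (polyVec c d x)) q.1))
    (by
      rintro (n | q)
      exacts [hs _, adjAt_mulVec_evalVec_mem_seriesOver hz hz0 _ _])
  obtain ⟨T, hT⟩ := exists_zeros_iff (fun x : PolyIdx c d → K => x)
    (φ := fun (_ : Unit) x => PowerSeries.coeff d (subst (minor F c) (polyVec c d x)))
    fun _ => hs _
  refine ⟨S, T, ?_⟩
  ext x
  rw [Set.mem_preimage, mem_zStar_iff hF, Set.mem_sdiff, hS, hT, PowerSeries.order_eq_nat]
  simp only [hmem x, true_and, Sum.forall, Sum.elim_inl, Sum.elim_inr, Prod.forall,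
    Fin.forall_iff, Nat.lt_succ_iff, forall_const]
  tauto

end LocallyClosed

end Arquile

end

open Arquile in
theorem mainTheorem4 {K : Type*} [Field K] [PerfectField K] (Q : Quality K) {m k : ℕ}
    (f : Fin k → Q.series (Option (Fin m))) (I : Ideal (Q.series (Option (Fin m))))
    (hI : I = Ideal.span (Set.range f))
    (F : Fin k → MvPowerSeries (Option (Fin m)) K) (hF : F = underlying f)
    (c : Fin k ↪ Fin m) (g : MvPowerSeries (Option (Fin m)) K) (hgc : g = minor F c)
    (hg : g ≠ 0) :
    (variety Q I = ⋃ d : ℕ∞, stratum Q I g d) ∧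
    (∀ d e : ℕ∞, d ≠ e → Disjoint (stratum Q I g d) (stratum Q I g e)) ∧
    (∀ d : ℕ∞, IsTextileLocallyClosed Q (stratum Q I g d)) ∧
    IsDivisionModule Q F (gens F c) ∧
    ∀ p, IsTaylorRemainder Q F (gens F c) p → ∀ d : ℕ,
      Fintype.card (PolyIdx c d) = d * (2 * m - k) ∧
      IsZariskiLocallyClosed (polyVec c d ⁻¹' zStar Q F c d) ∧
      Set.BijOn (straighten F c p d) (stratum Q I g d) (straightened Q F c d) ∧
      Fintype.card (Rest c) = m - k ∧
      IsRationallyTextileIso (factorMap F c p d) (stratum Q I g d)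
        (prodArcs Q (zStar Q F c d) (Rest c)) ∧
      IsTAdicHomeo (factorMap F c p d) (stratum Q I g d)
        (prodArcs Q (zStar Q F c d) (Rest c)) ∧
      ∀ y ∈ stratum Q I g d, remainder c d y ∈ zStar Q F c d ∧
        (fun i => factorMap F c p d y (Sum.inl i)) = remainder c d y := by
  have hst : ∀ d : ℕ∞, stratum Q I g d = zeroStratum Q F c d := by
    subst hI hgc hF
    exact stratum_eq_zeroStratum f
  have hFQ : ∀ j, F j ∈ Q.series (Option (Fin m)) := by
    subst hF
    exact fun j => (f j).2
  refine ⟨?_, fun d e hde => ?_, fun d => ?_, ?_, fun p hp d => ?_⟩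
  · ext y
    simp [stratum]
  · exact Set.disjoint_left.mpr fun y hd he => hde (hd.2.symm.trans he.2)
  · rw [hst]
    exact isTextileLocallyClosed_zeroStratum d
  · exact isDivisionModule_gens c hFQ (hgc ▸ hg)
  · obtain ⟨hm, hm', hinv⟩ := invOn_factorInv (d := d) hFQ hp
    have h1 := rationallyTextileOn_factorMap (d := d) hFQ hp
    have h2 := rationallyTextileOn_factorInv (c := c) (d := d) (p := p) hFQ
    rw [hst]
    refine ⟨card_polyIdx c d, isZariskiLocallyClosed_zStar hFQ d, bijOn_straighten hFQ hp,
      card_rest c, ⟨_, hm, hm', hinv, h1, h2⟩,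
      ⟨_, hm, hm', hinv, h1.tAdicContinuousOn, h2.tAdicContinuousOn⟩, fun y hy => ?_⟩
    exact ⟨(exists_eq_remainder_add hFQ hp hy).1, ((mapsTo_straighten hFQ hp).2 y hy).2⟩
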